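/- Let $n\ge 1$, let $\Omega\subset\mathbb{R}^n$ be a bounded open set (in particular, any bounded domain), and let $\sigma\colon\Omega\to[0,\infty]$ be measurable. Write $D_0=\sigma^{-1}(\{0\})$ and $D_\infty=\sigma^{-1}(\{\infty\})$, and suppose that - $D_0$ and $D_\infty$ are open; - $\overline{D_0}$, $\overline{D_\infty}$ and $\partial\Omega$ are pairwise disjoint; - there are constants $0<m\le M<\infty$ with $m\le\sigma\le M$ almost everywhere in $\Omega\setminus(D_0\cup D_\infty)$; - $D_0$ has Lipschitz boundary, that is, near each of its boundary points it is, in suitable orthonormal coordinates, the region above the graph of a Lipschitz function. Let $1<p<\infty$ and $f\in W^{1,p}(\Omega)$. Let $W^{1,p}_0(\Omega)$ be the closure of $C_c^\infty(\Omega)$ in $W^{1,p}(\Omega)$, and for $u\in W^{1,p}(\Omega)$ put $$E(u)=\int_\Omega\sigma\,|\nabla u|^p\,dx\in[0,\infty],\qquad \infty\cdot 0=0,$$ where $\nabla u$ is the weak gradient. Then $E$ has a minimizer in $f+W^{1,p}_0(\Omega)$, and every minimizer $u$ has the following properties. 1. $E(u)<\infty$. 2. A function $v$ is a minimizer of $E$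 in $f+W^{1,p}_0(\Omega)$ if and only if $v-u\in W^{1,p}_0(\Omega)$ and $\nabla(v-u)=0$ almost everywhere in $\Omega\setminus D_0$. That is, the minimizer is unique exactly up to functions that have zero gradient outside $D_0$ and zero boundary values on $\partial\Omega$. 3. $\operatorname{div}(\sigma|\nabla u|^{p-2}\nabla u)=0$ in $U=\Omega\setminus(\overline{D_0}\cup\overline{D_\infty})$ in the weak sense: $\sigma|\nabla u|^{p-2}\nabla u$ is locally integrable in $U$, and $\int_U\sigma|\nabla u|^{p-2}\nabla u\cdot\nabla\varphi\,dx=0$ for all $\varphi\in C_c^\infty(U)$. 4. $\nabla u=0$ in $D_\infty$ in the weak sense. -/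

import Mathlib

open MeasureTheory Filter Topology
open scoped ENNReal NNReal ContDiff

/-- `φ ∈ C_c^∞(Ω)`. -/
structure IsTestFunction {n : ℕ} (Ω : Set (EuclideanSpace ℝ (Fin n)))
    (φ : EuclideanSpace ℝ (Fin n) → ℝ) : Prop where
  contDiff : ContDiff ℝ ∞ φ
  hasCompactSupport : HasCompactSupport φ
  tsupport_subset : tsupport φ ⊆ Ω

/-- `G` is a weak (distributional) gradient of `u` in the open set `Ω`:
both are locally integrable in `Ω`, and `∫_Ω u ∇φ = - ∫_Ω φ G` for all `φ ∈ C_c^∞(Ω)`. -/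
structure HasWeakGradient {n : ℕ} (Ω : Set (EuclideanSpace ℝ (Fin n)))
    (u : EuclideanSpace ℝ (Fin n) → ℝ)
    (G : EuclideanSpace ℝ (Fin n) → EuclideanSpace ℝ (Fin n)) : Prop where
  locallyIntegrableOn : LocallyIntegrableOn u Ω volume
  locallyIntegrableOn_grad : LocallyIntegrableOn G Ω volume
  integral_eq : ∀ φ : EuclideanSpace ℝ (Fin n) → ℝ, IsTestFunction Ω φ →
    ∫ x in Ω, u x • gradient φ x = - ∫ x in Ω, φ x • G x

open Classical in
/-- The weak gradient of `u` in `Ω` (a representative of it, which is unique up to null sets).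
It has the junk value `0` if `u` is not weakly differentiable in `Ω`. -/
noncomputable def weakGradient {n : ℕ} (Ω : Set (EuclideanSpace ℝ (Fin n)))
    (u : EuclideanSpace ℝ (Fin n) → ℝ) : EuclideanSpace ℝ (Fin n) → EuclideanSpace ℝ (Fin n) :=
  if h : ∃ G, HasWeakGradient Ω u G then h.choose else 0

/-- `u ∈ W^{1,p}(Ω)`. -/
structure MemSobolev {n : ℕ} (p : ℝ) (Ω : Set (EuclideanSpace ℝ (Fin n)))
    (u : EuclideanSpace ℝ (Fin n) → ℝ) : Prop where
  memLp : MemLp u (ENNReal.ofReal p) (volume.restrict Ω)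
  exists_hasWeakGradient : ∃ G, HasWeakGradient Ω u G
  memLp_weakGradient : MemLp (weakGradient Ω u) (ENNReal.ofReal p) (volume.restrict Ω)

/-- `u ∈ W^{1,p}_0(Ω)`: `u` is in the closure of `C_c^∞(Ω)` in `W^{1,p}(Ω)`. -/
structure MemSobolevZero {n : ℕ} (p : ℝ) (Ω : Set (EuclideanSpace ℝ (Fin n)))
    (u : EuclideanSpace ℝ (Fin n) → ℝ) : Prop where
  memSobolev : MemSobolev p Ω u
  exists_approx : ∃ φ : ℕ → EuclideanSpace ℝ (Fin n) → ℝ, (∀ k, IsTestFunction Ω (φ k)) ∧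
    Tendsto (fun k => eLpNorm (fun x => u x - φ k x) (ENNReal.ofReal p) (volume.restrict Ω))
      atTop (𝓝 0) ∧
    Tendsto (fun k => eLpNorm (fun x => weakGradient Ω u x - gradient (φ k) x)
      (ENNReal.ofReal p) (volume.restrict Ω)) atTop (𝓝 0)

/-- The set `D` has Lipschitz boundary: near each of its boundary points it is, for a suitable
direction `ν` of the vertical axis, the set of points that lie above the graph of a Lipschitz
function. The graph function takes the horizontal part `y - ⟪ν, y⟫ ν` of a point `y` as argument
(only its values on the hyperplane orthogonal to `ν` play a role). -/
def HasLipschitzBoundary {n : ℕ} (D : Set (EuclideanSpace ℝ (Fin n))) : Prop :=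
  ∀ x₀ ∈ frontier D, ∃ (ν : EuclideanSpace ℝ (Fin n)) (γ : EuclideanSpace ℝ (Fin n) → ℝ)
    (K : ℝ≥0) (r : ℝ), ‖ν‖ = 1 ∧ LipschitzWith K γ ∧ 0 < r ∧
      ∀ y ∈ Metric.ball x₀ r, (y ∈ D ↔ γ (y - inner ℝ ν y • ν) < inner ℝ ν y)

/-- The level set `σ⁻¹(c)` of a conductivity `σ : Ω → [0,∞]`. -/
def levelSet {n : ℕ} (Ω : Set (EuclideanSpace ℝ (Fin n)))
    (σ : EuclideanSpace ℝ (Fin n) → ℝ≥0∞) (c : ℝ≥0∞) : Set (EuclideanSpace ℝ (Fin n)) :=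
  {x ∈ Ω | σ x = c}

/-- The energy `∫_Ω σ |∇u|^p ∈ [0,∞]`, where `∞ · 0 = 0`. -/
noncomputable def pEnergy {n : ℕ} (p : ℝ) (Ω : Set (EuclideanSpace ℝ (Fin n)))
    (σ : EuclideanSpace ℝ (Fin n) → ℝ≥0∞) (u : EuclideanSpace ℝ (Fin n) → ℝ) : ℝ≥0∞ :=
  ∫⁻ x in Ω, σ x * ENNReal.ofReal (‖weakGradient Ω u x‖ ^ p)

/-- `u` minimizes the energy in the class `f + W^{1,p}_0(Ω)`. -/
def IsEnergyMinimizer {n : ℕ} (p : ℝ) (Ω : Set (EuclideanSpace ℝ (Fin n)))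
    (σ : EuclideanSpace ℝ (Fin n) → ℝ≥0∞) (f u : EuclideanSpace ℝ (Fin n) → ℝ) : Prop :=
  MemSobolevZero p Ω (u - f) ∧ ∀ v, MemSobolevZero p Ω (v - f) → pEnergy p Ω σ u ≤ pEnergy p Ω σ v

/-- `u` is a weak solution of `div (σ |∇u|^{p-2} ∇u) = 0` in the open set `U`, for a conductivity
`σ` that is finite in `U`: `u` is weakly differentiable, the flux `σ |∇u|^{p-2} ∇u` is locally
integrable (so that the integrals below exist) and has zero distributional divergence. -/
structure IsWeakSolution {n : ℕ} (p : ℝ) (U : Set (EuclideanSpace ℝ (Fin n)))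
    (σ : EuclideanSpace ℝ (Fin n) → ℝ≥0∞) (u : EuclideanSpace ℝ (Fin n) → ℝ) : Prop where
  exists_hasWeakGradient : ∃ G, HasWeakGradient U u G
  locallyIntegrableOn_flux : LocallyIntegrableOn
    (fun x => ((σ x).toReal * ‖weakGradient U u x‖ ^ (p - 2)) • weakGradient U u x) U volume
  integral_eq_zero : ∀ φ : EuclideanSpace ℝ (Fin n) → ℝ, IsTestFunction U φ →
    ∫ x in U, inner ℝ (((σ x).toReal * ‖weakGradient U u x‖ ^ (p - 2)) • weakGradient U u x)
      (gradient φ x) = 0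

/-! This is the direct method with one obstacle. The energy does not see `∇u` in `D₀`, and it does
not control `u` either: a piece of `Ω` enclosed by `D₀` can carry any constant at no cost.
Minimizing sequences need not be bounded in `W^{1,p}`, so only their gradients outside `D₀` are
followed.

Uniform convexity of `‖·‖ ^ p` (`exists_norm_sub_rpow_add_le`) is integrated against `σ`. Two
competitors with energies near the infimum then differ by a function of small energy, because their
midpoint is a competitor too (`exists_pEnergy_sub_le`). As `σ ≥ m` outside `D₀`, the gradients of a
minimizing sequence are Cauchy in `L^p(Ω \ D₀)`. Applied to two minimizers, the same estimate shows
that their gradients agree wherever `σ ≠ 0`.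

The limit must again be the gradient of an admissible function, which is
`IsReflectionCover.isClosed_map_gradientRestrict`; here the Lipschitz boundary enters. Replacing the
values in `D₀` by reflected values from outside keeps the gradient outside and bounds the Sobolev
norm by that gradient plus the `L^p` norm. On `W^{1,p}_0` of a bounded set the `L^p` norm is
dominated by a finite rank seminorm up to a small multiple of the Sobolev norm
(`exists_finite_rank_bound`, a quantitative Rellich theorem), and Peetre's lemma gives closed range.
Fatou's lemma on an almost everywhere convergent subsequence finishes existence, since `σ = 0` in
`D₀`.

The infimum is finite because `(1 - χ) f` is a competitor of finite energy when `χ = 1` near `D_∞`.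
Finite energy forces `∇u = 0` where `σ = ∞`. The equation is the first variation along test
functions supported in `U`, where `σ` is bounded. -/

/-! ### Test functions and calculus of weak gradients -/

section WeakGradients

variable {n : ℕ}

set_option hygiene false in
local notation "𝔼" => EuclideanSpace ℝ (Fin n)

variable {Ω U : Set 𝔼} {u v φ : 𝔼 → ℝ} {G H : 𝔼 → 𝔼}

namespace IsTestFunction

lemma continuous (h : IsTestFunction Ω φ) : Continuous φ := h.contDiff.continuous

lemma differentiable (h : IsTestFunction Ω φ) : Differentiable ℝ φ :=
  h.contDiff.differentiable (by simp)

lemma continuous_gradient (h : IsTestFunction Ω φ) : Continuous (gradient φ) :=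
  (LinearIsometryEquiv.continuous _).comp (h.contDiff.continuous_fderiv (by simp))

lemma mono (h : IsTestFunction U φ) (hU : U ⊆ Ω) : IsTestFunction Ω φ :=
  ⟨h.1, h.2, h.3.trans hU⟩

end IsTestFunction

lemma tsupport_gradient_subset (φ : 𝔼 → ℝ) : tsupport (gradient φ) ⊆ tsupport φ := by
  refine (closure_mono ?_).trans (closure_minimal (support_fderiv_subset ℝ (f := φ))
    (isClosed_tsupport φ))
  intro x hx
  simpa [gradient, Function.mem_support] using hx

namespace IsTestFunction

lemma hasCompactSupport_gradient (h : IsTestFunction Ω φ) : HasCompactSupport (gradient φ) :=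
  h.2.of_isClosed_subset (isClosed_tsupport _) (tsupport_gradient_subset φ)

lemma zero : IsTestFunction Ω (0 : 𝔼 → ℝ) :=
  ⟨contDiff_const, HasCompactSupport.zero, by simp [tsupport]⟩

lemma add {ψ : 𝔼 → ℝ} (h : IsTestFunction Ω φ) (h' : IsTestFunction Ω ψ) :
    IsTestFunction Ω (φ + ψ) :=
  ⟨h.1.add h'.1, h.2.add h'.2, (tsupport_add φ ψ).trans (Set.union_subset h.3 h'.3)⟩

lemma const_smul (c : ℝ) (h : IsTestFunction Ω φ) : IsTestFunction Ω (c • φ) :=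
  ⟨h.1.const_smul c, h.2.smul_left (f := fun _ => c),
    (closure_mono (Function.support_const_smul_subset c φ)).trans h.3⟩

lemma gradient_add {ψ : 𝔼 → ℝ} (h : IsTestFunction Ω φ) (h' : IsTestFunction Ω ψ) :
    gradient (φ + ψ) = gradient φ + gradient ψ := by
  ext1 x
  simp [gradient, fderiv_add (h.differentiable x) (h'.differentiable x)]

lemma gradient_const_smul (c : ℝ) (h : IsTestFunction Ω φ) :
    gradient (c • φ) = c • gradient φ := by
  ext1 x
  simp [gradient, fderiv_const_smul (h.differentiable x)]

lemma mul_left {χ : 𝔼 → ℝ} (hχ : ContDiff ℝ ∞ χ) (h : IsTestFunction Ω φ) :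
    IsTestFunction Ω (χ * φ) :=
  ⟨hχ.mul h.1, h.2.mul_left, (tsupport_mul_subset_right).trans h.3⟩

end IsTestFunction

lemma integrableOn_smul_of_locallyIntegrableOn {F : Type*} [NormedAddCommGroup F] [NormedSpace ℝ F]
    {u : 𝔼 → ℝ} {g : 𝔼 → F} (hu : LocallyIntegrableOn u Ω volume) (hg : Continuous g)
    (hc : HasCompactSupport g) (hs : tsupport g ⊆ Ω) :
    Integrable (fun x => u x • g x) := by
  have h1 : IntegrableOn (fun x => u x • g x) (tsupport g) :=
    (hu.integrableOn_compact_subset hs hc).smul_continuousOn hg.continuousOn hc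
  rw [← integrableOn_univ]
  exact h1.of_forall_sdiff_eq_zero MeasurableSet.univ
    (fun x hx => by simp [image_eq_zero_of_notMem_tsupport hx.2])

lemma integrableOn_smul_of_locallyIntegrableOn' {F : Type*} [NormedAddCommGroup F]
    [NormedSpace ℝ F] {g : 𝔼 → ℝ} {u : 𝔼 → F} (hu : LocallyIntegrableOn u Ω volume)
    (hg : Continuous g) (hc : HasCompactSupport g) (hs : tsupport g ⊆ Ω) :
    Integrable (fun x => g x • u x) := by
  have h1 : IntegrableOn (fun x => g x • u x) (tsupport g) :=
    (hu.integrableOn_compact_subset hs hc).continuousOn_smul hg.continuousOn hc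
  rw [← integrableOn_univ]
  exact h1.of_forall_sdiff_eq_zero MeasurableSet.univ
    (fun x hx => by simp [image_eq_zero_of_notMem_tsupport hx.2])

namespace HasWeakGradient

lemma integrable_smul_gradient (h : HasWeakGradient Ω u G) (hφ : IsTestFunction Ω φ) :
    Integrable (fun x => u x • gradient φ x) :=
  integrableOn_smul_of_locallyIntegrableOn h.1 hφ.continuous_gradient hφ.hasCompactSupport_gradient
    ((tsupport_gradient_subset φ).trans hφ.3)

lemma integrable_smul (h : HasWeakGradient Ω u G) (hφ : IsTestFunction Ω φ) :
    Integrable (fun x => φ x • G x) :=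
  integrableOn_smul_of_locallyIntegrableOn' h.2 hφ.continuous hφ.2 hφ.3

/-- Test functions vanish outside `Ω`, so the defining identity can be written over the whole space.
In this form it no longer refers to `Ω`, and passing to smaller open sets is immediate. -/
lemma integral_univ_eq (h : HasWeakGradient Ω u G) (hφ : IsTestFunction Ω φ) :
    ∫ x, u x • gradient φ x = - ∫ x, φ x • G x := by
  have h1 := h.3 φ hφ
  rwa [setIntegral_eq_integral_of_forall_compl_eq_zero,
    setIntegral_eq_integral_of_forall_compl_eq_zero] at h1
  · intro x hx
    rw [image_eq_zero_of_notMem_tsupport (fun h => hx (hφ.3 h)), zero_smul]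
  · intro x hx
    rw [image_eq_zero_of_notMem_tsupport (f := gradient φ)
      (fun h => hx (hφ.3 (tsupport_gradient_subset φ h))), smul_zero]

lemma of_integral_univ_eq (hu : LocallyIntegrableOn u Ω volume)
    (hG : LocallyIntegrableOn G Ω volume)
    (h : ∀ φ, IsTestFunction Ω φ → ∫ x, u x • gradient φ x = - ∫ x, φ x • G x) :
    HasWeakGradient Ω u G := by
  refine ⟨hu, hG, fun φ hφ => ?_⟩
  rw [setIntegral_eq_integral_of_forall_compl_eq_zero,
    setIntegral_eq_integral_of_forall_compl_eq_zero, h φ hφ]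
  · intro x hx
    rw [image_eq_zero_of_notMem_tsupport (fun h => hx (hφ.3 h)), zero_smul]
  · intro x hx
    rw [image_eq_zero_of_notMem_tsupport (f := gradient φ)
      (fun h => hx (hφ.3 (tsupport_gradient_subset φ h))), smul_zero]

lemma mono (h : HasWeakGradient Ω u G) (hU : U ⊆ Ω) : HasWeakGradient U u G :=
  of_integral_univ_eq (h.1.mono_set hU) (h.2.mono_set hU)
    fun _ hφ => h.integral_univ_eq (hφ.mono hU)

/-- The difference of two weak gradients is annihilated by all test functions, so the fundamental
lemma of the calculus of variations applies. The choice made in `weakGradient` is therefore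
harmless. -/
lemma ae_unique (hΩ : IsOpen Ω) (h : HasWeakGradient Ω u G) (h' : HasWeakGradient Ω u H) :
    G =ᵐ[volume.restrict Ω] H := by
  have := hΩ.ae_eq_zero_of_integral_contDiff_smul_eq_zero (h.2.sub h'.2) (fun φ h1 h2 h3 => by
    have hφ : IsTestFunction Ω φ := ⟨h1, h2, h3⟩
    simp only [Pi.sub_apply, smul_sub]
    rw [integral_sub (h.integrable_smul hφ) (h'.integrable_smul hφ), sub_eq_zero]
    have := (h.integral_univ_eq hφ).symm.trans (h'.integral_univ_eq hφ)
    simpa using this)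
  rw [EventuallyEq, ae_restrict_iff' hΩ.measurableSet]
  filter_upwards [this] with x hx hxΩ
  simpa [sub_eq_zero] using hx hxΩ

lemma congr_ae (h : HasWeakGradient Ω u G)
    (hu : u =ᵐ[volume.restrict Ω] v) (hG : G =ᵐ[volume.restrict Ω] H) :
    HasWeakGradient Ω v H := by
  refine ⟨?_, ?_, fun φ hφ => ?_⟩
  · intro x hx
    obtain ⟨s, hs, hi⟩ := h.1 x hx
    refine ⟨s ∩ Ω, inter_mem hs self_mem_nhdsWithin, ?_⟩
    refine (hi.mono_set Set.inter_subset_left).congr ?_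
    exact ae_mono (Measure.restrict_mono Set.inter_subset_right le_rfl) hu
  · intro x hx
    obtain ⟨s, hs, hi⟩ := h.2 x hx
    refine ⟨s ∩ Ω, inter_mem hs self_mem_nhdsWithin, ?_⟩
    refine (hi.mono_set Set.inter_subset_left).congr ?_
    exact ae_mono (Measure.restrict_mono Set.inter_subset_right le_rfl) hG
  · have h1 : ∫ x in Ω, u x • gradient φ x = ∫ x in Ω, v x • gradient φ x :=
      integral_congr_ae (by filter_upwards [hu] with x hx; rw [hx])
    have h2 : ∫ x in Ω, φ x • G x = ∫ x in Ω, φ x • H x :=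
      integral_congr_ae (by filter_upwards [hG] with x hx; rw [hx])
    rw [← h1, ← h2, h.3 φ hφ]

lemma add (h : HasWeakGradient Ω u G) (h' : HasWeakGradient Ω v H) :
    HasWeakGradient Ω (u + v) (G + H) := by
  refine of_integral_univ_eq (h.1.add h'.1) (h.2.add h'.2) fun φ hφ => ?_
  simp only [Pi.add_apply, add_smul, smul_add]
  rw [integral_add (h.integrable_smul_gradient hφ) (h'.integrable_smul_gradient hφ),
    integral_add (h.integrable_smul hφ) (h'.integrable_smul hφ), h.integral_univ_eq hφ,
    h'.integral_univ_eq hφ, neg_add]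

lemma const_smul (c : ℝ) (h : HasWeakGradient Ω u G) :
    HasWeakGradient Ω (c • u) (c • G) := by
  refine of_integral_univ_eq (h.1.smul c) (h.2.smul c) fun φ hφ => ?_
  simp only [Pi.smul_apply, smul_assoc]
  simp_rw [fun x => smul_comm (φ x) c (G x)]
  rw [integral_smul, integral_smul, h.integral_univ_eq hφ, smul_neg]

lemma sub (h : HasWeakGradient Ω u G) (h' : HasWeakGradient Ω v H) :
    HasWeakGradient Ω (u - v) (G - H) := by
  have := h.add (h'.const_smul (-1))
  simpa [sub_eq_add_neg] using this

lemma hasWeakGradient_weakGradient (h : ∃ G, HasWeakGradient Ω u G) :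
    HasWeakGradient Ω u (weakGradient Ω u) := by
  rw [weakGradient, dif_pos h]
  exact h.choose_spec

lemma weakGradient_ae_eq (h : HasWeakGradient Ω u G) (hΩ : IsOpen Ω) :
    weakGradient Ω u =ᵐ[volume.restrict Ω] G :=
  (hasWeakGradient_weakGradient ⟨G, h⟩).ae_unique hΩ h

end HasWeakGradient

namespace MemSobolev

variable {p : ℝ}

lemma hasWeakGradient (h : MemSobolev p Ω u) : HasWeakGradient Ω u (weakGradient Ω u) :=
  HasWeakGradient.hasWeakGradient_weakGradient h.2

lemma of_hasWeakGradient (hΩ : IsOpen Ω) (h : HasWeakGradient Ω u G)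
    (hu : MemLp u (ENNReal.ofReal p) (volume.restrict Ω))
    (hG : MemLp G (ENNReal.ofReal p) (volume.restrict Ω)) : MemSobolev p Ω u :=
  ⟨hu, ⟨G, h⟩, hG.ae_eq (h.weakGradient_ae_eq hΩ).symm⟩

lemma add (hΩ : IsOpen Ω) (h : MemSobolev p Ω u) (h' : MemSobolev p Ω v) :
    MemSobolev p Ω (u + v) :=
  of_hasWeakGradient hΩ (h.hasWeakGradient.add h'.hasWeakGradient) (h.1.add h'.1) (h.3.add h'.3)

end MemSobolev

end WeakGradients

/-! ### Mollification and density of test functions -/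

section Mollification

variable {n : ℕ}

set_option hygiene false in
local notation "𝔼" => EuclideanSpace ℝ (Fin n)

variable {F : Type*} [NormedAddCommGroup F] {q : ℝ≥0∞}

/-- Minkowski's integral inequality for averages: Jensen's inequality moves the power `q` inside the
average over the probability measure `μ`, and Tonelli exchanges the integrals. -/
lemma eLpNorm_le_of_enorm_le_lintegral {T : Type*} [MeasurableSpace T] {μ : Measure T}
    [IsProbabilityMeasure μ] (hq1 : 1 ≤ q) (hq : q ≠ ⊤) {F' : Type*} [NormedAddCommGroup F']
    {f : 𝔼 → F'} {H : 𝔼 → T → F} (hH : AEStronglyMeasurable (Function.uncurry H) (volume.prod μ))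
    (hfH : ∀ x, ‖f x‖ₑ ≤ ∫⁻ t, ‖H x t‖ₑ ∂μ) {C : ℝ≥0∞}
    (hC : ∀ᵐ t ∂μ, eLpNorm (fun x => H x t) q volume ≤ C) :
    eLpNorm f q volume ≤ C := by
  have hq0 : q ≠ 0 := (zero_lt_one.trans_le hq1).ne'
  have hr0 : 0 < q.toReal := ENNReal.toReal_pos hq0 hq
  have key : ∫⁻ x, ‖f x‖ₑ ^ q.toReal ≤ C ^ q.toReal := by
    calc ∫⁻ x, ‖f x‖ₑ ^ q.toReal ≤ ∫⁻ x, ∫⁻ t, ‖H x t‖ₑ ^ q.toReal ∂μ := by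
          refine lintegral_mono_ae ?_
          filter_upwards [hH.prodMk_left] with x hx
          have h1 := eLpNorm_le_eLpNorm_of_exponent_le hq1 hx
          rw [eLpNorm_one_eq_lintegral_enorm, eLpNorm_eq_lintegral_rpow_enorm_toReal hq0 hq] at h1
          have h2 := ENNReal.rpow_le_rpow ((hfH x).trans h1) hr0.le
          rwa [← ENNReal.rpow_mul, one_div, inv_mul_cancel₀ hr0.ne', ENNReal.rpow_one] at h2
      _ = ∫⁻ t, ∫⁻ x, ‖H x t‖ₑ ^ q.toReal ∂volume ∂μ :=
          lintegral_lintegral_swap (hH.enorm.pow_const _)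
      _ ≤ ∫⁻ _, C ^ q.toReal ∂μ := by
          refine lintegral_mono_ae ?_
          filter_upwards [hC] with t ht
          have h2 := ENNReal.rpow_le_rpow ht hr0.le
          rwa [eLpNorm_eq_lintegral_rpow_enorm_toReal hq0 hq,
            ← ENNReal.rpow_mul, one_div, inv_mul_cancel₀ hr0.ne', ENNReal.rpow_one] at h2
      _ = C ^ q.toReal := by simp
  rw [eLpNorm_eq_lintegral_rpow_enorm_toReal hq0 hq]
  calc _ ≤ (C ^ q.toReal) ^ (1 / q.toReal) := ENNReal.rpow_le_rpow key (by positivity)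
    _ = C := by rw [← ENNReal.rpow_mul, one_div, mul_inv_cancel₀ hr0.ne', ENNReal.rpow_one]

/-- Continuity of translation in `L^q`, obtained from the continuity of composition with measure
preserving maps, for the continuous family `t ↦ (x ↦ x - t)`. -/
lemma exists_eLpNorm_sub_translate_le (hq1 : 1 ≤ q) (hq : q ≠ ⊤) {g : 𝔼 → F}
    (hg : MemLp g q volume) {ε : ℝ≥0∞} (hε : ε ≠ 0) :
    ∃ δ > 0, ∀ t : 𝔼, ‖t‖ < δ → eLpNorm (fun x => g x - g (x - t)) q volume ≤ ε := by
  have : Fact (1 ≤ q) := ⟨hq1⟩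
  let Φ : C(𝔼 × 𝔼, 𝔼) := ⟨fun z => z.2 - z.1, by fun_prop⟩
  have hmp : ∀ t, MeasurePreserving (Φ.curry t) volume volume := fun t =>
    measurePreserving_sub_right volume t
  have h1 := (tendsto_const_nhds (x := hg.toLp g) (f := 𝓝 (0 : 𝔼))).compMeasurePreservingLp
    (Φ.curry.continuous.tendsto 0) hmp (hmp 0) hq
  rw [Lp.tendsto_Lp_iff_tendsto_eLpNorm'] at h1
  have h2 : ∀ t, eLpNorm (⇑(Lp.compMeasurePreserving (Φ.curry t) (hmp t) (hg.toLp g)) -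
      ⇑(Lp.compMeasurePreserving (Φ.curry 0) (hmp 0) (hg.toLp g))) q volume
      = eLpNorm (fun x => g x - g (x - t)) q volume := by
    intro t
    rw [eLpNorm_sub_comm]
    have h3 : ∀ t, ⇑(Lp.compMeasurePreserving (Φ.curry t) (hmp t) (hg.toLp g))
        =ᵐ[volume] fun x => g (x - t) := by
      intro t
      refine (Lp.coeFn_compMeasurePreserving _ (hmp t)).trans ?_
      exact (hmp t).quasiMeasurePreserving.ae_eq_comp hg.coeFn_toLp
    refine eLpNorm_congr_ae ?_
    filter_upwards [h3 t, h3 0] with x hx hx0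
    rw [Pi.sub_apply, hx, hx0, sub_zero]
  simp_rw [h2] at h1
  have h4 := h1.eventually (Iic_mem_nhds (pos_iff_ne_zero.mpr hε))
  obtain ⟨δ, hδ, h5⟩ := Metric.eventually_nhds_iff.mp h4
  exact ⟨δ, hδ, fun t ht => h5 (by simpa using ht)⟩

variable [NormedSpace ℝ F]

/-- As `η` has integral one, `g - η * g` is the average of `g - g(· - t)` over the probability
measure `η(t) dt`, so the mollification error is at most the worst translation error on the support
of `η`. -/
lemma eLpNorm_sub_convolution_le [CompleteSpace F] (hq1 : 1 ≤ q) (hq : q ≠ ⊤) {η : 𝔼 → ℝ}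
    (hη0 : ∀ x, 0 ≤ η x) (hηc : Continuous η) (hηs : HasCompactSupport η) (hη1 : ∫ x, η x = 1)
    {g : 𝔼 → F} (hg : MemLp g q volume) {C : ℝ≥0∞}
    (hC : ∀ t ∈ Function.support η, eLpNorm (fun x => g x - g (x - t)) q volume ≤ C) :
    eLpNorm (fun x => g x - convolution η g (ContinuousLinearMap.lsmul ℝ ℝ) volume x) q volume
      ≤ C := by
  have hηi : Integrable η := hηc.integrable_of_hasCompactSupport hηs
  let μ : Measure 𝔼 := volume.withDensity fun t => ENNReal.ofReal (η t)
  have hηm : Measurable fun t => ENNReal.ofReal (η t) := hηc.measurable.ennreal_ofReal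
  have : IsProbabilityMeasure μ := ⟨by
    rw [withDensity_apply _ MeasurableSet.univ, Measure.restrict_univ,
      ← ofReal_integral_eq_lintegral_ofReal hηi (ae_of_all _ hη0), hη1, ENNReal.ofReal_one]⟩
  have hμ : μ ≪ volume := withDensity_absolutelyContinuous _ _
  have hH : AEStronglyMeasurable (Function.uncurry fun x t => g x - g (x - t))
      (volume.prod μ) := by
    have h1 : AEStronglyMeasurable (fun z : 𝔼 × 𝔼 => g z.1) (volume.prod μ) := hg.1.comp_fst
    have h2 : AEStronglyMeasurable (fun z : 𝔼 × 𝔼 => g (z.1 - z.2)) (volume.prod μ) :=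
      hg.1.comp_quasiMeasurePreserving (quasiMeasurePreserving_sub_of_right_invariant volume μ)
    exact h1.sub h2
  refine eLpNorm_le_of_enorm_le_lintegral (μ := μ) hq1 hq hH (fun x => ?_) ?_
  · have hm : AEStronglyMeasurable (fun t => g (x - t)) volume :=
      hg.1.comp_quasiMeasurePreserving (Measure.measurePreserving_sub_left volume x).quasiMeasurePreserving
    have hconv : Integrable (fun t => η t • g (x - t)) :=
      (HasCompactSupport.convolutionExists_left (ContinuousLinearMap.lsmul ℝ ℝ) hηs hηc
        (hg.locallyIntegrable hq1) x).integrable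
    have h1 : g x - convolution η g (ContinuousLinearMap.lsmul ℝ ℝ) volume x
        = ∫ t, η t • (g x - g (x - t)) := by
      simp_rw [smul_sub]
      rw [integral_sub (hηi.smul_const _) hconv, integral_smul_const, hη1, one_smul]
      rfl
    rw [h1]
    refine (enorm_integral_le_lintegral_enorm _).trans (le_of_eq ?_)
    have hm' : AEMeasurable (fun t => ‖g x - g (x - t)‖ₑ) volume :=
      (aestronglyMeasurable_const.sub hm).enorm
    rw [lintegral_withDensity_eq_lintegral_mul₀ hηm.aemeasurable hm']
    refine lintegral_congr fun t => ?_
    rw [enorm_smul, Pi.mul_apply, Real.enorm_of_nonneg (hη0 t)]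
  · rw [ae_withDensity_iff hηm]
    refine ae_of_all _ fun t ht => hC t ?_
    rintro h
    simp [h] at ht

/-- By the fundamental theorem of calculus the difference is an average over `s ∈ (0, 1]` of `Dφ(x -
t + s t) t`, and translation invariance makes the norm of each of these independent of `s`. -/
lemma eLpNorm_sub_translate_le (hq1 : 1 ≤ q) (hq : q ≠ ⊤) {φ : 𝔼 → ℝ} (hφ : ContDiff ℝ 1 φ)
    (t : 𝔼) :
    eLpNorm (fun x => φ x - φ (x - t)) q volume ≤ ‖t‖ₑ * eLpNorm (gradient φ) q volume := by
  let μ : Measure ℝ := volume.restrict (Set.Ioc 0 1)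
  have : IsProbabilityMeasure μ := ⟨by simp [μ]⟩
  have hc : Continuous (fderiv ℝ φ) := hφ.continuous_fderiv (by simp)
  have hcu : Continuous fun z : 𝔼 × ℝ => fderiv ℝ φ (z.1 - t + z.2 • t) t := by fun_prop
  refine eLpNorm_le_of_enorm_le_lintegral (μ := μ) hq1 hq (H := fun x s =>
    fderiv ℝ φ (x - t + s • t) t) hcu.aestronglyMeasurable (fun x => ?_) ?_
  · have hd : ∀ s ∈ Set.uIcc (0 : ℝ) 1, HasDerivAt (fun s : ℝ => φ (x - t + s • t))
        (fderiv ℝ φ (x - t + s • t) t) s := by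
      intro s _
      have h1 : HasDerivAt (fun s : ℝ => x - t + s • t) t s := by
        simpa using ((hasDerivAt_id s).smul_const t).const_add (x - t)
      exact ((hφ.differentiable (by simp)) _).hasFDerivAt.comp_hasDerivAt s h1
    have h2 := intervalIntegral.integral_eq_sub_of_hasDerivAt hd
      (Continuous.intervalIntegrable (by fun_prop) 0 1)
    have h3 : φ x - φ (x - t) = ∫ s, fderiv ℝ φ (x - t + s • t) t ∂μ := by
      rw [intervalIntegral.integral_of_le zero_le_one] at h2
      rw [h2]
      simp
    rw [h3]
    exact enorm_integral_le_lintegral_enorm _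
  · refine ae_of_all _ fun s => ?_
    have h1 : eLpNorm (fun x => fderiv ℝ φ (x - t + s • t) t) q volume
        = eLpNorm (fun x => fderiv ℝ φ x t) q volume := by
      have hmp : MeasurePreserving (fun x : 𝔼 => x - t + s • t) volume volume := by
        simpa [sub_eq_add_neg, add_assoc] using
          measurePreserving_add_right (volume : Measure 𝔼) (-t + s • t)
      exact eLpNorm_comp_measurePreserving (g := fun x => fderiv ℝ φ x t)
        (by fun_prop : Continuous fun x => fderiv ℝ φ x t).aestronglyMeasurable hmp
    rw [h1, ← ofReal_norm]
    refine eLpNorm_le_mul_eLpNorm_of_ae_le_mul (ae_of_all _ fun x => ?_) q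
    calc ‖fderiv ℝ φ x t‖ ≤ ‖fderiv ℝ φ x‖ * ‖t‖ := ContinuousLinearMap.le_opNorm _ _
      _ = ‖t‖ * ‖gradient φ x‖ := by rw [mul_comm, gradient, LinearIsometryEquiv.norm_map]

lemma exists_mollifier {δ : ℝ} (hδ : 0 < δ) : ∃ η : 𝔼 → ℝ, ContDiff ℝ ∞ η ∧ (∀ x, 0 ≤ η x) ∧
    HasCompactSupport η ∧ ∫ x, η x = 1 ∧ Function.support η ⊆ Metric.ball 0 δ := by
  let b : ContDiffBump (0 : 𝔼) := ⟨δ / 2, δ, by positivity, by linarith⟩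
  exact ⟨b.normed volume, b.contDiff_normed, b.nonneg_normed, b.hasCompactSupport_normed,
    b.integral_normed, b.support_normed_eq.le⟩

lemma HasWeakGradient.gradient_convolution {w : 𝔼 → ℝ} {G : 𝔼 → 𝔼}
    (h : HasWeakGradient Set.univ w G) {η : 𝔼 → ℝ} (hη : ContDiff ℝ ∞ η)
    (hηs : HasCompactSupport η) (x : 𝔼) :
    gradient (convolution η w (ContinuousLinearMap.lsmul ℝ ℝ) volume) x
      = convolution η G (ContinuousLinearMap.lsmul ℝ ℝ) volume x := by
  have hw : LocallyIntegrable w := locallyIntegrableOn_univ.mp h.1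
  have hd := hηs.hasFDerivAt_convolution_left (ContinuousLinearMap.lsmul ℝ ℝ)
    (hη.of_le (by simp)) hw x
  -- The weak gradient identity is tested with the reflected and translated mollifier. The minus
  -- sign in its gradient cancels the one from integration by parts.
  have hψ : IsTestFunction Set.univ fun y => η (x - y) :=
    ⟨hη.comp (contDiff_const.sub contDiff_id),
      hηs.comp_homeomorph (Homeomorph.subLeft x), Set.subset_univ _⟩
  have hgrad : ∀ y, gradient (fun y => η (x - y)) y = - gradient η (x - y) := by
    intro y
    have : fderiv ℝ (fun y => η (x - y)) y = - fderiv ℝ η (x - y) :=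
      (((hη.differentiable (by simp)) (x - y)).hasFDerivAt.comp y
        ((hasFDerivAt_id y).const_sub x)).fderiv.trans (by ext; simp)
    simp [gradient, this]
  have h1 := h.integral_univ_eq hψ
  simp_rw [hgrad, smul_neg] at h1
  rw [integral_neg, neg_inj] at h1
  rw [gradient, hd.fderiv, convolution_eq_swap, convolution_eq_swap]
  simp only [ContinuousLinearMap.lsmul_apply]
  rw [← h1]
  change (InnerProductSpace.toDual ℝ 𝔼).symm.toContinuousLinearEquiv.toContinuousLinearMap _ = _
  rw [← ContinuousLinearMap.integral_comp_comm]
  · refine integral_congr_ae (ae_of_all _ fun y => ?_)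
    simp only [gradient]
    rw [← map_smul]
    change (InnerProductSpace.toDual ℝ 𝔼).symm _ = _
    congr 1
    ext v
    simp [ContinuousLinearMap.precompL_apply, mul_comm]
  · exact (HasCompactSupport.convolutionExists_left _ (hηs.fderiv (𝕜 := ℝ))
      (hη.continuous_fderiv (by simp)) hw x).integrable_swap

/-- Weakly differentiable functions with compact support in an open set are limits of test
functions. -/
lemma HasWeakGradient.exists_isTestFunction_eLpNorm_sub_le (hq1 : 1 ≤ q) (hq : q ≠ ⊤)
    {w : 𝔼 → ℝ} {G : 𝔼 → 𝔼} (h : HasWeakGradient Set.univ w G) (hw : MemLp w q volume)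
    (hG : MemLp G q volume) {K Ω : Set 𝔼} (hK : IsCompact K) (hΩ : IsOpen Ω) (hKΩ : K ⊆ Ω)
    (hwK : Function.support w ⊆ K) {ε : ℝ≥0∞} (hε : ε ≠ 0) :
    ∃ φ, IsTestFunction Ω φ ∧ eLpNorm (fun x => w x - φ x) q volume ≤ ε ∧
      eLpNorm (fun x => G x - gradient φ x) q volume ≤ ε := by
  obtain ⟨δ₁, hδ₁, hδ₁w⟩ := exists_eLpNorm_sub_translate_le hq1 hq hw hε
  obtain ⟨δ₂, hδ₂, hδ₂G⟩ := exists_eLpNorm_sub_translate_le hq1 hq hG hε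
  obtain ⟨δ₃, hδ₃, hδ₃K⟩ := hK.exists_cthickening_subset_open hΩ hKΩ
  -- `δ₁` and `δ₂` make the errors for the function and its gradient small; `δ₃` keeps the support
  -- of the mollification inside `Ω`.
  obtain ⟨η, hη, hη0, hηs, hη1, hηb⟩ := exists_mollifier (n := n)
    (show 0 < min δ₁ (min δ₂ δ₃) by positivity)
  have hηn : ∀ t ∈ Function.support η, ‖t‖ < δ₁ ∧ ‖t‖ < δ₂ ∧ ‖t‖ < δ₃ := by
    intro t ht
    simpa using hηb ht
  have hts : tsupport (convolution η w (ContinuousLinearMap.lsmul ℝ ℝ) volume)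
      ⊆ Metric.cthickening δ₃ K := by
    refine closure_minimal ?_ Metric.isClosed_cthickening
    refine (support_convolution_subset _).trans ?_
    rintro _ ⟨a, ha, b, hb, rfl⟩
    refine Metric.mem_cthickening_of_dist_le _ b _ K (hwK hb) ?_
    simpa using (hηn a ha).2.2.le
  refine ⟨convolution η w (ContinuousLinearMap.lsmul ℝ ℝ) volume, ⟨?_, ?_, hts.trans hδ₃K⟩, ?_, ?_⟩
  · exact hηs.contDiff_convolution_left _ hη (locallyIntegrableOn_univ.mp h.1)
  · exact hK.cthickening.of_isClosed_subset (isClosed_tsupport _) hts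
  · exact eLpNorm_sub_convolution_le hq1 hq hη0 hη.continuous hηs hη1 hw
      fun t ht => hδ₁w t (hηn t ht).1
  · simp_rw [h.gradient_convolution hη hηs]
    exact eLpNorm_sub_convolution_le hq1 hq hη0 hη.continuous hηs hη1 hG
      fun t ht => hδ₂G t (hηn t ht).2.1

end Mollification

/-! ### Lipschitz functions as weakly differentiable functions -/

section Lipschitz

variable {n : ℕ}

set_option hygiene false in
local notation "𝔼" => EuclideanSpace ℝ (Fin n)

lemma norm_gradient_eq (f : 𝔼 → ℝ) (x : 𝔼) : ‖gradient f x‖ = ‖fderiv ℝ f x‖ := by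
  rw [gradient, LinearIsometryEquiv.norm_map]

lemma measurable_gradient (f : 𝔼 → ℝ) : Measurable (gradient f) :=
  (LinearIsometryEquiv.continuous _).measurable.comp (measurable_fderiv ℝ f)

variable {K : ℝ≥0} {f : 𝔼 → ℝ}

lemma LipschitzWith.norm_gradient_le (hf : LipschitzWith K f) (x : 𝔼) : ‖gradient f x‖ ≤ K := by
  rw [norm_gradient_eq]
  exact norm_fderiv_le_of_lipschitz ℝ hf

/-- By Rademacher's theorem the classical gradient exists almost everywhere and is bounded.
Integration by parts for line derivatives then gives the identity paired with each direction `e`. -/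
lemma LipschitzWith.hasWeakGradient (hf : LipschitzWith K f) :
    HasWeakGradient Set.univ f (gradient f) := by
  have hG : LocallyIntegrable (gradient f) := by
    refine (locallyIntegrable_const (K : ℝ)).mono (measurable_gradient f).aestronglyMeasurable
      (ae_of_all _ fun x => ?_)
    simpa using hf.norm_gradient_le x
  refine HasWeakGradient.of_integral_univ_eq (hf.continuous.locallyIntegrable.locallyIntegrableOn _)
    (hG.locallyIntegrableOn _) fun φ hφ => ?_
  have hi1 : Integrable fun x => f x • gradient φ x :=
    integrableOn_smul_of_locallyIntegrableOn
      (hf.continuous.locallyIntegrable.locallyIntegrableOn Set.univ)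
      hφ.continuous_gradient hφ.hasCompactSupport_gradient (Set.subset_univ _)
  have hi2 : Integrable fun x => φ x • gradient f x :=
    integrableOn_smul_of_locallyIntegrableOn' (hG.locallyIntegrableOn Set.univ)
      hφ.continuous hφ.2 (Set.subset_univ _)
  obtain ⟨C, hC⟩ := hφ.1.lipschitzWith_of_hasCompactSupport hφ.2 (by simp)
  refine ext_inner_left ℝ fun e => ?_
  rw [inner_neg_right, ← integral_inner hi1, ← integral_inner hi2]
  have h1 := hf.integral_lineDeriv_mul_eq (μ := volume) hC hφ.2 e
  have h2 : ∫ x, inner ℝ e (φ x • gradient f x) = ∫ x, lineDeriv ℝ f x e * φ x := by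
    refine integral_congr_ae ?_
    filter_upwards [hf.ae_differentiableAt] with x hx
    rw [hx.lineDeriv_eq_fderiv, real_inner_smul_right, real_inner_comm, inner_gradient_left,
      mul_comm]
  have h3 : ∫ x, inner ℝ e (f x • gradient φ x) = - ∫ x, lineDeriv ℝ φ x (-e) * f x := by
    rw [← integral_neg]
    refine integral_congr_ae (ae_of_all _ fun x => ?_)
    simp only
    rw [(hφ.differentiable x).lineDeriv_eq_fderiv, real_inner_smul_right, real_inner_comm,
      inner_gradient_left, map_neg]
    ring
  rw [h2, h3, h1]

lemma IsTestFunction.hasWeakGradient {Ω : Set 𝔼} {φ : 𝔼 → ℝ} (h : IsTestFunction Ω φ) :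
    HasWeakGradient Set.univ φ (gradient φ) := by
  obtain ⟨C, hC⟩ := h.1.lipschitzWith_of_hasCompactSupport h.2 (by simp)
  exact hC.hasWeakGradient

/-- At almost every point of `s` the derivative is determined by the values on `s`, because almost
every point is a density point. The set `s` may have empty interior, which makes gluing along a
frontier possible without knowing the measure of the frontier. -/
lemma LipschitzWith.gradient_ae_eq_zero (hf : LipschitzWith K f) {s : Set 𝔼}
    (hs : MeasurableSet s) (h0 : ∀ x ∈ s, f x = 0) :
    ∀ᵐ x ∂volume.restrict s, gradient f x = 0 := by
  rcases subsingleton_or_nontrivial 𝔼 with hE | hE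
  · exact ae_of_all _ fun x => Subsingleton.elim _ _
  obtain ⟨v, hv⟩ := exists_ne (0 : 𝔼)
  let t := {x | x ∈ s ∧ DifferentiableAt ℝ f x}
  have ht : MeasurableSet t := hs.inter (measurableSet_of_differentiableAt ℝ f)
  -- The derivative estimate used next concerns maps from the space to itself, so `f` is multiplied
  -- by a fixed nonzero vector. On `t` this map is approximated by the zero map with error constant
  -- `0`.
  have happ : ApproximatesLinearOn (fun x => f x • v) (0 : 𝔼 →L[ℝ] 𝔼) t 0 := by
    intro x hx y hy
    simp [h0 x hx.1, h0 y hy.1]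
  have h1 := happ.norm_fderiv_sub_le volume ht (fun x => (fderiv ℝ f x).smulRight v)
    (fun x hx => (hx.2.hasFDerivAt.smul_const v).hasFDerivWithinAt)
  rw [ae_restrict_iff' ht] at h1
  rw [ae_restrict_iff' hs]
  filter_upwards [h1, hf.ae_differentiableAt] with x hx hd hxs
  have h2 := hx ⟨hxs, hd⟩
  simp only [sub_zero, nonpos_iff_eq_zero, nnnorm_eq_zero] at h2
  have h3 : fderiv ℝ f x = 0 := by
    ext w
    have := DFunLike.congr_fun h2 w
    simpa [hv] using this
  simp [gradient, h3]

end Lipschitz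

/-! ### `W^{1,p}_0` as a closed subspace of pairs -/

section SobolevZero

variable {n : ℕ}

set_option hygiene false in
local notation "𝔼" => EuclideanSpace ℝ (Fin n)

/-- Integration of an `L^q` function against a bounded compactly supported function is continuous
on `L^q`. -/
lemma continuous_integral_smul_of_hasCompactSupport {q : ℝ≥0∞} [Fact (1 ≤ q)] {Ω : Set 𝔼}
    {F F₁ F₂ : Type*} [NormedAddCommGroup F] [NormedSpace ℝ F] [CompleteSpace F]
    [NormedAddCommGroup F₁] [NormedSpace ℝ F₁]
    [NormedAddCommGroup F₂] [NormedSpace ℝ F₂] (B : F₁ →L[ℝ] F₂ →L[ℝ] F) {g : 𝔼 → F₁}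
    (hg : Continuous g) (hc : HasCompactSupport g) :
    Continuous fun x : Lp F₂ q (volume.restrict Ω) => ∫ y in Ω, B (g y) (x y) := by
  have : Fact (1 ≤ q.conjExponent) := ⟨by simp [ENNReal.conjExponent]⟩
  have hgq : MemLp g q.conjExponent (volume.restrict Ω) := hg.memLp_of_hasCompactSupport hc
  have : q.conjExponent.HolderConjugate q := inferInstance
  convert ((B.lpPairing (volume.restrict Ω) q.conjExponent q) (hgq.toLp g)).continuous with x
  rw [ContinuousLinearMap.lpPairing_eq_integral]
  refine integral_congr_ae ?_
  filter_upwards [hgq.coeFn_toLp] with y hy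
  rw [hy]

variable (q : ℝ≥0∞) [Fact (1 ≤ q)] (Ω : Set (EuclideanSpace ℝ (Fin n)))

/-- The pairs `(φ, ∇φ)` for `φ ∈ C_c^∞(Ω)`, as elements of `L^q(Ω) × L^q(Ω; ℝⁿ)`. -/
noncomputable def testPairs : Submodule ℝ (Lp ℝ q ((volume : Measure 𝔼).restrict Ω) ×
    Lp 𝔼 q ((volume : Measure 𝔼).restrict Ω)) where
  carrier := {x | ∃ φ, IsTestFunction Ω φ ∧ x.1 =ᵐ[volume.restrict Ω] φ ∧
    x.2 =ᵐ[volume.restrict Ω] gradient φ}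
  zero_mem' := by
    refine ⟨0, IsTestFunction.zero, Lp.coeFn_zero _ _ _, ?_⟩
    filter_upwards [Lp.coeFn_zero 𝔼 q (volume.restrict Ω)] with x hx
    have h : gradient (0 : 𝔼 → ℝ) x = 0 := gradient_fun_const x (0 : ℝ)
    rw [h]
    exact hx
  add_mem' := by
    rintro x y ⟨φ, hφ, h1, h2⟩ ⟨ψ, hψ, h3, h4⟩
    refine ⟨φ + ψ, hφ.add hψ, (Lp.coeFn_add x.1 y.1).trans (h1.add h3), ?_⟩
    rw [hφ.gradient_add hψ]
    exact (Lp.coeFn_add x.2 y.2).trans (h2.add h4)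
  smul_mem' := by
    rintro c x ⟨φ, hφ, h1, h2⟩
    refine ⟨c • φ, hφ.const_smul c, (Lp.coeFn_smul c x.1).trans (h1.const_smul c), ?_⟩
    rw [hφ.gradient_const_smul]
    exact (Lp.coeFn_smul c x.2).trans (h2.const_smul c)

/-- The pairs `(u, ∇u)` for `u ∈ W^{1,q}_0(Ω)`, as elements of `L^q(Ω) × L^q(Ω; ℝⁿ)`. -/
noncomputable def sobolevZero : Submodule ℝ (Lp ℝ q ((volume : Measure 𝔼).restrict Ω) ×
    Lp 𝔼 q ((volume : Measure 𝔼).restrict Ω)) :=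
  (testPairs q Ω).topologicalClosure

variable {q Ω}

lemma IsTestFunction.memLp {φ : 𝔼 → ℝ} (h : IsTestFunction Ω φ) (q : ℝ≥0∞) (μ : Measure 𝔼)
    [IsFiniteMeasureOnCompacts μ] : MemLp φ q μ :=
  h.continuous.memLp_of_hasCompactSupport h.2

lemma IsTestFunction.memLp_gradient {φ : 𝔼 → ℝ} (h : IsTestFunction Ω φ) (q : ℝ≥0∞) (μ : Measure 𝔼)
    [IsFiniteMeasureOnCompacts μ] : MemLp (gradient φ) q μ :=
  h.continuous_gradient.memLp_of_hasCompactSupport h.hasCompactSupport_gradient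

lemma mem_sobolevZero_iff {x : Lp ℝ q ((volume : Measure 𝔼).restrict Ω) ×
    Lp 𝔼 q ((volume : Measure 𝔼).restrict Ω)} :
    x ∈ sobolevZero q Ω ↔ ∀ ε : ℝ≥0∞, ε ≠ 0 → ∃ φ, IsTestFunction Ω φ ∧
      eLpNorm (fun y => x.1 y - φ y) q (volume.restrict Ω) ≤ ε ∧
      eLpNorm (fun y => x.2 y - gradient φ y) q (volume.restrict Ω) ≤ ε := by
  rw [sobolevZero, ← SetLike.mem_coe, Submodule.topologicalClosure_coe, EMetric.mem_closure_iff]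
  constructor
  · intro h ε hε
    obtain ⟨y, ⟨φ, hφ, h1, h2⟩, hy⟩ := h ε (pos_iff_ne_zero.mpr hε)
    rw [Prod.edist_eq, max_lt_iff, Lp.edist_def, Lp.edist_def] at hy
    refine ⟨φ, hφ, ?_, ?_⟩
    · refine le_trans (le_of_eq (eLpNorm_congr_ae ?_)) hy.1.le
      filter_upwards [h1] with z hz
      rw [Pi.sub_apply, hz]
    · refine le_trans (le_of_eq (eLpNorm_congr_ae ?_)) hy.2.le
      filter_upwards [h2] with z hz
      rw [Pi.sub_apply, hz]
  · intro h ε hε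
    obtain ⟨ε', hε', hlt⟩ := exists_between hε
    obtain ⟨φ, hφ, h1, h2⟩ := h ε' hε'.ne'
    have hm1 := hφ.memLp q (volume.restrict Ω)
    have hm2 := hφ.memLp_gradient q (volume.restrict Ω)
    refine ⟨(hm1.toLp, hm2.toLp), ⟨φ, hφ, hm1.coeFn_toLp, hm2.coeFn_toLp⟩, ?_⟩
    rw [Prod.edist_eq, max_lt_iff, Lp.edist_def, Lp.edist_def]
    constructor
    · refine lt_of_eq_of_lt (eLpNorm_congr_ae ?_) (h1.trans_lt hlt)
      filter_upwards [hm1.coeFn_toLp] with z hz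
      simp only [Pi.sub_apply, hz]
    · refine lt_of_eq_of_lt (eLpNorm_congr_ae ?_) (h2.trans_lt hlt)
      filter_upwards [hm2.coeFn_toLp] with z hz
      simp only [Pi.sub_apply, hz]

lemma locallyIntegrableOn_of_memLp {F : Type*} [NormedAddCommGroup F] {g : 𝔼 → F}
    (hΩ : IsOpen Ω) (hg : MemLp g q (volume.restrict Ω)) : LocallyIntegrableOn g Ω volume := by
  rw [locallyIntegrableOn_iff hΩ.isLocallyClosed]
  intro K hK hKc
  have : IsFiniteMeasure (volume.restrict K) := ⟨by simpa using hKc.measure_lt_top⟩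
  exact ((hg.mono_measure (Measure.restrict_mono hK le_rfl)).integrable Fact.out)

/-- For a fixed test function both sides of the weak gradient identity are continuous in the pair,
so the identity passes from test pairs to their closure. -/
lemma hasWeakGradient_of_mem_sobolevZero (hΩ : IsOpen Ω)
    {x : Lp ℝ q ((volume : Measure 𝔼).restrict Ω) × Lp 𝔼 q ((volume : Measure 𝔼).restrict Ω)}
    (hx : x ∈ sobolevZero q Ω) : HasWeakGradient Ω x.1 x.2 := by
  refine ⟨locallyIntegrableOn_of_memLp hΩ (Lp.memLp x.1),
    locallyIntegrableOn_of_memLp hΩ (Lp.memLp x.2), fun φ hφ => ?_⟩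
  have hc1 : Continuous fun x : Lp ℝ q ((volume : Measure 𝔼).restrict Ω) =>
      ∫ y in Ω, x y • gradient φ y := by
    simpa using continuous_integral_smul_of_hasCompactSupport
      (ContinuousLinearMap.lsmul ℝ ℝ (E := 𝔼)).flip hφ.continuous_gradient
        hφ.hasCompactSupport_gradient
  have hc2 : Continuous fun x : Lp 𝔼 q ((volume : Measure 𝔼).restrict Ω) =>
      ∫ y in Ω, φ y • x y := by
    simpa using continuous_integral_smul_of_hasCompactSupport
      (ContinuousLinearMap.lsmul ℝ ℝ (E := 𝔼)) hφ.continuous hφ.2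
  have hcl := isClosed_eq (hc1.comp continuous_fst) (hc2.comp continuous_snd).neg
  refine closure_minimal (s := (testPairs q Ω : Set _)) ?_ hcl
    (by rwa [sobolevZero, ← SetLike.mem_coe, Submodule.topologicalClosure_coe] at hx)
  rintro y ⟨ψ, hψ, h1, h2⟩
  exact (((hψ.hasWeakGradient.mono (Set.subset_univ Ω)).congr_ae h1.symm h2.symm).3 φ hφ)

lemma exists_mem_sobolevZero (hq : q ≠ ⊤) {w : 𝔼 → ℝ} {G : 𝔼 → 𝔼}
    (h : HasWeakGradient Set.univ w G) (hw : MemLp w q volume)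
    (hG : MemLp G q volume) {K : Set 𝔼} (hK : IsCompact K) (hΩ : IsOpen Ω) (hKΩ : K ⊆ Ω)
    (hwK : Function.support w ⊆ K) :
    ∃ x ∈ sobolevZero q Ω, x.1 =ᵐ[volume.restrict Ω] w ∧ x.2 =ᵐ[volume.restrict Ω] G := by
  have hm1 := hw.restrict Ω
  have hm2 := hG.restrict Ω
  refine ⟨(hm1.toLp, hm2.toLp), ?_, hm1.coeFn_toLp, hm2.coeFn_toLp⟩
  rw [mem_sobolevZero_iff]
  intro ε hε
  obtain ⟨φ, hφ, h1, h2⟩ :=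
    h.exists_isTestFunction_eLpNorm_sub_le Fact.out hq hw hG hK hΩ hKΩ hwK hε
  refine ⟨φ, hφ, ?_, ?_⟩
  · refine le_trans (le_of_eq (eLpNorm_congr_ae ?_)) ((eLpNorm_restrict_le _ _ _ Ω).trans h1)
    filter_upwards [hm1.coeFn_toLp] with z hz
    simp only [hz]
  · refine le_trans (le_of_eq (eLpNorm_congr_ae ?_)) ((eLpNorm_restrict_le _ _ _ Ω).trans h2)
    filter_upwards [hm2.coeFn_toLp] with z hz
    simp only [hz]

variable {p : ℝ}

/-- The bridge between functions and elements of a Banach space. Linearity of the function class and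
completeness arguments are then inherited from the closed subspace. -/
lemma memSobolevZero_iff [Fact (1 ≤ ENNReal.ofReal p)] (hΩ : IsOpen Ω) {u : 𝔼 → ℝ} :
    MemSobolevZero p Ω u ↔ ∃ x ∈ sobolevZero (ENNReal.ofReal p) Ω,
      x.1 =ᵐ[volume.restrict Ω] u ∧ x.2 =ᵐ[volume.restrict Ω] weakGradient Ω u := by
  constructor
  · rintro ⟨h, φ, hφ, h1, h2⟩
    refine ⟨(h.1.toLp, h.3.toLp), ?_, h.1.coeFn_toLp, h.3.coeFn_toLp⟩
    rw [mem_sobolevZero_iff]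
    intro ε hε
    obtain ⟨k, hk1, hk2⟩ := ((h1.eventually (Iic_mem_nhds (pos_iff_ne_zero.mpr hε))).and
      (h2.eventually (Iic_mem_nhds (pos_iff_ne_zero.mpr hε)))).exists
    refine ⟨φ k, hφ k, ?_, ?_⟩
    · refine le_trans (le_of_eq (eLpNorm_congr_ae ?_)) hk1
      filter_upwards [h.1.coeFn_toLp] with z hz
      simp only [hz]
    · refine le_trans (le_of_eq (eLpNorm_congr_ae ?_)) hk2
      filter_upwards [h.3.coeFn_toLp] with z hz
      simp only [hz]
  · rintro ⟨x, hx, h1, h2⟩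
    have hw := (hasWeakGradient_of_mem_sobolevZero hΩ hx).congr_ae h1 h2
    refine ⟨MemSobolev.of_hasWeakGradient hΩ hw ((memLp_congr_ae h1).mp (Lp.memLp _))
      ((memLp_congr_ae h2).mp (Lp.memLp _)), ?_⟩
    rw [mem_sobolevZero_iff] at hx
    have hpos : ∀ k : ℕ, ((k : ℝ≥0∞) + 1)⁻¹ ≠ 0 := fun k =>
      ENNReal.inv_ne_zero.mpr (by finiteness)
    choose φ hφ hφ1 hφ2 using fun k : ℕ => hx _ (hpos k)
    have hlim : Tendsto (fun k : ℕ => ((k : ℝ≥0∞) + 1)⁻¹) atTop (𝓝 0) := by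
      have := (tendsto_add_atTop_iff_nat 1).mpr ENNReal.tendsto_inv_nat_nhds_zero
      simpa using this
    refine ⟨φ, hφ, ?_, ?_⟩
    · refine tendsto_of_tendsto_of_tendsto_of_le_of_le tendsto_const_nhds hlim
        (fun _ => zero_le) (fun k => ?_)
      refine le_trans (le_of_eq (eLpNorm_congr_ae ?_)) (hφ1 k)
      filter_upwards [h1] with z hz
      simp only [hz]
    · refine tendsto_of_tendsto_of_tendsto_of_le_of_le tendsto_const_nhds hlim
        (fun _ => zero_le) (fun k => ?_)
      refine le_trans (le_of_eq (eLpNorm_congr_ae ?_)) (hφ2 k)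
      filter_upwards [h2] with z hz
      simp only [hz]

lemma memSobolevZero_of_mem_sobolevZero [Fact (1 ≤ ENNReal.ofReal p)] (hΩ : IsOpen Ω) {u : 𝔼 → ℝ}
    {x : Lp ℝ (ENNReal.ofReal p) ((volume : Measure 𝔼).restrict Ω) ×
      Lp 𝔼 (ENNReal.ofReal p) ((volume : Measure 𝔼).restrict Ω)}
    (hx : x ∈ sobolevZero (ENNReal.ofReal p) Ω) (hu : x.1 =ᵐ[volume.restrict Ω] u) :
    MemSobolevZero p Ω u ∧ weakGradient Ω u =ᵐ[volume.restrict Ω] x.2 := by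
  have hw := (hasWeakGradient_of_mem_sobolevZero hΩ hx).congr_ae hu (ae_eq_refl _)
  have := hw.weakGradient_ae_eq hΩ
  exact ⟨(memSobolevZero_iff hΩ).mpr ⟨x, hx, hu, this.symm⟩, this⟩

namespace MemSobolevZero

variable [Fact (1 ≤ ENNReal.ofReal p)] {u v : 𝔼 → ℝ}

lemma add (hΩ : IsOpen Ω) (hu : MemSobolevZero p Ω u) (hv : MemSobolevZero p Ω v) :
    MemSobolevZero p Ω (u + v) := by
  obtain ⟨x, hx, hxu, -⟩ := (memSobolevZero_iff hΩ).mp hu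
  obtain ⟨y, hy, hyv, -⟩ := (memSobolevZero_iff hΩ).mp hv
  exact (memSobolevZero_of_mem_sobolevZero hΩ (Submodule.add_mem _ hx hy)
    ((Lp.coeFn_add x.1 y.1).trans (hxu.add hyv))).1

lemma const_smul (hΩ : IsOpen Ω) (c : ℝ) (hu : MemSobolevZero p Ω u) :
    MemSobolevZero p Ω (c • u) := by
  obtain ⟨x, hx, hxu, -⟩ := (memSobolevZero_iff hΩ).mp hu
  exact (memSobolevZero_of_mem_sobolevZero hΩ (Submodule.smul_mem _ c hx)
    ((Lp.coeFn_smul c x.1).trans (hxu.const_smul c))).1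

lemma sub (hΩ : IsOpen Ω) (hu : MemSobolevZero p Ω u) (hv : MemSobolevZero p Ω v) :
    MemSobolevZero p Ω (u - v) := by
  have := hu.add hΩ (hv.const_smul hΩ (-1))
  simpa [sub_eq_add_neg] using this

end MemSobolevZero

end SobolevZero

/-! ### A quantitative Rellich theorem -/

section Rellich

variable {n : ℕ}

set_option hygiene false in
local notation "𝔼" => EuclideanSpace ℝ (Fin n)

variable {q : ℝ≥0∞} [Fact (1 ≤ q)] {Ω : Set (EuclideanSpace ℝ (Fin n))}

lemma exists_clm_eq_integral_smul {g : 𝔼 → ℝ} (hg : Continuous g) (hc : HasCompactSupport g) :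
    ∃ ℓ : Lp ℝ q ((volume : Measure 𝔼).restrict Ω) →L[ℝ] ℝ, ∀ w, ℓ w = ∫ y in Ω, g y • w y := by
  have : Fact (1 ≤ q.conjExponent) := ⟨by simp [ENNReal.conjExponent]⟩
  have hgq : MemLp g q.conjExponent (volume.restrict Ω) := hg.memLp_of_hasCompactSupport hc
  have : q.conjExponent.HolderConjugate q := inferInstance
  refine ⟨((ContinuousLinearMap.lsmul ℝ ℝ (E := ℝ)).lpPairing (volume.restrict Ω)
    q.conjExponent q) (hgq.toLp g), fun w => ?_⟩
  rw [ContinuousLinearMap.lpPairing_eq_integral]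
  refine integral_congr_ae ?_
  filter_upwards [hgq.coeFn_toLp] with y hy
  rw [hy, ContinuousLinearMap.lsmul_apply]

lemma exists_integral_norm_le {α : Type*} [MeasurableSpace α] {μ : Measure α} [IsFiniteMeasure μ] :
    ∃ A : ℝ, 0 ≤ A ∧ ∀ w : Lp ℝ q μ, Integrable w μ ∧ ∫ y, ‖w y‖ ∂μ ≤ A * ‖w‖ := by
  refine ⟨(μ Set.univ ^ (1 / (1 : ℝ≥0∞).toReal - 1 / q.toReal)).toReal, ENNReal.toReal_nonneg,
    fun w => ?_⟩
  have hw := (Lp.memLp w)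
  refine ⟨hw.integrable Fact.out, ?_⟩
  have h1 := eLpNorm_le_eLpNorm_mul_rpow_measure_univ (Fact.out : 1 ≤ q) hw.1
  rw [integral_norm_eq_lintegral_enorm hw.1, ← eLpNorm_one_eq_lintegral_enorm, Lp.norm_def,
    ← ENNReal.toReal_mul, mul_comm]
  refine ENNReal.toReal_mono (ENNReal.mul_ne_top hw.eLpNorm_ne_top ?_) h1
  refine ENNReal.rpow_ne_top_of_nonneg ?_ (measure_ne_top μ _)
  rw [ENNReal.toReal_one, one_div_one, sub_nonneg, one_div]
  rcases eq_or_ne q ⊤ with rfl | hq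
  · simp
  · refine inv_le_one_of_one_le₀ ?_
    have := ENNReal.toReal_mono hq (Fact.out : 1 ≤ q)
    simpa using this

/-- Up to an arbitrarily small multiple of the Sobolev norm, the `L^q` norm is controlled on
`W^{1,q}_0(Ω)` by finitely many continuous linear functionals. -/
lemma exists_finite_rank_bound (hq : q ≠ ⊤) (hΩb : Bornology.IsBounded Ω)
    (hΩ : MeasurableSet Ω) {ε : ℝ} (hε : 0 < ε) :
    ∃ (T : Finset 𝔼) (P : Lp ℝ q ((volume : Measure 𝔼).restrict Ω) →L[ℝ] (T → ℝ)),
      ∀ x ∈ sobolevZero q Ω, ‖x.1‖ ≤ ε * ‖x‖ + ‖P x.1‖ := by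
  have hfin : IsFiniteMeasure ((volume : Measure 𝔼).restrict Ω) :=
    ⟨by simpa using hΩb.measure_lt_top⟩
  -- Mollifying at radius `ε / 2` costs at most `ε / 2` times the norm of the gradient. The
  -- mollified function is Lipschitz with constant controlled by its `L^q` norm, hence nearly
  -- determined by its values on a finite net.
  obtain ⟨η, hη, hη0, hηs, hη1, hηb⟩ := exists_mollifier (n := n) (half_pos hε)
  obtain ⟨Λ, hΛ⟩ := hη.lipschitzWith_of_hasCompactSupport hηs (by simp)
  obtain ⟨A, hA0, hA⟩ := exists_integral_norm_le (q := q) (μ := (volume : Measure 𝔼).restrict Ω)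
  choose ℓ hℓ using fun z : 𝔼 => exists_clm_eq_integral_smul (q := q) (Ω := Ω)
    (g := fun t => η (z - t)) (hη.continuous.comp (continuous_const.sub continuous_id))
    (hηs.comp_homeomorph (Homeomorph.subLeft z))
  set B : ℝ := (((volume : Measure 𝔼).restrict Ω) Set.univ ^ q.toReal⁻¹).toReal with hB
  have hB0 : 0 ≤ B := ENNReal.toReal_nonneg
  -- Mesh of the net. `B` compares the `L^q` norm with the supremum on `Ω`, `A` the `L^1` norm with
  -- the `L^q` norm, and `Λ` is the Lipschitz constant of `η`. The `+ 1` in the witness prevents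
  -- division by zero.
  obtain ⟨r, hr0, hr⟩ : ∃ r : ℝ, 0 < r ∧ B * (Λ * r * A) ≤ ε / 2 := by
    refine ⟨ε / 2 / (B * Λ * A + 1), by positivity, ?_⟩
    have : B * (Λ * (ε / 2 / (B * Λ * A + 1)) * A) = (B * Λ * A) / (B * Λ * A + 1) * (ε / 2) := by
      ring
    rw [this]
    refine mul_le_of_le_one_left (by positivity) ?_
    rw [div_le_one (by positivity)]
    linarith
  obtain ⟨T, -, hT⟩ := hΩb.isCompact_closure.elim_finite_subcover_image
    (b := Set.univ) (c := fun z : 𝔼 => Metric.ball z r) (fun _ _ => Metric.isOpen_ball)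
    (fun x _ => by
      simp only [Set.mem_univ, Set.iUnion_true, Set.mem_iUnion]
      exact ⟨x, Metric.mem_ball_self hr0⟩)
  obtain ⟨hTf, hTc⟩ := hT
  refine ⟨hTf.toFinset, B • ContinuousLinearMap.pi fun z : hTf.toFinset => ℓ z, ?_⟩
  -- The inequality is a closed condition on the pair, so it only has to be checked for test
  -- functions.
  have hcl : IsClosed {x : Lp ℝ q ((volume : Measure 𝔼).restrict Ω) ×
      Lp 𝔼 q ((volume : Measure 𝔼).restrict Ω) | ‖x.1‖ ≤ ε * ‖x‖ +
      ‖(B • ContinuousLinearMap.pi fun z : hTf.toFinset => ℓ z) x.1‖} :=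
    isClosed_le (by fun_prop) (by fun_prop)
  intro x hx
  refine closure_minimal (s := (testPairs q Ω : Set _)) ?_ hcl
    (by rwa [sobolevZero, ← SetLike.mem_coe, Submodule.topologicalClosure_coe] at hx)
  clear hx x
  rintro x ⟨φ, hφ, h1, h2⟩
  rw [Set.mem_ofPred_eq]
  have hconv : ∀ z, convolution η φ (ContinuousLinearMap.lsmul ℝ ℝ) volume z = ℓ z x.1 := by
    intro z
    rw [hℓ, convolution_eq_swap]
    simp only [ContinuousLinearMap.lsmul_apply]
    rw [← setIntegral_eq_integral_of_forall_compl_eq_zero (s := Ω)]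
    · refine integral_congr_ae ?_
      filter_upwards [h1] with t ht
      rw [ht]
    · intro t ht
      rw [image_eq_zero_of_notMem_tsupport (fun h => ht (hφ.3 h)), smul_zero]
  have hlip : ∀ z z' : 𝔼, |ℓ z x.1 - ℓ z' x.1| ≤ Λ * dist z z' * A * ‖x.1‖ := by
    intro z z'
    obtain ⟨hint, hle⟩ := hA x.1
    have hint' : ∀ z, Integrable (fun t => η (z - t) • x.1 t) (volume.restrict Ω) := by
      intro z
      obtain ⟨C, hC⟩ := hη.continuous.bounded_above_of_compact_support hηs
      exact hint.bdd_mul (c := C) (hη.continuous.comp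
        (continuous_const.sub continuous_id)).aestronglyMeasurable (ae_of_all _ fun t => hC _)
    rw [hℓ, hℓ, ← integral_sub (hint' z) (hint' z'), ← Real.norm_eq_abs]
    calc ‖∫ t in Ω, (η (z - t) • x.1 t - η (z' - t) • x.1 t)‖
        ≤ ∫ t in Ω, Λ * dist z z' * ‖x.1 t‖ := by
          refine norm_integral_le_of_norm_le (hint.norm.const_mul _) (ae_of_all _ fun t => ?_)
          rw [← sub_smul, norm_smul]
          gcongr
          have := hΛ.dist_le_mul (z - t) (z' - t)
          rwa [dist_sub_right, Real.dist_eq, ← Real.norm_eq_abs] at this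
      _ ≤ Λ * dist z z' * (A * ‖x.1‖) := by
          rw [integral_const_mul]
          gcongr
      _ = _ := by ring
  set N := ‖ContinuousLinearMap.pi (fun z : hTf.toFinset => ℓ z) x.1‖ with hN
  have hbound : ∀ y ∈ Ω, ‖ℓ y x.1‖ ≤ N + Λ * r * A * ‖x.1‖ := by
    intro y hy
    obtain ⟨z, hz, hyz⟩ := Set.mem_iUnion₂.mp (hTc (subset_closure hy))
    have h3 := hlip y z
    have h4 : ‖ℓ z x.1‖ ≤ N :=
      norm_le_pi_norm (ContinuousLinearMap.pi (fun z : hTf.toFinset => ℓ z) x.1)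
        ⟨z, hTf.mem_toFinset.mpr hz⟩
    have h5 : Λ * dist y z * A * ‖x.1‖ ≤ Λ * r * A * ‖x.1‖ := by
      have := (Metric.mem_ball.mp hyz).le
      gcongr
    have h6 : ‖ℓ y x.1‖ ≤ ‖ℓ z x.1‖ + |ℓ y x.1 - ℓ z x.1| := by
      rw [← Real.norm_eq_abs]
      exact norm_le_insert' _ _
    linarith
  have hcc : Continuous fun y => ℓ y x.1 := by
    simp_rw [← hconv]
    exact hηs.continuous_convolution_left _ hη.continuous
      hφ.continuous.locallyIntegrable
  have hb0 : 0 ≤ N + Λ * r * A * ‖x.1‖ := by positivity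
  have h7 : eLpNorm (fun y => ℓ y x.1) q (volume.restrict Ω)
      ≤ ENNReal.ofReal (B * (N + Λ * r * A * ‖x.1‖)) := by
    refine (eLpNorm_le_of_ae_bound ((ae_restrict_iff' hΩ).mpr (ae_of_all _ hbound))).trans ?_
    rw [ENNReal.ofReal_mul hB0, hB, ENNReal.ofReal_toReal]
    exact ENNReal.rpow_ne_top_of_nonneg (by positivity) (measure_ne_top _ _)
  have h8 : eLpNorm (fun y => φ y - ℓ y x.1) q (volume.restrict Ω)
      ≤ ENNReal.ofReal (ε / 2 * ‖x.2‖) := by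
    simp_rw [← hconv]
    refine (eLpNorm_restrict_le _ _ _ _).trans ?_
    refine eLpNorm_sub_convolution_le Fact.out hq hη0 hη.continuous hηs hη1
      (hφ.memLp q volume) fun t ht => ?_
    refine (eLpNorm_sub_translate_le Fact.out hq (hφ.1.of_le (by simp)) t).trans ?_
    rw [ENNReal.ofReal_mul (by positivity)]
    have h9 : eLpNorm (gradient φ) q volume = ENNReal.ofReal ‖x.2‖ := by
      rw [Lp.norm_def, ENNReal.ofReal_toReal (Lp.eLpNorm_ne_top _), eLpNorm_congr_ae h2,
        eLpNorm_restrict_eq_of_support_subset]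
      exact (subset_tsupport _).trans ((tsupport_gradient_subset φ).trans hφ.3)
    rw [h9]
    gcongr
    rw [← ofReal_norm]
    refine ENNReal.ofReal_le_ofReal ?_
    simpa using (Metric.mem_ball.mp (hηb ht)).le
  have h10 : ENNReal.ofReal ‖x.1‖ ≤ ENNReal.ofReal (ε / 2 * ‖x.2‖ +
      B * (N + Λ * r * A * ‖x.1‖)) := by
    have hn1 : ENNReal.ofReal ‖x.1‖ = eLpNorm φ q (volume.restrict Ω) := by
      rw [Lp.norm_def, ENNReal.ofReal_toReal (Lp.eLpNorm_ne_top _), eLpNorm_congr_ae h1]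
    rw [hn1, ENNReal.ofReal_add (by positivity) (by positivity)]
    refine le_trans ?_ (add_le_add h8 h7)
    refine le_trans (le_of_eq ?_) (eLpNorm_add_le (hφ.continuous.sub hcc).aestronglyMeasurable
      hcc.aestronglyMeasurable Fact.out)
    congr 1
    ext y
    simp
  have h11 := (ENNReal.ofReal_le_ofReal_iff (by positivity)).mp h10
  have h12 : ‖(B • ContinuousLinearMap.pi fun z : hTf.toFinset => ℓ z) x.1‖ = B * N := by
    rw [_root_.smul_apply, norm_smul, Real.norm_of_nonneg hB0]
  rw [h12]
  have h13 : ‖x.2‖ ≤ ‖x‖ := norm_snd_le x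
  have h14 : ‖x.1‖ ≤ ‖x‖ := norm_fst_le x
  have h15 : B * (Λ * r * A) * ‖x.1‖ ≤ ε / 2 * ‖x‖ := by gcongr
  have h16 : ε / 2 * ‖x.2‖ ≤ ε / 2 * ‖x‖ := by gcongr
  nlinarith

end Rellich

/-! ### Reflection in a Lipschitz boundary -/

section Reflection

variable {n : ℕ}

set_option hygiene false in
local notation "𝔼" => EuclideanSpace ℝ (Fin n)

/-- For an involution preimages are images, and an `L`-Lipschitz map enlarges `n`-dimensional
Hausdorff measure, a multiple of which is the volume, at most by `L ^ n`. This replaces the change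
of variables formula. -/
lemma LipschitzWith.map_volume_le_of_involutive {Φ : 𝔼 → 𝔼} {L : ℝ≥0} (hL : LipschitzWith L Φ)
    (hinv : Function.Involutive Φ) :
    Measure.map Φ volume ≤ ((L : ℝ≥0∞) ^ n) • (volume : Measure 𝔼) := by
  obtain ⟨c, hvol⟩ : ∃ c : ℝ≥0, (volume : Measure 𝔼) =
      c • (Measure.hausdorffMeasure (Module.finrank ℝ 𝔼) : Measure 𝔼) :=
    ⟨_, Measure.isAddLeftInvariant_eq_smul_of_regular _ _⟩
  refine Measure.le_iff.mpr fun s hs => ?_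
  rw [Measure.map_apply hL.continuous.measurable hs, ← Set.image_eq_preimage_of_inverse
    hinv.leftInverse hinv.rightInverse, hvol]
  have h := hL.hausdorffMeasure_image_le (d := Module.finrank ℝ 𝔼) (by positivity) s
  rw [finrank_euclideanSpace_fin] at h ⊢
  rw [ENNReal.rpow_natCast] at h
  simp only [Measure.smul_apply, ENNReal.smul_def, smul_eq_mul]
  calc _ ≤ _ := mul_le_mul_right h _
    _ = _ := by ring

/-- Reflection in the graph of a Lipschitz function. -/
lemma exists_lipschitz_reflection {ν : 𝔼} (hν : ‖ν‖ = 1) {γ : 𝔼 → ℝ} {K : ℝ≥0}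
    (hγ : LipschitzWith K γ) : ∃ (Φ : 𝔼 → 𝔼) (L : ℝ≥0), LipschitzWith L Φ ∧
      Function.Involutive Φ ∧
      (∀ y, Φ y - inner ℝ ν (Φ y) • ν = y - inner ℝ ν y • ν) ∧
      (∀ y, inner ℝ ν (Φ y) = 2 * γ (y - inner ℝ ν y • ν) - inner ℝ ν y) ∧
      (∀ y, γ (y - inner ℝ ν y • ν) = inner ℝ ν y → Φ y = y) := by
  let A : 𝔼 →L[ℝ] ℝ := innerSL ℝ ν
  let Q : 𝔼 →L[ℝ] 𝔼 := ContinuousLinearMap.id ℝ 𝔼 - A.smulRight ν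
  -- The horizontal part is kept and the height `s` becomes `2γ - s`: points of the graph stay
  -- fixed, and two applications cancel.
  let Φ : 𝔼 → 𝔼 := fun y => y + (ContinuousLinearMap.toSpanSingleton ℝ ν) (2 * (γ (Q y) - A y))
  have hQ : ∀ y, Q y = y - inner ℝ ν y • ν := fun y => by simp [Q, A]
  have hA : ∀ y, A y = inner ℝ ν y := fun y => by simp [A]
  have hΦ : ∀ y, Φ y = y + (2 * (γ (y - inner ℝ ν y • ν) - inner ℝ ν y)) • ν := fun y => by
    simp only [Φ, hQ, hA, ContinuousLinearMap.toSpanSingleton_apply]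
  have h1 : ∀ y, inner ℝ ν (Φ y) = 2 * γ (y - inner ℝ ν y • ν) - inner ℝ ν y := by
    intro y
    rw [hΦ, inner_add_right, real_inner_smul_right, real_inner_self_eq_norm_sq, hν]
    ring
  have h2 : ∀ y, Φ y - inner ℝ ν (Φ y) • ν = y - inner ℝ ν y • ν := by
    intro y
    rw [h1, hΦ]
    module
  have hlip := LipschitzWith.id.add ((ContinuousLinearMap.toSpanSingleton ℝ ν).lipschitz.comp
    ((((2 : ℝ) • ContinuousLinearMap.id ℝ ℝ).lipschitz).comp
      ((hγ.comp Q.lipschitz).sub A.lipschitz)))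
  refine ⟨Φ, _, hlip, fun y => ?_, h2, h1, fun y hy => ?_⟩
  · rw [hΦ (Φ y), h2, h1, hΦ]
    module
  · rw [hΦ, hy]
    simp

/-- A finite family of Lipschitz reflections in pieces of the boundary of `D`, together with
cutoff functions that add up to one on the boundary. -/
structure IsReflectionCover {ι : Type*} [Fintype ι] (D : Set (EuclideanSpace ℝ (Fin n)))
    (χ : ι → EuclideanSpace ℝ (Fin n) → ℝ)
    (Φ : ι → EuclideanSpace ℝ (Fin n) → EuclideanSpace ℝ (Fin n)) (L : ℝ≥0) : Prop where
  contDiff : ∀ i, ContDiff ℝ ∞ (χ i)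
  hasCompactSupport : ∀ i, HasCompactSupport (χ i)
  sum_eq_one : ∀ y ∈ frontier D, ∑ i, χ i y = 1
  lipschitz : ∀ i, LipschitzWith L (Φ i)
  involutive : ∀ i, Function.Involutive (Φ i)
  apply_notMem : ∀ i, ∀ y ∈ tsupport (χ i), y ∈ D → Φ i y ∉ D
  apply_eq : ∀ i, ∀ y ∈ tsupport (χ i), y ∈ frontier D → Φ i y = y

lemma HasLipschitzBoundary.exists_reflection {D : Set 𝔼} (hD : HasLipschitzBoundary D)
    (hDo : IsOpen D) {x₀ : 𝔼} (hx₀ : x₀ ∈ frontier D) :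
    ∃ (Φ : 𝔼 → 𝔼) (L : ℝ≥0) (ρ : ℝ), 0 < ρ ∧ LipschitzWith L Φ ∧ Function.Involutive Φ ∧
      (∀ y ∈ Metric.ball x₀ ρ, y ∈ D → Φ y ∉ D) ∧
      (∀ y ∈ Metric.ball x₀ ρ, y ∈ frontier D → Φ y = y) := by
  obtain ⟨ν, γ, K, r, hν, hγ, hr, hD⟩ := hD x₀ hx₀
  obtain ⟨Φ, L, hL, hinv, h1, h2, h3⟩ := exists_lipschitz_reflection hν hγ
  -- Near `x₀` the frontier lies on the graph: points strictly below have a neighbourhood that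
  -- misses `D`, and points strictly above lie in `D`, which is open.
  have hfr : ∀ y ∈ Metric.ball x₀ r, y ∈ frontier D → γ (y - inner ℝ ν y • ν) = inner ℝ ν y := by
    intro y hy hyD
    have hγc := hγ.continuous
    refine le_antisymm ?_ ?_
    · by_contra! hlt
      have hev : ∀ᶠ z in 𝓝 y, inner ℝ ν z < γ (z - inner ℝ ν z • ν) :=
        (isOpen_lt (by fun_prop) (by fun_prop)).mem_nhds hlt
      obtain ⟨z, ⟨hz1, hz2⟩, hz3⟩ := mem_closure_iff_nhds.mp (frontier_subset_closure hyD) _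
        (inter_mem hev (Metric.isOpen_ball.mem_nhds hy))
      exact absurd ((hD z hz2).mp hz3) (not_lt.mpr hz1.le)
    · rw [hDo.frontier_eq] at hyD
      exact not_lt.mp fun h => hyD.2 ((hD y hy).mpr h)
  -- The graph describes `D` only in the ball of radius `r`. Since `Φ` fixes `x₀`, images of points
  -- close to `x₀` stay in that ball.
  have hcont : ∀ᶠ y in 𝓝 x₀, Φ y ∈ Metric.ball x₀ r := by
    refine hL.continuous.continuousAt.eventually_mem ?_
    rw [h3 x₀ (hfr x₀ (Metric.mem_ball_self hr) hx₀)]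
    exact Metric.ball_mem_nhds x₀ hr
  obtain ⟨ρ, hρ, hball⟩ := Metric.eventually_nhds_iff_ball.mp
    (hcont.and (Metric.ball_mem_nhds x₀ hr))
  refine ⟨Φ, L, ρ, hρ, hL, hinv, fun y hy hyD hΦD => ?_, fun y hy hyD => ?_⟩
  · have h4 := (hD y (hball y hy).2).mp hyD
    have h5 := (hD _ (hball y hy).1).mp hΦD
    rw [h1, h2] at h5
    linarith
  · exact h3 y (hfr y (hball y hy).2 hyD)

open scoped Manifold in
-- The frontier is compact, so finitely many local reflections suffice. The cutoffs are a smooth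
-- partition of unity on the frontier subordinate to their balls, and the sum of the Lipschitz
-- constants serves for all of them.
lemma HasLipschitzBoundary.exists_isReflectionCover {D : Set 𝔼} (hD : HasLipschitzBoundary D)
    (hDo : IsOpen D) (hDb : Bornology.IsBounded D) :
    ∃ (T : Finset 𝔼) (χ : T → 𝔼 → ℝ) (Φ : T → 𝔼 → 𝔼) (L : ℝ≥0), IsReflectionCover D χ Φ L := by
  have hcpt : IsCompact (frontier D) :=
    hDb.isCompact_closure.of_isClosed_subset isClosed_frontier frontier_subset_closure
  choose! Φ L ρ hρ hL hinv hmem heq using fun x₀ (hx₀ : x₀ ∈ frontier D) =>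
    hD.exists_reflection hDo hx₀
  obtain ⟨T, hT, hTc⟩ := hcpt.elim_nhds_subcover (fun x => Metric.ball x (ρ x))
    (fun x hx => Metric.ball_mem_nhds x (hρ x hx))
  obtain ⟨f, hf⟩ := SmoothPartitionOfUnity.exists_isSubordinate 𝓘(ℝ, 𝔼)
    (isClosed_frontier (s := D)) (fun x : T => Metric.ball (x : 𝔼) (ρ x))
    (fun x => Metric.isOpen_ball) (fun y hy => by
      obtain ⟨x, hx, hxy⟩ := Set.mem_iUnion₂.mp (hTc hy)
      exact Set.mem_iUnion.mpr ⟨⟨x, hx⟩, hxy⟩)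
  refine ⟨T, fun x => f x, fun x => Φ x, ∑ x ∈ T, L x, ?_, ?_, ?_, ?_, ?_, ?_, ?_⟩
  · exact fun x => (f x).contMDiff.contDiff
  · refine fun x => Metric.isBounded_ball.isCompact_closure.of_isClosed_subset
      (isClosed_tsupport _) ((hf x).trans subset_closure)
  · intro y hy
    rw [← finsum_eq_sum_of_fintype]
    exact f.sum_eq_one hy
  · exact fun x => (hL x (hT x x.2)).weaken (Finset.single_le_sum (f := L) (by simp) x.2)
  · exact fun x => hinv x (hT x x.2)
  · exact fun x y hy => hmem x (hT x x.2) y (hf x hy)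
  · exact fun x y hy => heq x (hT x x.2) y (hf x hy)

end Reflection

/-! ### Products, sums and gluing of Lipschitz functions -/

section LipschitzAux

lemma LipschitzWith.mul_of_norm_le {α : Type*} [PseudoMetricSpace α] {f g : α → ℝ}
    {K L A B : ℝ≥0} (hf : LipschitzWith K f) (hg : LipschitzWith L g) (hA : ∀ x, ‖f x‖ ≤ A)
    (hB : ∀ x, ‖g x‖ ≤ B) : LipschitzWith (A * L + B * K) fun x => f x * g x := by
  refine LipschitzWith.of_dist_le_mul fun x y => ?_
  have h1 := hf.dist_le_mul x y
  have h2 := hg.dist_le_mul x y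
  rw [Real.dist_eq] at h1 h2 ⊢
  calc |f x * g x - f y * g y| = |f x * (g x - g y) + g y * (f x - f y)| := by ring_nf
    _ ≤ |f x| * |g x - g y| + |g y| * |f x - f y| := by
        rw [← abs_mul, ← abs_mul]; exact abs_add_le _ _
    _ ≤ A * (L * dist x y) + B * (K * dist x y) := by
        have := hA x
        have := hB y
        rw [Real.norm_eq_abs] at *
        gcongr
    _ = _ := by push_cast; ring

lemma exists_lipschitzWith_finset_sum {α ι : Type*} [PseudoMetricSpace α] (s : Finset ι)
    {f : ι → α → ℝ} (hf : ∀ i, ∃ K : ℝ≥0, LipschitzWith K (f i)) :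
    ∃ K : ℝ≥0, LipschitzWith K fun x => ∑ i ∈ s, f i x := by
  classical
  induction s using Finset.induction_on with
  | empty => exact ⟨0, by simp⟩
  | insert i s hi ih =>
    obtain ⟨K, hK⟩ := ih
    obtain ⟨L, hL⟩ := hf i
    exact ⟨L + K, by simpa [Finset.sum_insert hi] using hL.add hK⟩

/-- A segment from a point of `D` to a point outside crosses the frontier, where `f` vanishes. The
part of the segment up to the crossing already bounds the jump. -/
lemma LipschitzWith.indicator_of_eq_zero_on_frontier {V F : Type*} [NormedAddCommGroup V]
    [NormedSpace ℝ V] [NormedAddCommGroup F] {f : V → F} {K : ℝ≥0} (hf : LipschitzWith K f)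
    {D : Set V} (hD : IsOpen D) (h0 : ∀ x ∈ frontier D, f x = 0) :
    LipschitzWith K (D.indicator f) := by
  have key : ∀ x ∈ D, ∀ y ∉ D, dist (f x) 0 ≤ K * dist x y := by
    intro x hx y hy
    obtain ⟨z, hz, hzD⟩ : ∃ z ∈ segment ℝ x y, z ∈ frontier D := by
      by_contra! hne
      have hpre : IsPreconnected (segment ℝ x y) := (convex_segment x y).isPreconnected
      obtain ⟨z, -, hz1, hz2⟩ := hpre D (closure D)ᶜ hD isClosed_closure.isOpen_compl
        (fun z hz => by
          by_cases hzD : z ∈ D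
          · exact Or.inl hzD
          · refine Or.inr fun hzc => hne z hz ?_
            rw [hD.frontier_eq]
            exact ⟨hzc, hzD⟩)
        ⟨x, left_mem_segment ℝ x y, hx⟩
        ⟨y, right_mem_segment ℝ x y, fun hyc => hne y (right_mem_segment ℝ x y) (by
          rw [hD.frontier_eq]; exact ⟨hyc, hy⟩)⟩
      exact hz2 (subset_closure hz1)
    rw [← h0 z hzD]
    refine (hf.dist_le_mul x z).trans ?_
    gcongr
    rw [← dist_add_dist_of_mem_segment hz]
    exact le_add_of_nonneg_right dist_nonneg
  refine LipschitzWith.of_dist_le_mul fun x y => ?_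
  by_cases hx : x ∈ D <;> by_cases hy : y ∈ D
  · simpa [hx, hy] using hf.dist_le_mul x y
  · simpa [hx, hy] using key x hx y hy
  · have := key y hy x hx
    rw [dist_comm y x] at this
    simpa [hx, hy] using this
  · simp only [Set.indicator_of_notMem hx, Set.indicator_of_notMem hy, dist_self]
    positivity

end LipschitzAux

/-! ### Extension into `D` by reflection -/

section Extension

variable {n : ℕ}

set_option hygiene false in
local notation "𝔼" => EuclideanSpace ℝ (Fin n)

variable {ι : Type*} [Fintype ι]

/-- The function that agrees with `φ` outside `D`, and in `D` is obtained from the values of `φ`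
outside `D` by reflection. -/
noncomputable def reflectionExtension (D : Set (EuclideanSpace ℝ (Fin n)))
    (χ : ι → EuclideanSpace ℝ (Fin n) → ℝ)
    (Φ : ι → EuclideanSpace ℝ (Fin n) → EuclideanSpace ℝ (Fin n))
    (φ : EuclideanSpace ℝ (Fin n) → ℝ) : EuclideanSpace ℝ (Fin n) → ℝ :=
  φ + D.indicator fun y => ∑ i, χ i y * φ (Φ i y) - φ y

variable {D Ω : Set (EuclideanSpace ℝ (Fin n))} {χ : ι → EuclideanSpace ℝ (Fin n) → ℝ}
  {Φ : ι → EuclideanSpace ℝ (Fin n) → EuclideanSpace ℝ (Fin n)} {L : ℝ≥0} {φ ψ : 𝔼 → ℝ}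

lemma reflectionExtension_apply_of_notMem {y : 𝔼} (hy : y ∉ D) :
    reflectionExtension D χ Φ φ y = φ y := by
  simp [reflectionExtension, hy]

lemma reflectionExtension_apply_of_mem {y : 𝔼} (hy : y ∈ D) :
    reflectionExtension D χ Φ φ y = ∑ i, χ i y * φ (Φ i y) := by
  simp [reflectionExtension, hy]

lemma reflectionExtension_add :
    reflectionExtension D χ Φ (φ + ψ) =
      reflectionExtension D χ Φ φ + reflectionExtension D χ Φ ψ := by
  ext y
  by_cases hy : y ∈ D
  · simp [reflectionExtension_apply_of_mem hy, mul_add, Finset.sum_add_distrib]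
  · simp [reflectionExtension_apply_of_notMem hy]

lemma reflectionExtension_const_smul (c : ℝ) :
    reflectionExtension D χ Φ (c • φ) = c • reflectionExtension D χ Φ φ := by
  ext y
  by_cases hy : y ∈ D
  · simp [reflectionExtension_apply_of_mem hy, Finset.mul_sum, mul_left_comm]
  · simp [reflectionExtension_apply_of_notMem hy]

lemma support_reflectionExtension_subset :
    Function.support (reflectionExtension D χ Φ φ) ⊆ tsupport φ ∪ closure D := by
  intro y hy
  by_cases hyD : y ∈ D
  · exact Or.inr (subset_closure hyD)
  · refine Or.inl (subset_tsupport _ ?_)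
    rwa [Function.mem_support, reflectionExtension_apply_of_notMem hyD] at hy

namespace IsReflectionCover

variable (h : IsReflectionCover D χ Φ L)

include h

lemma exists_lipschitzWith_sum (hφ : IsTestFunction Ω φ) :
    ∃ K : ℝ≥0, LipschitzWith K fun y => ∑ i, χ i y * φ (Φ i y) := by
  refine exists_lipschitzWith_finset_sum _ fun i => ?_
  obtain ⟨K₁, hK₁⟩ := (h.contDiff i).lipschitzWith_of_hasCompactSupport
    (h.hasCompactSupport i) (by simp)
  obtain ⟨K₂, hK₂⟩ := hφ.1.lipschitzWith_of_hasCompactSupport hφ.2 (by simp)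
  obtain ⟨A, hA⟩ := (h.contDiff i).continuous.bounded_above_of_compact_support
    (h.hasCompactSupport i)
  obtain ⟨B, hB⟩ := hφ.continuous.bounded_above_of_compact_support hφ.2
  exact ⟨_, hK₁.mul_of_norm_le (hK₂.comp (h.lipschitz i)) (A := A.toNNReal) (B := B.toNNReal)
    (fun x => (hA x).trans (Real.le_coe_toNNReal A))
    (fun x => (hB _).trans (Real.le_coe_toNNReal B))⟩

lemma sum_apply_eq_of_mem_frontier {y : 𝔼} (hy : y ∈ frontier D) :
    ∑ i, χ i y * φ (Φ i y) = φ y := by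
  have h1 : ∀ i, χ i y * φ (Φ i y) = χ i y * φ y := by
    intro i
    by_cases hi : y ∈ tsupport (χ i)
    · rw [h.apply_eq i y hi hy]
    · simp [image_eq_zero_of_notMem_tsupport hi]
  rw [Finset.sum_congr rfl fun i _ => h1 i, ← Finset.sum_mul, h.sum_eq_one y hy, one_mul]

/-- The correction vanishes on the frontier: there each reflection fixes the point wherever its
cutoff is active, and the cutoffs sum to one. Hence it can be cut off at the frontier without losing
the Lipschitz property. -/
lemma exists_lipschitzWith_sub (hφ : IsTestFunction Ω φ) (hD : IsOpen D) :
    ∃ K : ℝ≥0, LipschitzWith K (D.indicator fun y => ∑ i, χ i y * φ (Φ i y) - φ y) := by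
  obtain ⟨K₁, hK₁⟩ := h.exists_lipschitzWith_sum hφ
  obtain ⟨K₂, hK₂⟩ := hφ.1.lipschitzWith_of_hasCompactSupport hφ.2 (by simp)
  exact ⟨_, (hK₁.sub hK₂).indicator_of_eq_zero_on_frontier hD fun y hy => by
    rw [h.sum_apply_eq_of_mem_frontier hy, sub_self]⟩

lemma exists_lipschitzWith_reflectionExtension (hφ : IsTestFunction Ω φ) (hD : IsOpen D) :
    ∃ K : ℝ≥0, LipschitzWith K (reflectionExtension D χ Φ φ) := by
  obtain ⟨K₁, hK₁⟩ := h.exists_lipschitzWith_sub hφ hD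
  obtain ⟨K₂, hK₂⟩ := hφ.1.lipschitzWith_of_hasCompactSupport hφ.2 (by simp)
  exact ⟨_, hK₂.add hK₁⟩

/-- The correction is Lipschitz and zero on all of `Dᶜ`, frontier included, so its gradient vanishes
almost everywhere there. -/
lemma gradient_reflectionExtension_ae_eq (hφ : IsTestFunction Ω φ) (hD : IsOpen D) :
    ∀ᵐ y ∂volume.restrict Dᶜ, gradient (reflectionExtension D χ Φ φ) y = gradient φ y := by
  obtain ⟨K, hK⟩ := h.exists_lipschitzWith_sub hφ hD
  filter_upwards [hK.gradient_ae_eq_zero hD.measurableSet.compl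
    (fun x hx => Set.indicator_of_notMem hx _), ae_restrict_of_ae hK.ae_differentiableAt]
    with y hy hyd
  rw [gradient] at hy ⊢
  rw [reflectionExtension, fderiv_add (hφ.differentiable y) hyd, map_add, hy, add_zero, gradient]

/-- In `D` the gradient of the reflection extension is controlled by the values and the gradient
outside `D`. -/
lemma exists_norm_gradient_le (hD : IsOpen D) :
    ∃ C : ℝ≥0, ∀ φ : 𝔼 → ℝ, IsTestFunction Ω φ → ∀ᵐ y ∂volume.restrict D,
      ‖gradient (reflectionExtension D χ Φ φ) y‖ ≤
        C * ∑ i, Dᶜ.indicator (fun z => ‖φ z‖ + ‖gradient φ z‖) (Φ i y) := by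
  choose A hA using fun i => (h.contDiff i).continuous.bounded_above_of_compact_support
    (h.hasCompactSupport i)
  choose B hB using fun i => (h.contDiff i).lipschitzWith_of_hasCompactSupport
    (h.hasCompactSupport i) (by simp)
  refine ⟨∑ i, ((A i).toNNReal * L + B i), fun φ hφ => ?_⟩
  have hdiff : ∀ᵐ y : 𝔼, ∀ i, DifferentiableAt ℝ (Φ i) y :=
    ae_all_iff.mpr fun i => (h.lipschitz i).ae_differentiableAt
  filter_upwards [ae_restrict_mem hD.measurableSet, ae_restrict_of_ae hdiff] with y hy hdy
  have hev : reflectionExtension D χ Φ φ =ᶠ[𝓝 y] fun y => ∑ i, χ i y * φ (Φ i y) := by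
    filter_upwards [hD.mem_nhds hy] with z hz
    exact reflectionExtension_apply_of_mem hz
  have hder : ∀ i, HasFDerivAt (fun y => χ i y * φ (Φ i y))
      (χ i y • ((fderiv ℝ φ (Φ i y)).comp (fderiv ℝ (Φ i) y)) + φ (Φ i y) • fderiv ℝ (χ i) y) y :=
    fun i => (((h.contDiff i).differentiable (by simp)) y).hasFDerivAt.mul
      ((hφ.differentiable (Φ i y)).hasFDerivAt.comp y (hdy i).hasFDerivAt)
  rw [norm_gradient_eq, hev.fderiv_eq, (HasFDerivAt.fun_sum fun i _ => hder i).fderiv,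
    NNReal.coe_sum, Finset.sum_mul]
  refine norm_sum_le_of_le _ fun i _ => ?_
  have hind0 : ∀ z, 0 ≤ Dᶜ.indicator (fun z => ‖φ z‖ + ‖gradient φ z‖) z := fun z =>
    Set.indicator_nonneg (fun _ _ => by positivity) z
  -- Where the cutoff is active the reflected point is outside `D`, so the indicator does not lose
  -- it; elsewhere the cutoff and its derivative both vanish.
  by_cases hi : y ∈ tsupport (χ i)
  · have h1 : Dᶜ.indicator (fun z => ‖φ z‖ + ‖gradient φ z‖) (Φ i y)
        = ‖φ (Φ i y)‖ + ‖gradient φ (Φ i y)‖ :=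
      Set.indicator_of_mem (h.apply_notMem i y hi hy) _
    have h2 : Dᶜ.indicator (fun z => ‖φ z‖ + ‖gradient φ z‖) (Φ i y) ≤
        ∑ j, Dᶜ.indicator (fun z => ‖φ z‖ + ‖gradient φ z‖) (Φ j y) :=
      Finset.single_le_sum (f := fun j => Dᶜ.indicator (fun z => ‖φ z‖ + ‖gradient φ z‖) (Φ j y))
        (fun j _ => hind0 _) (Finset.mem_univ i)
    have h3 : ‖χ i y‖ ≤ (A i).toNNReal := (hA i y).trans (Real.le_coe_toNNReal _)
    have h4 : ‖fderiv ℝ (χ i) y‖ ≤ B i := norm_fderiv_le_of_lipschitz ℝ (hB i)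
    have h5 : ‖fderiv ℝ (Φ i) y‖ ≤ L := norm_fderiv_le_of_lipschitz ℝ (h.lipschitz i)
    have h6 := norm_gradient_eq φ (Φ i y)
    calc _ ≤ ‖χ i y‖ * (‖fderiv ℝ φ (Φ i y)‖ * ‖fderiv ℝ (Φ i) y‖)
          + ‖φ (Φ i y)‖ * ‖fderiv ℝ (χ i) y‖ := by
          refine (norm_add_le _ _).trans ?_
          rw [norm_smul, norm_smul]
          gcongr
          exact ContinuousLinearMap.opNorm_comp_le _ _
      _ ≤ (A i).toNNReal * (‖gradient φ (Φ i y)‖ * L) + ‖φ (Φ i y)‖ * B i := by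
          rw [h6]
          gcongr
      _ ≤ ((A i).toNNReal * L + B i) * (‖φ (Φ i y)‖ + ‖gradient φ (Φ i y)‖) := by
          have : 0 ≤ ((A i).toNNReal : ℝ) * L * ‖φ (Φ i y)‖ := by positivity
          have : 0 ≤ B i * ‖gradient φ (Φ i y)‖ := by positivity
          nlinarith
      _ ≤ _ := by
          rw [← h1]
          push_cast
          gcongr
  · have h1 : χ i y = 0 := image_eq_zero_of_notMem_tsupport hi
    have h2 : fderiv ℝ (χ i) y = 0 :=
      image_eq_zero_of_notMem_tsupport (f := fderiv ℝ (χ i)) fun hy' =>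
        hi (tsupport_fderiv_subset ℝ hy')
    rw [h1, h2, zero_smul, smul_zero, add_zero, norm_zero]
    exact mul_nonneg (NNReal.coe_nonneg _) (Finset.sum_nonneg fun j _ => hind0 _)

lemma eLpNorm_comp_le {q : ℝ≥0∞} (hq : q ≠ ⊤) {F : Type*} [NormedAddCommGroup F] {g : 𝔼 → F}
    (hg : AEStronglyMeasurable g volume) (i : ι) :
    eLpNorm (fun y => g (Φ i y)) q volume ≤
      ((L : ℝ≥0∞) ^ n) ^ (1 / q).toReal * eLpNorm g q volume := by
  have hle := (h.lipschitz i).map_volume_le_of_involutive (h.involutive i)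
  have hac : Measure.map (Φ i) volume ≪ volume :=
    (Measure.absolutelyContinuous_of_le hle).trans (Measure.smul_absolutelyContinuous)
  calc eLpNorm (fun y => g (Φ i y)) q volume = eLpNorm g q (Measure.map (Φ i) volume) :=
        (eLpNorm_map_measure (hg.mono_ac hac) (h.lipschitz i).continuous.aemeasurable).symm
    _ ≤ eLpNorm g q (((L : ℝ≥0∞) ^ n) • volume) := eLpNorm_mono_measure _ hle
    _ = _ := by rw [eLpNorm_smul_measure_of_ne_top hq, smul_eq_mul]

/-- The pointwise bound is integrated, each reflection costing a fixed factor for the distortion of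
volume. Only the behaviour of `φ` outside `D` appears on the right. -/
lemma exists_eLpNorm_gradient_le {q : ℝ≥0∞} (hq1 : 1 ≤ q) (hq : q ≠ ⊤) (hD : IsOpen D) :
    ∃ C : ℝ≥0, ∀ φ : 𝔼 → ℝ, IsTestFunction Ω φ →
      eLpNorm (gradient (reflectionExtension D χ Φ φ)) q (volume.restrict D) ≤
        C * (eLpNorm φ q (volume.restrict Dᶜ) + eLpNorm (gradient φ) q (volume.restrict Dᶜ)) := by
  obtain ⟨C, hC⟩ := h.exists_norm_gradient_le (Ω := Ω) hD
  set c : ℝ≥0∞ := ((L : ℝ≥0∞) ^ n) ^ (1 / q).toReal with hc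
  have hct : c ≠ ⊤ := ENNReal.rpow_ne_top_of_nonneg ENNReal.toReal_nonneg
    (ENNReal.pow_ne_top ENNReal.coe_ne_top)
  refine ⟨C * (Fintype.card ι * c.toNNReal), fun φ hφ => ?_⟩
  set g : 𝔼 → ℝ := Dᶜ.indicator (fun z => ‖φ z‖ + ‖gradient φ z‖) with hg
  have hgm : AEStronglyMeasurable g volume :=
    (hφ.continuous.norm.add hφ.continuous_gradient.norm).aestronglyMeasurable.indicator
      hD.measurableSet.compl
  have hgm' : ∀ i, AEStronglyMeasurable (fun y => g (Φ i y)) volume := fun i => by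
    refine hgm.comp_quasiMeasurePreserving ⟨(h.lipschitz i).continuous.measurable, ?_⟩
    exact (Measure.absolutelyContinuous_of_le ((h.lipschitz i).map_volume_le_of_involutive
      (h.involutive i))).trans Measure.smul_absolutelyContinuous
  have h1 : eLpNorm g q volume ≤
      eLpNorm φ q (volume.restrict Dᶜ) + eLpNorm (gradient φ) q (volume.restrict Dᶜ) := by
    rw [hg, eLpNorm_indicator_eq_eLpNorm_restrict hD.measurableSet.compl, ← eLpNorm_norm φ,
      ← eLpNorm_norm (gradient φ)]
    exact eLpNorm_add_le hφ.continuous.norm.aestronglyMeasurable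
      hφ.continuous_gradient.norm.aestronglyMeasurable hq1
  calc eLpNorm (gradient (reflectionExtension D χ Φ φ)) q (volume.restrict D)
      ≤ ENNReal.ofReal C * eLpNorm (∑ i, fun y => g (Φ i y)) q (volume.restrict D) := by
        refine eLpNorm_le_mul_eLpNorm_of_ae_le_mul ?_ q
        filter_upwards [hC φ hφ] with y hy
        refine hy.trans ?_
        gcongr
        simpa only [Finset.sum_apply] using Real.le_norm_self _
    _ ≤ C * eLpNorm (∑ i, fun y => g (Φ i y)) q volume := by
        rw [ENNReal.ofReal_coe_nnreal]
        gcongr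
        exact Measure.restrict_le_self
    _ ≤ C * ∑ i, eLpNorm (fun y => g (Φ i y)) q volume := by
        gcongr
        exact eLpNorm_sum_le (fun i _ => hgm' i) hq1
    _ ≤ C * ∑ _i : ι, c * eLpNorm g q volume := by
        gcongr with i
        exact h.eLpNorm_comp_le hq hgm i
    _ = (C * (Fintype.card ι * c.toNNReal) : ℝ≥0) * eLpNorm g q volume := by
        rw [Finset.sum_const, Finset.card_univ, nsmul_eq_mul]
        push_cast
        rw [ENNReal.coe_toNNReal hct]
        ring
    _ ≤ _ := by gcongr

end IsReflectionCover

end Extension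

/-! ### Closedness of the space of gradients outside `D` -/

section ClosedRange

/-- A version of Peetre's lemma: an estimate up to a finite rank operator gives closed range. -/
lemma isClosed_map_of_norm_le_add_norm {V W F : Type*} [NormedAddCommGroup V] [NormedSpace ℝ V]
    [CompleteSpace V] [NormedAddCommGroup W] [NormedSpace ℝ W] [NormedAddCommGroup F]
    [NormedSpace ℝ F] [FiniteDimensional ℝ F] (R : V →L[ℝ] W) (P : V →L[ℝ] F)
    {X : Submodule ℝ V} (hX : IsClosed (X : Set V)) {C : ℝ}
    (hC : ∀ x ∈ X, ‖x‖ ≤ C * (‖R x‖ + ‖P x‖)) : IsClosed (X.map (R : V →ₗ[ℝ] W) : Set W) := by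
  have : CompleteSpace X := hX.completeSpace_coe
  let f : X →L[ℝ] W := R.comp X.subtypeL
  let g : X →L[ℝ] F := P.comp X.subtypeL
  -- On the kernel of `P` the estimate makes `R` bounded below, so the image of this kernel is
  -- closed. Its codimension in `X` is finite, and adding finitely many dimensions preserves
  -- closedness.
  let S : Submodule ℝ X := LinearMap.ker (g : X →ₗ[ℝ] F)
  have hS : IsClosed (S : Set X) := g.isClosed_ker
  have : CompleteSpace S := hS.completeSpace_coe
  have hanti : AntilipschitzWith C.toNNReal (f.comp S.subtypeL) := by
    refine ContinuousLinearMap.antilipschitz_of_bound _ fun x => ?_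
    have h1 := hC x x.1.2
    have h2 : P ((x : X) : V) = 0 := x.2
    rw [h2, norm_zero, add_zero] at h1
    exact h1.trans (mul_le_mul_of_nonneg_right (Real.le_coe_toNNReal C) (norm_nonneg _))
  have : S.CoFG := Submodule.CoFG.ker _
  have hcl : IsClosed (S.map (f : X →ₗ[ℝ] W) : Set W) := by
    have := hanti.isClosed_range (f.comp S.subtypeL).uniformContinuous
    convert this using 1
    ext y
    simp [f]
  have h3 := LinearMap.isClosed_range_of_isClosed_map_of_finiteDimensional_quotient hcl
  convert h3 using 1
  ext y
  simp [f]

variable {n : ℕ}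

set_option hygiene false in
local notation "𝔼" => EuclideanSpace ℝ (Fin n)

variable {ι : Type*} [Fintype ι] {q : ℝ≥0∞} [Fact (1 ≤ q)]
  {D Ω : Set (EuclideanSpace ℝ (Fin n))} {χ : ι → EuclideanSpace ℝ (Fin n) → ℝ}
  {Φ : ι → EuclideanSpace ℝ (Fin n) → EuclideanSpace ℝ (Fin n)} {L : ℝ≥0}

/-- The restriction of the gradient to the complement of `D`, for pairs `(u, ∇u)`. -/
noncomputable def gradientRestrict (q : ℝ≥0∞) [Fact (1 ≤ q)]
    (D Ω : Set (EuclideanSpace ℝ (Fin n))) :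
    (Lp ℝ q ((volume : Measure 𝔼).restrict Ω) × Lp 𝔼 q ((volume : Measure 𝔼).restrict Ω)) →L[ℝ]
      Lp 𝔼 q (((volume : Measure 𝔼).restrict Ω).restrict Dᶜ) :=
  (LpToLpRestrictCLM 𝔼 𝔼 ℝ ((volume : Measure 𝔼).restrict Ω) q Dᶜ).comp
    (ContinuousLinearMap.snd ℝ _ _)

lemma gradientRestrict_coeFn (x : Lp ℝ q ((volume : Measure 𝔼).restrict Ω) ×
    Lp 𝔼 q ((volume : Measure 𝔼).restrict Ω)) :
    gradientRestrict q D Ω x =ᵐ[((volume : Measure 𝔼).restrict Ω).restrict Dᶜ] x.2 :=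
  LpToLpRestrictCLM_coeFn ℝ Dᶜ x.2

namespace IsReflectionCover

/-- The pairs `(ψ, ∇ψ)` for the reflection extensions `ψ` of test functions. -/
noncomputable def extensionPairs (h : IsReflectionCover D χ Φ L) (hD : IsOpen D) (q : ℝ≥0∞)
    [Fact (1 ≤ q)] (Ω : Set (EuclideanSpace ℝ (Fin n))) :
    Submodule ℝ (Lp ℝ q ((volume : Measure 𝔼).restrict Ω) ×
      Lp 𝔼 q ((volume : Measure 𝔼).restrict Ω)) where
  carrier := {x | ∃ φ, IsTestFunction Ω φ ∧
    x.1 =ᵐ[volume.restrict Ω] reflectionExtension D χ Φ φ ∧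
    x.2 =ᵐ[volume.restrict Ω] gradient (reflectionExtension D χ Φ φ)}
  zero_mem' := by
    have h0 : reflectionExtension D χ Φ 0 = 0 := by
      simpa using reflectionExtension_const_smul (D := D) (χ := χ) (Φ := Φ) (φ := 0) 0
    refine ⟨0, IsTestFunction.zero, ?_, ?_⟩
    · rw [h0]
      exact Lp.coeFn_zero _ _ _
    · rw [h0]
      filter_upwards [Lp.coeFn_zero 𝔼 q (volume.restrict Ω)] with x hx
      have h : gradient (0 : 𝔼 → ℝ) x = 0 := gradient_fun_const x (0 : ℝ)
      rw [h]
      exact hx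
  add_mem' := by
    rintro x y ⟨φ, hφ, h1, h2⟩ ⟨ψ, hψ, h3, h4⟩
    refine ⟨φ + ψ, hφ.add hψ, ?_, ?_⟩
    · rw [reflectionExtension_add]
      exact (Lp.coeFn_add x.1 y.1).trans (h1.add h3)
    -- The extensions are only Lipschitz, so their gradients add only where both are differentiable,
    -- that is almost everywhere.
    · obtain ⟨K₁, hK₁⟩ := h.exists_lipschitzWith_reflectionExtension hφ hD
      obtain ⟨K₂, hK₂⟩ := h.exists_lipschitzWith_reflectionExtension hψ hD
      filter_upwards [Lp.coeFn_add x.2 y.2, h2, h4, ae_restrict_of_ae hK₁.ae_differentiableAt,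
        ae_restrict_of_ae hK₂.ae_differentiableAt] with z hz hz2 hz4 hd1 hd2
      rw [Prod.snd_add, hz, Pi.add_apply, hz2, hz4, reflectionExtension_add]
      simp [gradient, fderiv_add hd1 hd2]
  smul_mem' := by
    rintro c x ⟨φ, hφ, h1, h2⟩
    refine ⟨c • φ, hφ.const_smul c, ?_, ?_⟩
    · rw [reflectionExtension_const_smul]
      exact (Lp.coeFn_smul c x.1).trans (h1.const_smul c)
    · obtain ⟨K₁, hK₁⟩ := h.exists_lipschitzWith_reflectionExtension hφ hD
      filter_upwards [Lp.coeFn_smul c x.2, h2, ae_restrict_of_ae hK₁.ae_differentiableAt]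
        with z hz hz2 hd1
      rw [Prod.smul_snd, hz, Pi.smul_apply, hz2, reflectionExtension_const_smul]
      simp [gradient, fderiv_const_smul hd1]

variable (h : IsReflectionCover D χ Φ L) (hD : IsOpen D)

include h hD

/-- The extension is Lipschitz, and its support is compact in `Ω` because `closure D ⊆ Ω`, so
mollification approximates it by test functions. -/
lemma exists_mem_sobolevZero_reflectionExtension (hq : q ≠ ⊤) (hΩ : IsOpen Ω)
    (hDb : Bornology.IsBounded D) (hDΩ : closure D ⊆ Ω) {φ : 𝔼 → ℝ} (hφ : IsTestFunction Ω φ) :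
    ∃ x ∈ sobolevZero q Ω, x.1 =ᵐ[volume.restrict Ω] reflectionExtension D χ Φ φ ∧
      x.2 =ᵐ[volume.restrict Ω] gradient (reflectionExtension D χ Φ φ) := by
  obtain ⟨K₁, hK₁⟩ := h.exists_lipschitzWith_reflectionExtension hφ hD
  have hcpt : IsCompact (tsupport φ ∪ closure D) := IsCompact.union hφ.2 hDb.isCompact_closure
  have hsupp : HasCompactSupport (reflectionExtension D χ Φ φ) :=
    hcpt.of_isClosed_subset (isClosed_tsupport _)
      (closure_minimal support_reflectionExtension_subset hcpt.isClosed)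
  refine exists_mem_sobolevZero hq hK₁.hasWeakGradient
    (hK₁.continuous.memLp_of_hasCompactSupport hsupp) ?_
    hcpt hΩ (Set.union_subset hφ.3 hDΩ) support_reflectionExtension_subset
  have hgsupp : HasCompactSupport (gradient (reflectionExtension D χ Φ φ)) :=
    hsupp.of_isClosed_subset (isClosed_tsupport _) (tsupport_gradient_subset _)
  exact (memLp_top_of_bound (measurable_gradient _).aestronglyMeasurable K₁
    (ae_of_all _ hK₁.norm_gradient_le)).mono_exponent_of_measure_support_ne_top
    (fun x hx => image_eq_zero_of_notMem_tsupport hx) hgsupp.measure_lt_top.ne le_top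

lemma extensionPairs_le (hq : q ≠ ⊤) (hΩ : IsOpen Ω)
    (hDb : Bornology.IsBounded D) (hDΩ : closure D ⊆ Ω) :
    h.extensionPairs hD q Ω ≤ sobolevZero q Ω := by
  rintro x ⟨φ, hφ, h1, h2⟩
  obtain ⟨y, hy, h3, h4⟩ :=
    h.exists_mem_sobolevZero_reflectionExtension hD hq hΩ hDb hDΩ hφ
  have : x = y := Prod.ext (Lp.ext (h1.trans h3.symm)) (Lp.ext (h2.trans h4.symm))
  rwa [this]

/-- Reflection removes the freedom inside `D`: for extensions, the gradient in `D` is controlled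
from outside. No such bound could hold for all test functions, whose gradients in `D` are arbitrary.
-/
lemma exists_norm_le (hq : q ≠ ⊤) :
    ∃ C : ℝ, 0 < C ∧ ∀ x ∈ h.extensionPairs hD q Ω,
      ‖x‖ ≤ C * (‖gradientRestrict q D Ω x‖ + ‖x.1‖) := by
  obtain ⟨C, hC⟩ := h.exists_eLpNorm_gradient_le (Ω := Ω) (Fact.out : 1 ≤ q) hq hD
  refine ⟨1 + C, by positivity, ?_⟩
  rintro x ⟨φ, hφ, h1, h2⟩
  set ψ := reflectionExtension D χ Φ φ with hψ
  have hDm := hD.measurableSet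
  have hcomm : (volume.restrict Dᶜ).restrict Ω = (volume.restrict Ω).restrict Dᶜ :=
    (Measure.restrict_comm hDm.compl).symm
  have hR : eLpNorm (gradient ψ) q ((volume.restrict Ω).restrict Dᶜ)
      = ENNReal.ofReal ‖gradientRestrict q D Ω x‖ := by
    rw [Lp.norm_def, ENNReal.ofReal_toReal (Lp.eLpNorm_ne_top _)]
    exact eLpNorm_congr_ae
      ((EventuallyEq.restrict h2).symm.trans (gradientRestrict_coeFn x).symm)
  have hφ1 : eLpNorm φ q (volume.restrict Dᶜ) ≤ ENNReal.ofReal ‖x.1‖ := by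
    rw [Lp.norm_def, ENNReal.ofReal_toReal (Lp.eLpNorm_ne_top _), eLpNorm_congr_ae h1,
      ← eLpNorm_restrict_eq_of_support_subset ((subset_tsupport φ).trans hφ.3), hcomm]
    refine le_trans (le_of_eq (eLpNorm_congr_ae ?_)) (eLpNorm_restrict_le _ _ _ Dᶜ)
    filter_upwards [ae_restrict_mem hDm.compl] with y hy
    rw [hψ, reflectionExtension_apply_of_notMem hy]
  have hφ2 : eLpNorm (gradient φ) q (volume.restrict Dᶜ)
      = ENNReal.ofReal ‖gradientRestrict q D Ω x‖ := by
    rw [← eLpNorm_restrict_eq_of_support_subset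
      ((subset_tsupport _).trans ((tsupport_gradient_subset φ).trans hφ.3)), ← hR, hcomm]
    refine eLpNorm_congr_ae ?_
    rw [← hcomm]
    exact (EventuallyEq.restrict (h.gradient_reflectionExtension_ae_eq hφ hD)).symm
  have hx2 : ENNReal.ofReal ‖x.2‖ ≤ ENNReal.ofReal
      (C * (‖x.1‖ + ‖gradientRestrict q D Ω x‖) + ‖gradientRestrict q D Ω x‖) := by
    have hn2 : ENNReal.ofReal ‖x.2‖ = eLpNorm (gradient ψ) q (volume.restrict Ω) := by
      rw [Lp.norm_def, ENNReal.ofReal_toReal (Lp.eLpNorm_ne_top _), eLpNorm_congr_ae h2]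
    have hm := (measurable_gradient ψ).aestronglyMeasurable (μ := volume.restrict Ω)
    rw [hn2, ENNReal.ofReal_add (by positivity) (by positivity), ENNReal.ofReal_mul (by positivity),
      ENNReal.ofReal_coe_nnreal, ENNReal.ofReal_add (by positivity) (by positivity)]
    calc eLpNorm (gradient ψ) q (volume.restrict Ω)
        = eLpNorm (D.indicator (gradient ψ) + Dᶜ.indicator (gradient ψ)) q
            (volume.restrict Ω) := by rw [Set.indicator_self_add_compl]
      _ ≤ eLpNorm (D.indicator (gradient ψ)) q (volume.restrict Ω)
          + eLpNorm (Dᶜ.indicator (gradient ψ)) q (volume.restrict Ω) :=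
          eLpNorm_add_le (hm.indicator hDm) (hm.indicator hDm.compl) Fact.out
      _ ≤ eLpNorm (gradient ψ) q (volume.restrict D)
          + ENNReal.ofReal ‖gradientRestrict q D Ω x‖ := by
          rw [eLpNorm_indicator_eq_eLpNorm_restrict hDm,
            eLpNorm_indicator_eq_eLpNorm_restrict hDm.compl, hR]
          gcongr
          exact Measure.restrict_le_self
      _ ≤ _ := by
          gcongr
          refine (hC φ hφ).trans ?_
          rw [hφ2]
          gcongr
  rw [ENNReal.ofReal_le_ofReal_iff (by positivity)] at hx2
  have hR0 := norm_nonneg (gradientRestrict q D Ω x)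
  have hx10 := norm_nonneg x.1
  have hC0 : (0 : ℝ) ≤ C := C.2
  rw [Prod.norm_def, max_le_iff]
  constructor
  · nlinarith [mul_nonneg hC0 hR0, mul_nonneg hC0 hx10]
  · nlinarith [mul_nonneg hC0 hR0, mul_nonneg hC0 hx10]

/-- The gradients outside `D` of functions in `W^{1,q}_0(Ω)` form a closed subspace. -/
lemma isClosed_map_gradientRestrict (hq : q ≠ ⊤) (hΩ : IsOpen Ω)
    (hΩb : Bornology.IsBounded Ω) (hDΩ : closure D ⊆ Ω) :
    IsClosed ((sobolevZero q Ω).map (gradientRestrict q D Ω).toLinearMap :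
      Set (Lp 𝔼 q (((volume : Measure 𝔼).restrict Ω).restrict Dᶜ))) := by
  have hDb : Bornology.IsBounded D := hΩb.subset (subset_closure.trans hDΩ)
  set R := gradientRestrict q D Ω with hRdef
  -- A smaller space with the same gradients outside `D`, on which the Sobolev norm is controlled by
  -- these gradients and the `L^q` norm.
  set X := (h.extensionPairs hD q Ω).topologicalClosure with hX
  have hXcl : IsClosed (X : Set (Lp ℝ q ((volume : Measure 𝔼).restrict Ω) ×
      Lp 𝔼 q ((volume : Measure 𝔼).restrict Ω))) :=
    (h.extensionPairs hD q Ω).isClosed_topologicalClosure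
  have hXle : X ≤ sobolevZero q Ω :=
    Submodule.topologicalClosure_minimal _ (h.extensionPairs_le hD hq hΩ hDb hDΩ)
      (testPairs q Ω).isClosed_topologicalClosure
  obtain ⟨C, hC0, hC⟩ := h.exists_norm_le (q := q) (Ω := Ω) hD hq
  have hC' : ∀ x ∈ X, ‖x‖ ≤ C * (‖R x‖ + ‖x.1‖) := by
    intro x hx
    have hcl : IsClosed {x | ‖x‖ ≤ C * (‖R x‖ + ‖x.1‖)} := isClosed_le (by fun_prop) (by fun_prop)
    exact closure_minimal (s := (h.extensionPairs hD q Ω : Set _)) (fun x hx => hC x hx) hcl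
      (by rwa [hX, ← SetLike.mem_coe, Submodule.topologicalClosure_coe] at hx)
  -- With the factor `1 / (2 * C)` the `L^q` term contributes only `‖x‖ / 2`, which is absorbed on
  -- the left, plus a finite rank term.
  obtain ⟨T, P, hP⟩ := exists_finite_rank_bound hq hΩb hΩ.measurableSet
    (show 0 < 1 / (2 * C) by positivity)
  have hXR : IsClosed (X.map R.toLinearMap :
      Set (Lp 𝔼 q (((volume : Measure 𝔼).restrict Ω).restrict Dᶜ))) := by
    refine isClosed_map_of_norm_le_add_norm R (P.comp (ContinuousLinearMap.fst ℝ _ _)) hXcl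
      (C := 2 * C) fun x hx => ?_
    have h1 := hC' x hx
    have h2 := hP x (hXle hx)
    have h3 : C * ‖x.1‖ ≤ C * (1 / (2 * C) * ‖x‖ + ‖P x.1‖) := by gcongr
    have h4 : C * (1 / (2 * C) * ‖x‖ + ‖P x.1‖) = ‖x‖ / 2 + C * ‖P x.1‖ := by
      field_simp
    change ‖x‖ ≤ 2 * C * (‖R x‖ + ‖P x.1‖)
    linarith
  have heq : (sobolevZero q Ω).map R.toLinearMap = X.map R.toLinearMap := by
    refine le_antisymm ?_ (Submodule.map_mono hXle)
    rintro _ ⟨x, hx, rfl⟩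
    -- Once the image of `X` is known to be closed, test functions suffice for the other inclusion;
    -- each has the same gradient outside `D` as its extension.
    have hcl : IsClosed {x | R x ∈ X.map R.toLinearMap} := hXR.preimage R.continuous
    refine closure_minimal (s := (testPairs q Ω : Set _)) ?_ hcl
      (by rwa [sobolevZero, Submodule.topologicalClosure_coe] at hx)
    rintro y ⟨φ, hφ, h1, h2⟩
    obtain ⟨z, hz, h3, h4⟩ :=
      h.exists_mem_sobolevZero_reflectionExtension (q := q) hD hq hΩ hDb hDΩ hφ
    refine ⟨z, Submodule.le_topologicalClosure _ ⟨φ, hφ, h3, h4⟩, Lp.ext ?_⟩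
    have hcomm : (volume.restrict Dᶜ).restrict Ω = (volume.restrict Ω).restrict Dᶜ :=
      (Measure.restrict_comm hD.measurableSet.compl).symm
    refine (gradientRestrict_coeFn z).trans (EventuallyEq.trans ?_ (gradientRestrict_coeFn y).symm)
    refine (EventuallyEq.restrict h4).trans (EventuallyEq.trans ?_ (EventuallyEq.restrict h2).symm)
    rw [← hcomm]
    exact EventuallyEq.restrict (h.gradient_reflectionExtension_ae_eq hφ hD)
  rw [heq]
  exact hXR

end IsReflectionCover

end ClosedRange

/-! ### Uniform convexity of the `p`-energy -/

section UniformConvexity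

variable {V : Type*} [NormedAddCommGroup V] [InnerProductSpace ℝ V] {p : ℝ}

/-- Vectors of equal norm are handled by strict convexity of the norm ball, vectors of different
norm by strict convexity of `t ↦ t ^ p`. -/
lemma two_mul_norm_half_add_rpow_lt (hp : 1 < p) {a b : V} (hab : a ≠ b) :
    2 * ‖(1 / 2 : ℝ) • (a + b)‖ ^ p < ‖a‖ ^ p + ‖b‖ ^ p := by
  rcases eq_or_ne ‖a‖ ‖b‖ with h | h
  · have h1 : ‖(1 / 2 : ℝ) • (a + b)‖ < ‖a‖ := (norm_midpoint_lt_iff h).mpr hab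
    have h2 := Real.rpow_lt_rpow (norm_nonneg _) h1 (by linarith : 0 < p)
    rw [← h]
    linarith
  · have h1 : ‖(1 / 2 : ℝ) • (a + b)‖ ≤ (1 / 2) * ‖a‖ + (1 / 2) * ‖b‖ := by
      rw [norm_smul, Real.norm_of_nonneg (by norm_num), ← mul_add]
      gcongr
      exact norm_add_le a b
    have h2 := (strictConvexOn_rpow hp).2 (norm_nonneg a) (norm_nonneg b) h
      (show (0 : ℝ) < 1 / 2 by norm_num) (show (0 : ℝ) < 1 / 2 by norm_num) (by norm_num)
    simp only [smul_eq_mul] at h2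
    have h3 := Real.rpow_le_rpow (norm_nonneg _) h1 (by linarith : 0 ≤ p)
    linarith

lemma two_mul_norm_half_add_rpow_le (hp : 1 < p) (a b : V) :
    2 * ‖(1 / 2 : ℝ) • (a + b)‖ ^ p ≤ ‖a‖ ^ p + ‖b‖ ^ p := by
  rcases eq_or_ne a b with rfl | h
  · rw [← two_smul ℝ a, smul_smul]
    norm_num
    linarith
  · exact (two_mul_norm_half_add_rpow_lt hp h).le

/-- Uniform convexity of `‖·‖ ^ p`. -/
lemma exists_norm_sub_rpow_add_le [FiniteDimensional ℝ V] (hp : 1 < p) {ε : ℝ} (hε : 0 < ε) :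
    ∃ C : ℝ, 0 ≤ C ∧ ∀ a b : V, ‖a - b‖ ^ p + 2 * C * ‖(1 / 2 : ℝ) • (a + b)‖ ^ p ≤
      (ε + C) * (‖a‖ ^ p + ‖b‖ ^ p) := by
  have hp0 : 0 < p := by linarith
  -- By homogeneity it suffices to treat `‖a‖ ^ p + ‖b‖ ^ p = 1`. Pairs that are also separated form
  -- a compact set, on which the convexity defect has a positive minimum `δ`.
  let S : Set (V × V) := {z | ‖z.1‖ ^ p + ‖z.2‖ ^ p = 1 ∧ ε ≤ ‖z.1 - z.2‖ ^ p}
  have hnorm : ∀ a b : V, ‖a‖ ^ p + ‖b‖ ^ p = 1 → ‖a‖ ≤ 1 ∧ ‖b‖ ≤ 1 := by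
    intro a b h
    have h1 : 0 ≤ ‖a‖ ^ p := by positivity
    have h2 : 0 ≤ ‖b‖ ^ p := by positivity
    constructor
    · by_contra! hlt
      have := Real.one_lt_rpow hlt hp0
      linarith
    · by_contra! hlt
      have := Real.one_lt_rpow hlt hp0
      linarith
  have hcp : Continuous fun x : ℝ => x ^ p := Real.continuous_rpow_const hp0.le
  have hSc : IsCompact S := by
    have hcl : IsClosed S := by
      have h1 : IsClosed {z : V × V | ‖z.1‖ ^ p + ‖z.2‖ ^ p = 1} :=
        isClosed_eq ((hcp.comp continuous_fst.norm).add (hcp.comp continuous_snd.norm))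
          continuous_const
      have h2 : IsClosed {z : V × V | ε ≤ ‖z.1 - z.2‖ ^ p} :=
        isClosed_le continuous_const (hcp.comp (continuous_fst.sub continuous_snd).norm)
      exact h1.inter h2
    refine (isCompact_closedBall (0 : V × V) 1).of_isClosed_subset hcl fun z hz => ?_
    rw [mem_closedBall_zero_iff, Prod.norm_def, max_le_iff]
    exact hnorm z.1 z.2 hz.1
  obtain ⟨δ, hδ0, hδ⟩ : ∃ δ > 0, ∀ z ∈ S, δ ≤ 1 - 2 * ‖(1 / 2 : ℝ) • (z.1 + z.2)‖ ^ p := by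
    rcases S.eq_empty_or_nonempty with h | h
    · exact ⟨1, one_pos, fun z hz => by simp [h] at hz⟩
    · obtain ⟨z, hz, hmin⟩ := hSc.exists_isMinOn h
        (f := fun z : V × V => 1 - 2 * ‖(1 / 2 : ℝ) • (z.1 + z.2)‖ ^ p)
        (Continuous.continuousOn (continuous_const.sub (continuous_const.mul
          (hcp.comp ((continuous_fst.add continuous_snd).const_smul (1 / 2 : ℝ)).norm))))
      refine ⟨_, ?_, fun w hw => hmin hw⟩
      have hne : z.1 ≠ z.2 := by
        intro heq
        have := hz.2
        rw [heq, sub_self, norm_zero, Real.zero_rpow hp0.ne'] at this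
        linarith
      have := two_mul_norm_half_add_rpow_lt hp hne
      rw [hz.1] at this
      simp only
      linarith
  -- On `S` one has `‖a - b‖ ^ p ≤ 2 ^ p = C * δ`, so `C` times the defect pays for the difference.
  -- Off `S` the term `ε` does.
  refine ⟨2 ^ p / δ, by positivity, ?_⟩
  have hunit : ∀ a b : V, ‖a‖ ^ p + ‖b‖ ^ p = 1 →
      ‖a - b‖ ^ p + 2 * (2 ^ p / δ) * ‖(1 / 2 : ℝ) • (a + b)‖ ^ p ≤ ε + 2 ^ p / δ := by
    intro a b hab
    have hC0 : 0 < 2 ^ p / δ := by positivity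
    have hd := two_mul_norm_half_add_rpow_le hp a b
    rw [hab] at hd
    by_cases hS : ε ≤ ‖a - b‖ ^ p
    · have h1 := hδ (a, b) ⟨hab, hS⟩
      simp only at h1
      have h2 : ‖a - b‖ ^ p ≤ 2 ^ p := by
        refine Real.rpow_le_rpow (norm_nonneg _) ?_ hp0.le
        have := hnorm a b hab
        linarith [norm_sub_le a b]
      have h3 : 2 ^ p ≤ 2 ^ p / δ * (1 - 2 * ‖(1 / 2 : ℝ) • (a + b)‖ ^ p) := by
        calc (2 : ℝ) ^ p = 2 ^ p / δ * δ := by field_simp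
          _ ≤ _ := by gcongr
      linarith
    · have : 2 ^ p / δ * (2 * ‖(1 / 2 : ℝ) • (a + b)‖ ^ p) ≤ 2 ^ p / δ * 1 := by gcongr
      linarith
  intro a b
  have ha : 0 ≤ ‖a‖ ^ p := by positivity
  have hb : 0 ≤ ‖b‖ ^ p := by positivity
  rcases (add_nonneg ha hb).eq_or_lt with h0 | h0
  · have ha0 : ‖a‖ ^ p = 0 := by linarith
    have hb0 : ‖b‖ ^ p = 0 := by linarith
    rw [Real.rpow_eq_zero (norm_nonneg _) hp0.ne', norm_eq_zero] at ha0 hb0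
    simp [ha0, hb0, Real.zero_rpow hp0.ne']
  · set t := (‖a‖ ^ p + ‖b‖ ^ p) ^ (1 / p) with ht
    have ht0 : 0 < t := by positivity
    have htp : t ^ p = ‖a‖ ^ p + ‖b‖ ^ p := by
      rw [ht, ← Real.rpow_mul h0.le, one_div, inv_mul_cancel₀ hp0.ne', Real.rpow_one]
    have hsc : ∀ c : V, ‖t⁻¹ • c‖ ^ p = ‖c‖ ^ p / t ^ p := by
      intro c
      rw [norm_smul, norm_inv, Real.norm_of_nonneg ht0.le, Real.mul_rpow (by positivity)
        (norm_nonneg _), Real.inv_rpow ht0.le]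
      ring
    have h1 := hunit (t⁻¹ • a) (t⁻¹ • b) (by
      rw [hsc, hsc, ← add_div, htp, div_self h0.ne'])
    rw [← smul_sub, ← smul_add, smul_comm (1 / 2 : ℝ) t⁻¹, hsc, hsc, htp] at h1
    have h2 := mul_le_mul_of_nonneg_right h1 h0.le
    calc _ = (‖a - b‖ ^ p / (‖a‖ ^ p + ‖b‖ ^ p) + 2 * (2 ^ p / δ) *
          (‖(1 / 2 : ℝ) • (a + b)‖ ^ p / (‖a‖ ^ p + ‖b‖ ^ p))) * (‖a‖ ^ p + ‖b‖ ^ p) := by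
          field_simp
      _ ≤ _ := h2

/-- The weighted energy `∫ σ ‖G‖ ^ p` is uniformly convex. -/
lemma exists_lintegral_norm_sub_rpow_add_le [FiniteDimensional ℝ V] [MeasurableSpace V]
    [BorelSpace V] (hp : 1 < p) {ε : ℝ≥0} (hε : ε ≠ 0) :
    ∃ C : ℝ≥0, ∀ {α : Type*} [MeasurableSpace α] (μ : Measure α) (σ : α → ℝ≥0∞) (G H : α → V),
      AEMeasurable σ μ → AEStronglyMeasurable G μ → AEStronglyMeasurable H μ →
      ∫⁻ x, σ x * ENNReal.ofReal (‖G x - H x‖ ^ p) ∂μ +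
        2 * C * ∫⁻ x, σ x * ENNReal.ofReal (‖(1 / 2 : ℝ) • (G x + H x)‖ ^ p) ∂μ ≤
      (ε + C) * (∫⁻ x, σ x * ENNReal.ofReal (‖G x‖ ^ p) ∂μ +
        ∫⁻ x, σ x * ENNReal.ofReal (‖H x‖ ^ p) ∂μ) := by
  obtain ⟨C, hC0, hC⟩ := exists_norm_sub_rpow_add_le (V := V) hp
    (NNReal.coe_pos.mpr (pos_iff_ne_zero.mpr hε))
  refine ⟨C.toNNReal, fun μ σ G H hσ hG hH => ?_⟩
  have hm : ∀ {F : _ → V}, AEStronglyMeasurable F μ →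
      AEMeasurable (fun x => σ x * ENNReal.ofReal (‖F x‖ ^ p)) μ := fun hF =>
    hσ.mul (hF.norm.aemeasurable.pow_const p).ennreal_ofReal
  have hm1 : AEMeasurable (fun x => σ x * ENNReal.ofReal (‖(1 / 2 : ℝ) • (G x + H x)‖ ^ p)) μ :=
    hm ((hG.add hH).const_smul (1 / 2 : ℝ))
  have hm2 : AEMeasurable (fun x => σ x * ENNReal.ofReal (‖G x - H x‖ ^ p)) μ := hm (hG.sub hH)
  have hm3 : AEMeasurable (fun x => σ x * ENNReal.ofReal (‖G x‖ ^ p) +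
      σ x * ENNReal.ofReal (‖H x‖ ^ p)) μ := (hm hG).add (hm hH)
  rw [← lintegral_add_left' (hm hG), ← lintegral_const_mul'' _ hm1,
    ← lintegral_add_left' hm2, ← lintegral_const_mul'' _ hm3]
  refine lintegral_mono fun x => ?_
  have h1 := ENNReal.ofReal_le_ofReal (hC (G x) (H x))
  rw [ENNReal.ofReal_add (by positivity) (by positivity), ENNReal.ofReal_mul (by positivity),
    ENNReal.ofReal_mul (by positivity), ENNReal.ofReal_mul (by positivity),
    ENNReal.ofReal_add (by positivity) (by positivity),
    ENNReal.ofReal_add (by positivity) (by positivity)] at h1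
  have h2 := mul_le_mul_right h1 (σ x)
  simp only [ENNReal.ofReal_coe_nnreal, ENNReal.ofReal_ofNat] at h2
  change _ ≤ _ * (_ + _)
  have h3 : ((C.toNNReal : ℝ≥0) : ℝ≥0∞) = ENNReal.ofReal C := rfl
  rw [h3]
  calc _ = σ x * (ENNReal.ofReal (‖G x - H x‖ ^ p) + 2 * ENNReal.ofReal C *
        ENNReal.ofReal (‖(1 / 2 : ℝ) • (G x + H x)‖ ^ p)) := by ring
    _ ≤ _ := h2
    _ = _ := by ring

end UniformConvexity

/-! ### Existence of minimizers -/

section Energy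

variable {n : ℕ}

set_option hygiene false in
local notation "𝔼" => EuclideanSpace ℝ (Fin n)

variable {p : ℝ} {Ω D : Set (EuclideanSpace ℝ (Fin n))} {σ : EuclideanSpace ℝ (Fin n) → ℝ≥0∞}
  {f u v : EuclideanSpace ℝ (Fin n) → ℝ} {G : 𝔼 → 𝔼}

lemma HasWeakGradient.pEnergy_eq (h : HasWeakGradient Ω u G) (hΩ : IsOpen Ω) :
    pEnergy p Ω σ u = ∫⁻ x in Ω, σ x * ENNReal.ofReal (‖G x‖ ^ p) := by
  refine lintegral_congr_ae ?_
  filter_upwards [h.weakGradient_ae_eq hΩ] with x hx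
  rw [hx]

lemma MemSobolevZero.memSobolev_of_sub (hΩ : IsOpen Ω) (h : MemSobolevZero p Ω (u - f))
    (hf : MemSobolev p Ω f) : MemSobolev p Ω u := by
  simpa using h.memSobolev.add hΩ hf

lemma exists_pEnergy_sub_add_le (hΩ : IsOpen Ω) (hσ : AEMeasurable σ (volume.restrict Ω))
    (hp : 1 < p) {ε : ℝ≥0} (hε : ε ≠ 0) :
    ∃ C : ℝ≥0, ∀ u v, MemSobolev p Ω u → MemSobolev p Ω v →
      pEnergy p Ω σ (u - v) + 2 * C * pEnergy p Ω σ ((1 / 2 : ℝ) • (u + v)) ≤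
        (ε + C) * (pEnergy p Ω σ u + pEnergy p Ω σ v) := by
  obtain ⟨C, hC⟩ := exists_lintegral_norm_sub_rpow_add_le (V := 𝔼) hp hε
  refine ⟨C, fun u v hu hv => ?_⟩
  rw [(hu.hasWeakGradient.sub hv.hasWeakGradient).pEnergy_eq hΩ,
    ((hu.hasWeakGradient.add hv.hasWeakGradient).const_smul (1 / 2)).pEnergy_eq hΩ]
  exact hC _ σ _ _ hσ hu.3.1 hv.3.1

/-- The difference of two competitors has small energy if their energies are close to a lower
bound of the energy. -/
lemma exists_pEnergy_sub_le [Fact (1 ≤ ENNReal.ofReal p)] (hΩ : IsOpen Ω)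
    (hσ : AEMeasurable σ (volume.restrict Ω)) (hp : 1 < p) (hf : MemSobolev p Ω f) {I : ℝ≥0}
    (hI : ∀ v, MemSobolevZero p Ω (v - f) → I ≤ pEnergy p Ω σ v) {η : ℝ≥0} (hη : η ≠ 0) :
    ∃ δ : ℝ≥0, δ ≠ 0 ∧ ∀ u v, MemSobolevZero p Ω (u - f) → MemSobolevZero p Ω (v - f) →
      pEnergy p Ω σ u ≤ I + δ → pEnergy p Ω σ v ≤ I + δ → pEnergy p Ω σ (u - v) ≤ η := by
  have hηp : 0 < η := pos_iff_ne_zero.mpr hη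
  -- This gives `ε * I ≤ η / 4`, and the `δ` below gives `(ε + C) * δ = η / 4`. Each occurs twice,
  -- which adds up to `η`.
  set ε : ℝ≥0 := η / (4 * (I + 1)) with hε
  have hε0 : ε ≠ 0 := by positivity
  obtain ⟨C, hC⟩ := exists_pEnergy_sub_add_le hΩ hσ hp hε0
  refine ⟨η / (4 * (ε + C)), by positivity, fun u v hu hv huI hvI => ?_⟩
  set δ : ℝ≥0 := η / (4 * (ε + C)) with hδ
  -- The midpoint is a competitor, so its energy is at least `I`; the finite term `2 * C * I` then
  -- cancels from both sides.
  have hmid : MemSobolevZero p Ω ((1 / 2 : ℝ) • (u + v) - f) := by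
    have h1 := (hu.add hΩ hv).const_smul hΩ (1 / 2)
    have h2 : (1 / 2 : ℝ) • (u + v) - f = (1 / 2 : ℝ) • (u - f + (v - f)) := by
      ext x
      simp
      ring
    rwa [h2]
  have h1 := hC u v (hu.memSobolev_of_sub hΩ hf) (hv.memSobolev_of_sub hΩ hf)
  have h2 : pEnergy p Ω σ (u - v) + 2 * C * I ≤ (ε + C) * ((I + δ) + (I + δ)) := by
    calc _ ≤ pEnergy p Ω σ (u - v) + 2 * C * pEnergy p Ω σ ((1 / 2 : ℝ) • (u + v)) := by
          gcongr
          exact hI _ hmid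
      _ ≤ _ := h1
      _ ≤ _ := by gcongr
  have h3 : (ε + C) * ((I + δ) + (I + δ)) ≤ η + 2 * C * I := by
    have h4 : ε * I ≤ η / 4 := by
      rw [hε, div_mul_eq_mul_div, div_le_div_iff₀ (by positivity) (by positivity)]
      have : η * I * 4 ≤ η * (I + 1) * 4 := by gcongr; simp
      calc _ ≤ _ := this
        _ = _ := by ring
    have h5 : (ε + C) * δ = η / 4 := by
      rw [hδ]
      have : ε + C ≠ 0 := by positivity
      field_simp
    calc (ε + C) * ((I + δ) + (I + δ)) = 2 * (ε * I) + 2 * ((ε + C) * δ) + 2 * C * I := by ring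
      _ ≤ 2 * (η / 4) + 2 * (η / 4) + 2 * C * I := by rw [h5]; gcongr
      _ = _ := by
        congr 1
        rw [← NNReal.coe_inj]
        push_cast
        ring
  have h6 : pEnergy p Ω σ (u - v) + ((2 * C * I : ℝ≥0) : ℝ≥0∞) ≤ η + ((2 * C * I : ℝ≥0) : ℝ≥0∞) := by
    refine le_trans (le_of_eq (by push_cast; ring)) (h2.trans ?_)
    exact_mod_cast h3
  exact (ENNReal.add_le_add_iff_right ENNReal.coe_ne_top).mp h6

lemma ofReal_mul_norm_gradientRestrict_rpow_le [Fact (1 ≤ ENNReal.ofReal p)] (hΩ : IsOpen Ω)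
    (hD : IsOpen D) (hp : 1 < p) {m : ℝ} (hm0 : 0 < m)
    (hm : ∀ᵐ x ∂(volume.restrict (Ω \ D)), ENNReal.ofReal m ≤ σ x)
    {x : Lp ℝ (ENNReal.ofReal p) ((volume : Measure 𝔼).restrict Ω) ×
      Lp 𝔼 (ENNReal.ofReal p) ((volume : Measure 𝔼).restrict Ω)}
    (hx : HasWeakGradient Ω u x.2) :
    ENNReal.ofReal (m * ‖gradientRestrict (ENNReal.ofReal p) D Ω x‖ ^ p) ≤ pEnergy p Ω σ u := by
  have hp0 : 0 < p := by linarith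
  have hq0 : ENNReal.ofReal p ≠ 0 := by simpa using hp0
  have hres : ((volume : Measure 𝔼).restrict Ω).restrict Dᶜ = volume.restrict (Ω \ D) := by
    rw [Measure.restrict_restrict hD.measurableSet.compl, Set.inter_comm, Set.sdiff_eq]
  rw [hx.pEnergy_eq hΩ, ENNReal.ofReal_mul hm0.le, Lp.norm_def,
    ENNReal.toReal_rpow, ENNReal.ofReal_toReal
      (ENNReal.rpow_ne_top_of_nonneg hp0.le (Lp.eLpNorm_ne_top _)),
    eLpNorm_congr_ae (gradientRestrict_coeFn x),
    eLpNorm_eq_lintegral_rpow_enorm_toReal hq0 ENNReal.ofReal_ne_top, ENNReal.toReal_ofReal hp0.le,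
    ← ENNReal.rpow_mul, one_div, inv_mul_cancel₀ hp0.ne', ENNReal.rpow_one, hres,
    ← lintegral_const_mul' _ _ ENNReal.ofReal_ne_top]
  refine (lintegral_mono_ae ?_).trans
    (lintegral_mono' (Measure.restrict_mono Set.sdiff_subset le_rfl) le_rfl)
  filter_upwards [hm] with y hy
  rw [← ENNReal.ofReal_rpow_of_nonneg (norm_nonneg _) hp0.le, ofReal_norm]
  gcongr

lemma le_liminf_mul_ofReal_norm_rpow {V : Type*} [NormedAddCommGroup V] (hp : 0 < p) (a : ℝ≥0∞)
    {g : ℕ → V} {b : V} (hg : Tendsto g atTop (𝓝 b)) :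
    a * ENNReal.ofReal (‖b‖ ^ p) ≤ liminf (fun k => a * ENNReal.ofReal (‖g k‖ ^ p)) atTop := by
  have h1 : Tendsto (fun k => ENNReal.ofReal (‖g k‖ ^ p)) atTop (𝓝 (ENNReal.ofReal (‖b‖ ^ p))) :=
    ENNReal.tendsto_ofReal (hg.norm.rpow_const (Or.inr hp.le))
  -- For `a = ∞` multiplication is discontinuous at `0`, where only the trivial inequality remains.
  rcases eq_or_ne (ENNReal.ofReal (‖b‖ ^ p)) 0 with h0 | h0
  · rw [h0, mul_zero]
    exact zero_le
  · exact (ENNReal.Tendsto.const_mul h1 (Or.inl h0)).liminf_eq.ge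

lemma exists_minimizing_seq {α : Type*} {A : α → Prop} {E : α → ℝ≥0∞}
    (h : ∃ v, A v ∧ E v < ⊤) : ∃ (I : ℝ≥0) (w : ℕ → α), (∀ v, A v → I ≤ E v) ∧
      (∀ k, A (w k)) ∧ Tendsto (fun k => E (w k)) atTop (𝓝 I) := by
  obtain ⟨v₀, hv₀, hE⟩ := h
  have hne : {v | A v}.Nonempty := ⟨v₀, hv₀⟩
  obtain ⟨s, -, hs, hmem⟩ := exists_seq_tendsto_sInf (hne.image E) (OrderBot.bddBelow _)
  have hlt : sInf (E '' {v | A v}) < ⊤ :=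
    (sInf_le (Set.mem_image_of_mem E (show v₀ ∈ {v | A v} from hv₀))).trans_lt hE
  choose w hwA hwE using hmem
  refine ⟨(sInf (E '' {v | A v})).toNNReal, w, fun v hv => ?_, hwA, ?_⟩
  · rw [ENNReal.coe_toNNReal hlt.ne]
    exact sInf_le (Set.mem_image_of_mem E (show v ∈ {v | A v} from hv))
  · rw [ENNReal.coe_toNNReal hlt.ne]
    exact hs.congr fun k => (hwE k).symm

/-- The direct method: minimizers exist if the energy is coercive outside `D` and vanishes
in `D`. -/
lemma IsReflectionCover.exists_isEnergyMinimizer {ι : Type*} [Fintype ι] {χ : ι → 𝔼 → ℝ}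
    {Φ : ι → 𝔼 → 𝔼} {L : ℝ≥0} [hpf : Fact (1 ≤ ENNReal.ofReal p)] (h : IsReflectionCover D χ Φ L)
    (hD : IsOpen D) (hΩ : IsOpen Ω) (hΩb : Bornology.IsBounded Ω) (hDΩ : closure D ⊆ Ω)
    (hσ : AEMeasurable σ (volume.restrict Ω)) (hp : 1 < p) (hf : MemSobolev p Ω f)
    (hσD : ∀ x ∈ D, σ x = 0) {m : ℝ} (hm0 : 0 < m)
    (hm : ∀ᵐ x ∂(volume.restrict (Ω \ D)), ENNReal.ofReal m ≤ σ x)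
    (hfin : ∃ v, MemSobolevZero p Ω (v - f) ∧ pEnergy p Ω σ v < ⊤) :
    ∃ u, IsEnergyMinimizer p Ω σ f u := by
  have hp0 : 0 < p := by linarith
  obtain ⟨I, w, hIle, hwA, hwE⟩ := exists_minimizing_seq hfin
  choose x hxmem hx1 hx2 using fun k => (memSobolevZero_iff hΩ).mp (hwA k)
  have hxg : ∀ k, HasWeakGradient Ω (w k - f) (x k).2 := fun k =>
    (hwA k).memSobolev.hasWeakGradient.congr_ae (ae_eq_refl _) (hx2 k).symm
  set R := gradientRestrict (ENNReal.ofReal p) D Ω with hR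
  -- Nearly minimal energies make the energy of the difference small, and coercivity outside `D`
  -- turns this into smallness in `L^p`.
  have hcauchy : CauchySeq fun k => R (x k) := by
    rw [Metric.cauchySeq_iff]
    intro ρ hρ
    have hη0 : (m * ρ ^ p / 2).toNNReal ≠ 0 := by
      have : 0 < m * ρ ^ p / 2 := by positivity
      simpa using this
    obtain ⟨δ, hδ0, hδ⟩ := exists_pEnergy_sub_le hΩ hσ hp hf hIle hη0
    obtain ⟨N, hle⟩ := eventually_atTop.mp (hwE.eventually_le_const
      (ENNReal.lt_add_right ENNReal.coe_ne_top (ENNReal.coe_ne_zero.mpr hδ0)))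
    refine ⟨N, fun j hj k hk => ?_⟩
    have h1 := hδ (w j) (w k) (hwA j) (hwA k) (hle j hj) (hle k hk)
    have h2 : HasWeakGradient Ω (w j - w k) (x j - x k).2 := by
      have h3 := (hxg j).sub (hxg k)
      rw [sub_sub_sub_cancel_right] at h3
      exact h3.congr_ae (ae_eq_refl _) (Lp.coeFn_sub (x j).2 (x k).2).symm
    have h4 := (ofReal_mul_norm_gradientRestrict_rpow_le hΩ hD hp hm0 hm h2).trans h1
    rw [← hR, map_sub] at h4
    have h5 : m * ‖R (x j) - R (x k)‖ ^ p ≤ m * ρ ^ p / 2 :=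
      (ENNReal.ofReal_le_ofReal_iff (by positivity)).mp h4
    rw [dist_eq_norm]
    by_contra! hge
    have h6 := Real.rpow_le_rpow hρ.le hge hp0.le
    have h7 : 0 < m * ρ ^ p := by positivity
    have h8 : m * ρ ^ p ≤ m * ‖R (x j) - R (x k)‖ ^ p := by gcongr
    linarith
  obtain ⟨y, hy⟩ := cauchySeq_tendsto_of_complete hcauchy
  -- Closed range yields an admissible function with the limit gradient outside `D`. The functions
  -- `x k` themselves need not converge.
  obtain ⟨z, hz, rfl⟩ : y ∈ (sobolevZero (ENNReal.ofReal p) Ω).map R.toLinearMap :=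
    (h.isClosed_map_gradientRestrict hD ENNReal.ofReal_ne_top hΩ hΩb hDΩ).mem_of_tendsto hy
      (Eventually.of_forall fun k => Submodule.mem_map_of_mem (hxmem k))
  set u : 𝔼 → ℝ := z.1 + f with hu
  have huf : u - f = z.1 := by simp [hu]
  have huA : MemSobolevZero p Ω (u - f) :=
    (memSobolevZero_of_mem_sobolevZero hΩ hz (by rw [huf])).1
  refine ⟨u, huA, fun v hv => le_trans ?_ (hIle v hv)⟩
  have hgf := hf.hasWeakGradient
  have hwg : ∀ k, HasWeakGradient Ω (w k) ((x k).2 + weakGradient Ω f) := fun k => by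
    have := (hxg k).add hgf
    rwa [sub_add_cancel] at this
  have hug : HasWeakGradient Ω u (z.2 + weakGradient Ω f) :=
    (hasWeakGradient_of_mem_sobolevZero hΩ hz).add hgf
  obtain ⟨ns, hns, hae⟩ := (tendstoInMeasure_of_tendsto_Lp hy).exists_seq_tendsto_ae
  have hDm := hD.measurableSet
  have hae2 : ∀ᵐ a ∂((volume : Measure 𝔼).restrict Ω), a ∈ Dᶜ →
      Tendsto (fun i => (x (ns i)).2 a) atTop (𝓝 (z.2 a)) := by
    rw [← ae_restrict_iff' hDm.compl]
    have hall : ∀ᵐ a ∂((volume : Measure 𝔼).restrict Ω).restrict Dᶜ,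
        ∀ i, R (x (ns i)) a = (x (ns i)).2 a :=
      ae_all_iff.mpr fun i => gradientRestrict_coeFn _
    filter_upwards [hae, hall, gradientRestrict_coeFn (D := D) z] with a ha ha1 ha2
    simp_rw [ha1] at ha
    exact ha2 ▸ ha
  have hEk := hwE.comp hns.tendsto_atTop
  rw [hug.pEnergy_eq hΩ, ← hEk.liminf_eq]
  change _ ≤ liminf (fun i => pEnergy p Ω σ (w (ns i))) atTop
  simp_rw [fun i => (hwg (ns i)).pEnergy_eq (p := p) (σ := σ) hΩ]
  -- Fatou's lemma. In `D` no convergence is available, but the weight vanishes there.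
  refine le_trans (lintegral_mono_ae ?_) (lintegral_liminf_le' fun i => ?_)
  · filter_upwards [hae2] with a ha
    by_cases haD : a ∈ D
    · simp [hσD a haD]
    · exact le_liminf_mul_ofReal_norm_rpow hp0 _ ((ha haD).add_const _)
  · exact hσ.mul (((((Lp.aestronglyMeasurable (x (ns i)).2).add
      hf.3.1).norm.aemeasurable.pow_const p)).ennreal_ofReal)

end Energy

/-! ### Finite energy and comparison of minimizers -/

section Minimizers

variable {n : ℕ}

set_option hygiene false in
local notation "𝔼" => EuclideanSpace ℝ (Fin n)

variable {p : ℝ} {Ω U D' : Set (EuclideanSpace ℝ (Fin n))}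
  {σ : EuclideanSpace ℝ (Fin n) → ℝ≥0∞} {f u v φ χ : EuclideanSpace ℝ (Fin n) → ℝ} {G : 𝔼 → 𝔼}

lemma tsupport_smul_gradient_subset (φ χ : 𝔼 → ℝ) :
    tsupport (φ • gradient χ) ⊆ tsupport χ :=
  (closure_mono (Function.support_smul_subset_right φ (gradient χ))).trans
    (tsupport_gradient_subset χ)

lemma HasWeakGradient.integrable_smul_smul_gradient (h : HasWeakGradient Ω f G)
    (hφ : IsTestFunction Set.univ φ) (hχ : IsTestFunction Ω χ) :
    Integrable fun x => f x • (φ x • gradient χ x) :=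
  integrableOn_smul_of_locallyIntegrableOn (g := φ • gradient χ) h.1
    (hφ.continuous.smul hχ.continuous_gradient)
    (hχ.2.of_isClosed_subset (isClosed_tsupport _) (tsupport_smul_gradient_subset φ χ))
    ((tsupport_smul_gradient_subset φ χ).trans hχ.3)

lemma HasWeakGradient.integrable_smul_smul_gradient' (h : HasWeakGradient Ω f G)
    (hφ : IsTestFunction Set.univ φ) (hχ : IsTestFunction Ω χ) :
    Integrable fun x => f x • (χ x • gradient φ x) := by
  have hs : tsupport (χ • gradient φ) ⊆ tsupport χ :=
    closure_mono (Function.support_smul_subset_left χ (gradient φ))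
  exact integrableOn_smul_of_locallyIntegrableOn (g := χ • gradient φ) h.1
    (hχ.continuous.smul hφ.continuous_gradient)
    (hχ.2.of_isClosed_subset (isClosed_tsupport _) hs) (hs.trans hχ.3)

lemma IsTestFunction.gradient_mul (hφ : IsTestFunction U φ) (hχ : IsTestFunction Ω χ) (x : 𝔼) :
    gradient (φ * χ) x = φ x • gradient χ x + χ x • gradient φ x := by
  rw [gradient, fderiv_mul (hφ.differentiable x) (hχ.differentiable x), map_add]
  simp [gradient]

/-- Product rule for a weakly differentiable function and a cutoff function. -/
lemma HasWeakGradient.isTestFunction_smul (h : HasWeakGradient Ω f G) (hχ : IsTestFunction Ω χ) :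
    HasWeakGradient Set.univ (fun x => χ x • f x) (fun x => χ x • G x + f x • gradient χ x) := by
  refine of_integral_univ_eq ?_ ?_ fun φ hφ => ?_
  · exact (integrableOn_smul_of_locallyIntegrableOn' h.1 hχ.continuous hχ.2
      hχ.3).locallyIntegrable.locallyIntegrableOn _
  · exact ((h.integrable_smul hχ).add
      (h.integrable_smul_gradient hχ)).locallyIntegrable.locallyIntegrableOn _
  · have hφχ : IsTestFunction Ω (φ * χ) := hχ.mul_left hφ.1
    have h1 := h.integral_univ_eq hφχ
    have hi1 := h.integrable_smul_smul_gradient' hφ hχ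
    have hi2 := h.integrable_smul_smul_gradient hφ hχ
    have hi3 : Integrable fun x => φ x • (χ x • G x) := by
      have := h.integrable_smul hφχ
      simpa [mul_smul] using this
    have e1 : ∀ x, f x • gradient (φ * χ) x =
        f x • (φ x • gradient χ x) + f x • (χ x • gradient φ x) := fun x => by
      rw [hφ.gradient_mul hχ, smul_add]
    have e2 : ∀ x, (φ * χ) x • G x = φ x • (χ x • G x) := fun x => by
      rw [Pi.mul_apply, mul_smul]
    have e3 : ∀ x, (χ x • f x) • gradient φ x = f x • (χ x • gradient φ x) := fun x => by
      rw [smul_eq_mul, mul_comm, mul_smul]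
    have e4 : ∀ x, φ x • (χ x • G x + f x • gradient χ x) =
        φ x • (χ x • G x) + f x • (φ x • gradient χ x) := fun x => by
      rw [smul_add, smul_comm (φ x) (f x)]
    rw [integral_congr_ae (ae_of_all _ e1), integral_congr_ae (ae_of_all _ e2),
      integral_add hi2 hi1] at h1
    rw [integral_congr_ae (ae_of_all _ e3), integral_congr_ae (ae_of_all _ e4),
      integral_add hi3 hi2, neg_add, ← h1]
    abel

lemma memLp_of_support_subset {q : ℝ≥0∞} {F : Type*} [NormedAddCommGroup F] {g : 𝔼 → F}
    (hΩ : MeasurableSet Ω) (hg : MemLp g q (volume.restrict Ω)) (hs : Function.support g ⊆ Ω) :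
    MemLp g q volume := by
  rw [← Set.indicator_eq_self.mpr hs]
  exact (memLp_indicator_iff_restrict hΩ).mpr hg

lemma MemSobolev.memSobolevZero_isTestFunction_smul [Fact (1 ≤ ENNReal.ofReal p)] (hΩ : IsOpen Ω)
    (hf : MemSobolev p Ω f) (hχ : IsTestFunction Ω χ) :
    MemSobolevZero p Ω (fun x => χ x • f x) ∧ HasWeakGradient Ω (fun x => χ x • f x)
      (fun x => χ x • weakGradient Ω f x + f x • gradient χ x) := by
  have hw := hf.hasWeakGradient.isTestFunction_smul hχ
  obtain ⟨A, hA⟩ := hχ.continuous.bounded_above_of_compact_support hχ.2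
  obtain ⟨B, hB⟩ :=
    hχ.continuous_gradient.bounded_above_of_compact_support hχ.hasCompactSupport_gradient
  have hχt : MemLp χ ⊤ (volume.restrict Ω) := hχ.memLp _ _
  have hχt' : MemLp (gradient χ) ⊤ (volume.restrict Ω) := hχ.memLp_gradient _ _
  have hs1 : Function.support χ ⊆ Ω := (subset_tsupport χ).trans hχ.3
  have hs2 : Function.support (gradient χ) ⊆ Ω :=
    (subset_tsupport _).trans ((tsupport_gradient_subset χ).trans hχ.3)
  have hm1 : MemLp (fun x => χ x • f x) (ENNReal.ofReal p) volume :=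
    memLp_of_support_subset hΩ.measurableSet (hf.1.smul (p := ⊤) hχt)
      ((Function.support_smul_subset_left _ _).trans hs1)
  have hm2 : MemLp (fun x => χ x • weakGradient Ω f x) (ENNReal.ofReal p) volume :=
    memLp_of_support_subset hΩ.measurableSet (hf.3.smul (p := ⊤) hχt)
      ((Function.support_smul_subset_left _ _).trans hs1)
  have hm3 : MemLp (fun x => f x • gradient χ x) (ENNReal.ofReal p) volume :=
    memLp_of_support_subset hΩ.measurableSet (hχt'.smul (q := ⊤) hf.1)
      ((Function.support_smul_subset_right f (gradient χ)).trans hs2)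
  obtain ⟨x, hx, hx1, -⟩ := exists_mem_sobolevZero ENNReal.ofReal_ne_top hw hm1 (hm2.add hm3)
    hχ.2 hΩ hχ.3 ((Function.support_smul_subset_left _ _).trans (subset_tsupport χ))
  exact ⟨(memSobolevZero_of_mem_sobolevZero hΩ hx hx1).1, hw.mono (Set.subset_univ _)⟩

open scoped Manifold in
lemma exists_isTestFunction_eq_one {K : Set 𝔼} (hK : IsCompact K) (hΩ : IsOpen Ω) (hKΩ : K ⊆ Ω) :
    ∃ χ, IsTestFunction Ω χ ∧ ∀ x ∈ K, ∀ᶠ y in 𝓝 x, χ y = 1 := by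
  obtain ⟨K₁, hK₁, hKK₁, hK₁Ω⟩ := exists_compact_between hK hΩ hKΩ
  obtain ⟨χ, hχ1, hχ0, -⟩ := exists_contMDiffMap_one_nhds_of_subset_interior (n := (⊤ : ℕ∞)) 𝓘(ℝ, 𝔼)
    hK.isClosed hKK₁
  have hs : tsupport χ ⊆ K₁ := closure_minimal
    (fun x hx => not_not.mp fun h => hx (hχ0 x h)) hK₁.isClosed
  exact ⟨χ, ⟨χ.contMDiff.contDiff, hK₁.of_isClosed_subset (isClosed_tsupport _) hs, hs.trans hK₁Ω⟩,
    fun x hx => hχ1.filter_mono (nhds_le_nhdsSet hx)⟩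

/-- There are competitors of finite energy: cut off the boundary values near `D'`. -/
lemma exists_pEnergy_lt_top [Fact (1 ≤ ENNReal.ofReal p)] (hΩ : IsOpen Ω)
    (hΩb : Bornology.IsBounded Ω) (hp : 1 < p) (hD'Ω : closure D' ⊆ Ω) {M : ℝ}
    (hM : ∀ᵐ x ∂(volume.restrict Ω), x ∉ D' → σ x ≤ ENNReal.ofReal M)
    (hf : MemSobolev p Ω f) : ∃ v, MemSobolevZero p Ω (v - f) ∧ pEnergy p Ω σ v < ⊤ := by
  have hp0 : 0 < p := by linarith
  have hcpt : IsCompact (closure D') := (hΩb.subset (subset_closure.trans hD'Ω)).isCompact_closure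
  obtain ⟨χ, hχ, hχ1⟩ := exists_isTestFunction_eq_one hcpt hΩ hD'Ω
  obtain ⟨h1, h2⟩ := hf.memSobolevZero_isTestFunction_smul hΩ hχ
  have h3 := h1.const_smul hΩ (-1)
  -- The competitor `w + f` is `(1 - χ) f`. It vanishes near `closure D'`, where the convention `∞ *
  -- 0 = 0` makes the energy density zero.
  set w : 𝔼 → ℝ := (-1 : ℝ) • (fun x => χ x • f x) with hw
  have h4 := (h2.const_smul (-1)).add hf.hasWeakGradient
  have h5 : MemSobolev p Ω (w + f) := h3.memSobolev.add hΩ hf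
  refine ⟨w + f, by simpa using h3, ?_⟩
  have hzero : ∀ᵐ x ∂(volume.restrict Ω), x ∈ D' → weakGradient Ω (w + f) x = 0 := by
    filter_upwards [h4.weakGradient_ae_eq hΩ] with x hx hxD
    have hev := hχ1 x (subset_closure hxD)
    have hg : gradient χ x = 0 := by
      have : χ =ᶠ[𝓝 x] fun _ => 1 := hev
      rw [this.gradient_eq, gradient_fun_const]
    rw [hx]
    simp [hg, hev.self_of_nhds]
  have hint : ∫⁻ x in Ω, ENNReal.ofReal (‖weakGradient Ω (w + f) x‖ ^ p) < ⊤ := by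
    have := lintegral_rpow_enorm_lt_top_of_eLpNorm_lt_top (by simpa using hp0)
      ENNReal.ofReal_ne_top h5.3.2
    rw [ENNReal.toReal_ofReal hp0.le] at this
    convert this using 3 with x
    rw [← ENNReal.ofReal_rpow_of_nonneg (norm_nonneg _) hp0.le, ofReal_norm]
  refine lt_of_le_of_lt (lintegral_mono_ae (g := fun x => ENNReal.ofReal M *
    ENNReal.ofReal (‖weakGradient Ω (w + f) x‖ ^ p)) ?_) ?_
  · filter_upwards [hzero, hM] with x hx0 hxM
    by_cases hxD : x ∈ D'
    · simp [hx0 hxD, Real.zero_rpow hp0.ne']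
    · gcongr
      exact hxM hxD
  · rw [lintegral_const_mul' _ _ ENNReal.ofReal_ne_top]
    exact ENNReal.mul_lt_top ENNReal.ofReal_lt_top hint

namespace IsEnergyMinimizer

lemma pEnergy_eq (hu : IsEnergyMinimizer p Ω σ f u) (hv : IsEnergyMinimizer p Ω σ f v) :
    pEnergy p Ω σ u = pEnergy p Ω σ v :=
  le_antisymm (hu.2 v hv.1) (hv.2 u hu.1)

/-- Minimizers have the same gradient where the weight is positive. -/
lemma weakGradient_sub_ae_eq_zero [Fact (1 ≤ ENNReal.ofReal p)] (hΩ : IsOpen Ω)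
    (hσ : AEMeasurable σ (volume.restrict Ω)) (hp : 1 < p) (hf : MemSobolev p Ω f)
    (hu : IsEnergyMinimizer p Ω σ f u) (hv : IsEnergyMinimizer p Ω σ f v)
    (hfin : pEnergy p Ω σ u < ⊤) :
    ∀ᵐ x ∂(volume.restrict Ω), σ x ≠ 0 → weakGradient Ω (v - u) x = 0 := by
  have hp0 : 0 < p := by linarith
  have hsob : MemSobolev p Ω (v - u) := by
    have := hv.1.sub hΩ hu.1
    rw [sub_sub_sub_cancel_right] at this
    exact this.memSobolev
  -- Both energies equal the minimum, so they are within every `δ` of it, and the energy of the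
  -- difference is below every positive `η`.
  have hE : pEnergy p Ω σ (v - u) = 0 := by
    by_contra hne
    obtain ⟨I, hI⟩ : ∃ I : ℝ≥0, (I : ℝ≥0∞) = pEnergy p Ω σ u := ⟨_, ENNReal.coe_toNNReal hfin.ne⟩
    obtain ⟨η, hη0, hη⟩ := ENNReal.lt_iff_exists_nnreal_btwn.mp (pos_iff_ne_zero.mpr hne)
    have hη0' : η ≠ 0 := by
      rintro rfl
      simp at hη0
    obtain ⟨δ, hδ0, hδ⟩ := exists_pEnergy_sub_le hΩ hσ hp hf (I := I)
      (fun w hw => hI ▸ hu.2 w hw) hη0'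
    refine absurd (hδ v u hv.1 hu.1 ?_ ?_) (not_le.mpr hη)
    · rw [← hu.pEnergy_eq hv, ← hI]
      exact le_self_add
    · rw [← hI]
      exact le_self_add
  have hm : AEMeasurable (fun x => σ x * ENNReal.ofReal (‖weakGradient Ω (v - u) x‖ ^ p))
      (volume.restrict Ω) := hσ.mul (hsob.3.1.norm.aemeasurable.pow_const p).ennreal_ofReal
  rw [pEnergy, lintegral_eq_zero_iff' hm] at hE
  filter_upwards [hE] with x hx hσx
  rw [Pi.zero_apply, mul_eq_zero] at hx
  have h1 := hx.resolve_left hσx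
  rw [ENNReal.ofReal_eq_zero] at h1
  have h2 := le_antisymm h1 (by positivity)
  rwa [Real.rpow_eq_zero (norm_nonneg _) hp0.ne', norm_eq_zero] at h2

lemma of_weakGradient_sub_ae_eq_zero [Fact (1 ≤ ENNReal.ofReal p)] (hΩ : IsOpen Ω)
    (hf : MemSobolev p Ω f) (hu : IsEnergyMinimizer p Ω σ f u)
    (hvu : MemSobolevZero p Ω (v - u))
    (h : ∀ᵐ x ∂(volume.restrict Ω), σ x ≠ 0 → weakGradient Ω (v - u) x = 0) :
    IsEnergyMinimizer p Ω σ f v := by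
  have hvf : MemSobolevZero p Ω (v - f) := by
    simpa using hvu.add hΩ hu.1
  refine ⟨hvf, fun w hw => le_trans (le_of_eq ?_) (hu.2 w hw)⟩
  have h1 := (hvu.memSobolev.hasWeakGradient.add
    (hu.1.memSobolev_of_sub hΩ hf).hasWeakGradient)
  rw [sub_add_cancel] at h1
  rw [h1.pEnergy_eq hΩ]
  refine lintegral_congr_ae ?_
  filter_upwards [h] with x hx
  by_cases h0 : σ x = 0
  · simp [h0]
  · simp [hx h0]

/-- Finite energy makes the energy density finite almost everywhere, whereas infinite weight times a
nonzero gradient would be infinite. -/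
lemma hasWeakGradient_zero (hp : 1 < p) (hσ : AEMeasurable σ (volume.restrict Ω))
    (hu : MemSobolev p Ω u) (hD' : D' ⊆ Ω) (hD'o : IsOpen D') (hσD' : ∀ x ∈ D', σ x = ⊤)
    (hfin : pEnergy p Ω σ u < ⊤) : HasWeakGradient D' u 0 := by
  have hp0 : 0 < p := by linarith
  refine (hu.hasWeakGradient.mono hD').congr_ae (ae_eq_refl _) ?_
  have hm : AEMeasurable (fun x => σ x * ENNReal.ofReal (‖weakGradient Ω u x‖ ^ p))
      (volume.restrict Ω) := hσ.mul (hu.3.1.norm.aemeasurable.pow_const p).ennreal_ofReal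
  have h1 := ae_lt_top' hm hfin.ne
  filter_upwards [ae_mono (Measure.restrict_mono hD' le_rfl) h1, ae_restrict_mem hD'o.measurableSet]
    with x hx hxD
  rw [hσD' x hxD] at hx
  by_contra hne
  refine hx.ne (ENNReal.top_mul ?_)
  have : 0 < ‖weakGradient Ω u x‖ := norm_pos_iff.mpr hne
  have : 0 < ‖weakGradient Ω u x‖ ^ p := by positivity
  simpa using this

end IsEnergyMinimizer

end Minimizers

/-! ### The Euler–Lagrange equation -/

section EulerLagrange

variable {n : ℕ}

set_option hygiene false in
local notation "𝔼" => EuclideanSpace ℝ (Fin n)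

/-- For `p < 2` the power `t ^ (p - 2)` is unbounded near `0`; the extra factor `t` tames it. This
controls the flux for every `p > 1`. -/
lemma rpow_sub_two_mul_self_le {p t s : ℝ} (hp : 1 < p) (ht : 0 ≤ t) (hts : t ≤ s) :
    t ^ (p - 2) * t ≤ s ^ (p - 1) := by
  refine le_trans (le_of_eq ?_) (Real.rpow_le_rpow ht hts (by linarith))
  rcases ht.eq_or_lt with rfl | ht
  · rw [mul_zero, Real.zero_rpow (by linarith)]
  · rw [← Real.rpow_add_one ht.ne']
    ring_nf

/-- First variation of the weighted `p`-energy. -/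
lemma integral_inner_eq_zero_of_forall_le {α V : Type*} [MeasurableSpace α] {μ : Measure α}
    [NormedAddCommGroup V] [InnerProductSpace ℝ V] {p : ℝ} (hp : 1 < p) {a : α → ℝ} {M : ℝ}
    {g h : α → V} (ha : AEStronglyMeasurable a μ) (haM : ∀ᵐ x ∂μ, |a x| ≤ M)
    (hg : MemLp g (ENNReal.ofReal p) μ) (hh : MemLp h (ENNReal.ofReal p) μ)
    (hmin : ∀ t : ℝ, ∫ x, a x * ‖g x‖ ^ p ∂μ ≤ ∫ x, a x * ‖g x + t • h x‖ ^ p ∂μ) :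
    ∫ x, inner ℝ ((a x * ‖g x‖ ^ (p - 2)) • g x) (h x) ∂μ = 0 := by
  have hp0 : 0 < p := by linarith
  have hpow : ∀ {k : α → ℝ}, MemLp k (ENNReal.ofReal p) μ → Integrable (fun x => ‖k x‖ ^ p) μ := by
    intro k hk
    have := hk.integrable_norm_rpow (by simpa using hp0) ENNReal.ofReal_ne_top
    rwa [ENNReal.toReal_ofReal hp0.le] at this
  have hm : ∀ t : ℝ, AEStronglyMeasurable (fun x => g x + t • h x) μ := fun t =>
    hg.1.add (hh.1.const_smul t)
  have hderiv : ∀ x, ∀ t : ℝ, HasDerivAt (fun t : ℝ => a x * ‖g x + t • h x‖ ^ p)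
      (a x * (p * ‖g x + t • h x‖ ^ (p - 2) * inner ℝ (g x + t • h x) (h x))) t := by
    intro x t
    have h1 : HasDerivAt (fun t : ℝ => g x + t • h x) (h x) t := by
      simpa using ((hasDerivAt_id t).smul_const (h x)).const_add (g x)
    have h2 := ((hasFDerivAt_norm_rpow (g x + t • h x) hp).comp_hasDerivAt t h1).const_mul (a x)
    exact h2
  -- For `|t| < 1` the derivative in `t` is dominated by the integrable function `M p (‖g‖ + ‖h‖) ^
  -- p`, which permits differentiation under the integral.
  have hbound : ∀ᵐ x ∂μ, ∀ t ∈ Metric.ball (0 : ℝ) 1,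
      ‖a x * (p * ‖g x + t • h x‖ ^ (p - 2) * inner ℝ (g x + t • h x) (h x))‖ ≤
        M * p * ‖‖g x‖ + ‖h x‖‖ ^ p := by
    filter_upwards [haM] with x hx t ht
    have ht1 : |t| ≤ 1 := by simpa using (Metric.mem_ball.mp ht).le
    have h1 : ‖g x + t • h x‖ ≤ ‖g x‖ + ‖h x‖ := by
      refine (norm_add_le _ _).trans ?_
      rw [norm_smul, Real.norm_eq_abs]
      gcongr
      exact mul_le_of_le_one_left (norm_nonneg _) ht1
    have h2 := rpow_sub_two_mul_self_le hp (norm_nonneg _) h1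
    have hM : 0 ≤ M := (abs_nonneg _).trans hx
    have hs : 0 ≤ ‖g x‖ + ‖h x‖ := by positivity
    have h3 : (‖g x‖ + ‖h x‖) ^ (p - 1) * ‖h x‖ ≤ (‖g x‖ + ‖h x‖) ^ p := by
      calc _ ≤ (‖g x‖ + ‖h x‖) ^ (p - 1) * (‖g x‖ + ‖h x‖) := by
            gcongr
            exact le_add_of_nonneg_left (norm_nonneg _)
        _ = (‖g x‖ + ‖h x‖) ^ p := by
            rcases hs.eq_or_lt with h0 | h0
            · rw [← h0, mul_zero, Real.zero_rpow hp0.ne']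
            · rw [← Real.rpow_add_one h0.ne', sub_add_cancel]
    rw [Real.norm_of_nonneg hs, norm_mul, norm_mul, norm_mul, Real.norm_eq_abs, Real.norm_eq_abs,
      abs_of_pos hp0, Real.norm_of_nonneg (by positivity : 0 ≤ ‖g x + t • h x‖ ^ (p - 2))]
    calc |a x| * (p * ‖g x + t • h x‖ ^ (p - 2) * ‖inner ℝ (g x + t • h x) (h x)‖)
        ≤ |a x| * (p * ‖g x + t • h x‖ ^ (p - 2) * (‖g x + t • h x‖ * ‖h x‖)) := by
          gcongr
          exact norm_inner_le_norm _ _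
      _ = |a x| * (p * ((‖g x + t • h x‖ ^ (p - 2) * ‖g x + t • h x‖) * ‖h x‖)) := by ring
      _ ≤ |a x| * (p * ((‖g x‖ + ‖h x‖) ^ (p - 1) * ‖h x‖)) := by gcongr
      _ ≤ M * (p * (‖g x‖ + ‖h x‖) ^ p) := by gcongr
      _ = _ := by ring
  have hint := hasDerivAt_integral_of_dominated_loc_of_deriv_le (μ := μ) (𝕜 := ℝ)
    (F := fun t x => a x * ‖g x + t • h x‖ ^ p)
    (F' := fun t x => a x * (p * ‖g x + t • h x‖ ^ (p - 2) * inner ℝ (g x + t • h x) (h x)))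
    (Metric.ball_mem_nhds (0 : ℝ) one_pos)
    (Eventually.of_forall fun t =>
      ha.mul ((hm t).norm.aemeasurable.pow_const p).aestronglyMeasurable)
    ((hpow (hg.add (hh.const_smul (0 : ℝ))).norm).bdd_mul (c := M) ha haM |>.congr
      (ae_of_all _ fun x => by simp))
    (ha.mul ((((hm 0).norm.aemeasurable.pow_const (p - 2)).aestronglyMeasurable.const_mul p).mul
      ((hm 0).inner hh.1)))
    hbound ((hpow (hg.norm.add hh.norm)).const_mul (M * p)) (ae_of_all _ fun x t _ => hderiv x t)
  have hmin' : IsLocalMin (fun t : ℝ => ∫ x, a x * ‖g x + t • h x‖ ^ p ∂μ) 0 :=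
    Eventually.of_forall fun t => by simpa using hmin t
  have h0 := hmin'.hasDerivAt_eq_zero hint.2
  have h1 : ∀ x, a x * (p * ‖g x + (0 : ℝ) • h x‖ ^ (p - 2) *
      inner ℝ (g x + (0 : ℝ) • h x) (h x)) =
      p * inner ℝ ((a x * ‖g x‖ ^ (p - 2)) • g x) (h x) := fun x => by
    rw [zero_smul, add_zero, real_inner_smul_left]
    ring
  rw [integral_congr_ae (ae_of_all _ h1), integral_const_mul] at h0
  exact (mul_eq_zero.mp h0).resolve_left hp0.ne'

variable {p M : ℝ} {Ω U : Set (EuclideanSpace ℝ (Fin n))}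
  {σ : EuclideanSpace ℝ (Fin n) → ℝ≥0∞} {f u φ : EuclideanSpace ℝ (Fin n) → ℝ}

lemma IsTestFunction.memSobolevZero [Fact (1 ≤ ENNReal.ofReal p)] (hΩ : IsOpen Ω)
    (hφ : IsTestFunction Ω φ) : MemSobolevZero p Ω φ := by
  have hm := hφ.memLp (ENNReal.ofReal p) (volume.restrict Ω)
  have hm' := hφ.memLp_gradient (ENNReal.ofReal p) (volume.restrict Ω)
  exact (memSobolevZero_of_mem_sobolevZero hΩ (x := (hm.toLp, hm'.toLp))
    (Submodule.le_topologicalClosure _ ⟨φ, hφ, hm.coeFn_toLp, hm'.coeFn_toLp⟩) hm.coeFn_toLp).1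

/-- A variation supported in `U` leaves the energy of `Ω \ U` unchanged. That part is finite and
cancels, which removes the region where `σ = ∞` from the comparison. -/
lemma IsEnergyMinimizer.setLIntegral_le [Fact (1 ≤ ENNReal.ofReal p)] (hΩ : IsOpen Ω)
    (hU : IsOpen U) (hUΩ : U ⊆ Ω) (hf : MemSobolev p Ω f) (hu : IsEnergyMinimizer p Ω σ f u)
    (hfin : pEnergy p Ω σ u < ⊤) (hφ : IsTestFunction U φ) (t : ℝ) :
    ∫⁻ x in U, σ x * ENNReal.ofReal (‖weakGradient Ω u x‖ ^ p) ≤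
      ∫⁻ x in U, σ x * ENNReal.ofReal (‖weakGradient Ω u x + t • gradient φ x‖ ^ p) := by
  have hφΩ := hφ.mono hUΩ
  have hadm : MemSobolevZero p Ω (u + t • φ - f) := by
    have := hu.1.add hΩ ((hφΩ.memSobolevZero (p := p) hΩ).const_smul hΩ t)
    rwa [sub_add_eq_add_sub] at this
  have hw := (hu.1.memSobolev_of_sub hΩ hf).hasWeakGradient.add
    ((hφΩ.hasWeakGradient.mono (Set.subset_univ Ω)).const_smul t)
  have hle := hu.2 _ hadm
  rw [hw.pEnergy_eq hΩ] at hle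
  have hoff : ∫⁻ x in Ω \ U, σ x * ENNReal.ofReal
      (‖(weakGradient Ω u + t • gradient φ) x‖ ^ p) =
      ∫⁻ x in Ω \ U, σ x * ENNReal.ofReal (‖weakGradient Ω u x‖ ^ p) := by
    refine setLIntegral_congr_fun (hΩ.measurableSet.diff hU.measurableSet) fun x hx => ?_
    have : gradient φ x = 0 := image_eq_zero_of_notMem_tsupport
      fun h => hx.2 (hφ.3 (tsupport_gradient_subset φ h))
    simp [this]
  have hsplit := fun k : 𝔼 → ℝ≥0∞ =>
    lintegral_inter_add_sdiff (μ := volume) k Ω hU.measurableSet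
  simp only [Set.inter_eq_self_of_subset_right hUΩ] at hsplit
  rw [pEnergy] at hle hfin
  rw [← hsplit, ← hsplit, hoff] at hle
  rw [← hsplit] at hfin
  exact ENNReal.le_of_add_le_add_right (ENNReal.add_lt_top.mp hfin).2.ne hle

lemma integrable_rpow_smul {α V : Type*} [MeasurableSpace α] {μ : Measure α} [IsFiniteMeasure μ]
    [NormedAddCommGroup V] [NormedSpace ℝ V] (hp : 1 < p) {a : α → ℝ}
    {g : α → V} (ha : AEStronglyMeasurable a μ) (haM : ∀ᵐ x ∂μ, |a x| ≤ M)
    (hg : MemLp g (ENNReal.ofReal p) μ) :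
    Integrable (fun x => (a x * ‖g x‖ ^ (p - 2)) • g x) μ := by
  have hp0 : 0 < p := by linarith
  have hi := hg.integrable_norm_rpow (by simpa using hp0) ENNReal.ofReal_ne_top
  rw [ENNReal.toReal_ofReal hp0.le] at hi
  refine (((integrable_const (1 : ℝ)).add hi).const_mul M).mono' ((ha.mul
    (hg.1.norm.aemeasurable.pow_const (p - 2)).aestronglyMeasurable).smul hg.1) ?_
  filter_upwards [haM] with x hx
  rw [norm_smul, norm_mul, Real.norm_eq_abs,
    Real.norm_of_nonneg (by positivity : 0 ≤ ‖g x‖ ^ (p - 2)), mul_assoc]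
  have h1 : ‖g x‖ ^ (p - 2) * ‖g x‖ ≤ 1 + ‖g x‖ ^ p := by
    refine (rpow_sub_two_mul_self_le hp (norm_nonneg _) le_rfl).trans ?_
    rcases le_total ‖g x‖ 1 with h | h
    · have := Real.rpow_le_one (norm_nonneg (g x)) h (by linarith : 0 ≤ p - 1)
      have : 0 ≤ ‖g x‖ ^ p := by positivity
      linarith
    · have := Real.rpow_le_rpow_of_exponent_le h (by linarith : p - 1 ≤ p)
      linarith
  exact mul_le_mul hx h1 (by positivity) ((abs_nonneg _).trans hx)

lemma IsEnergyMinimizer.isWeakSolution [Fact (1 ≤ ENNReal.ofReal p)] (hΩ : IsOpen Ω)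
    (hΩb : Bornology.IsBounded Ω) (hU : IsOpen U) (hUΩ : U ⊆ Ω) (hp : 1 < p)
    (hσ : AEMeasurable σ (volume.restrict Ω))
    (hM : ∀ᵐ x ∂(volume.restrict U), σ x ≤ ENNReal.ofReal M)
    (hf : MemSobolev p Ω f) (hu : IsEnergyMinimizer p Ω σ f u)
    (hfin : pEnergy p Ω σ u < ⊤) : IsWeakSolution p U σ u := by
  have hus := hu.1.memSobolev_of_sub hΩ hf
  have hwU := hus.hasWeakGradient.mono hUΩ
  have hgeq := hwU.weakGradient_ae_eq hU
  have hle := Measure.restrict_mono hUΩ (le_refl (volume : Measure 𝔼))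
  have : IsFiniteMeasure (volume.restrict U) :=
    ⟨by simpa using (hΩb.subset hUΩ).measure_lt_top⟩
  have ha : AEStronglyMeasurable (fun x => (σ x).toReal) (volume.restrict U) :=
    (hσ.mono_measure hle).ennreal_toReal.aestronglyMeasurable
  -- `ENNReal.ofReal` truncates negative numbers, and the sign of `M` is not prescribed, hence `max
  -- M 0`.
  have haM : ∀ᵐ x ∂(volume.restrict U), |(σ x).toReal| ≤ max M 0 := by
    filter_upwards [hM] with x hx
    rw [abs_of_nonneg ENNReal.toReal_nonneg]
    refine (ENNReal.toReal_mono ENNReal.ofReal_ne_top hx).trans_eq ?_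
    rw [ENNReal.toReal_ofReal']
  have hg : MemLp (weakGradient Ω u) (ENNReal.ofReal p) (volume.restrict U) :=
    hus.3.mono_measure hle
  refine ⟨⟨_, hwU⟩, ?_, fun φ hφ => ?_⟩
  · have h1 := integrable_rpow_smul hp ha haM (hg.ae_eq hgeq.symm)
    exact IntegrableOn.locallyIntegrableOn h1
  · have hpow : ∀ {k : 𝔼 → 𝔼}, MemLp k (ENNReal.ofReal p) (volume.restrict U) →
        Integrable (fun x => (σ x).toReal * ‖k x‖ ^ p) (volume.restrict U) := by
      intro k hk
      have := hk.integrable_norm_rpow (by simpa using zero_lt_one.trans hp) ENNReal.ofReal_ne_top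
      rw [ENNReal.toReal_ofReal (zero_le_one.trans hp.le)] at this
      exact this.bdd_mul ha haM
    have hh := hφ.memLp_gradient (ENNReal.ofReal p) (volume.restrict U)
    -- Since `σ` is finite almost everywhere in `U`, the extended energies there are ordinary
    -- integrals, to which the first variation applies.
    have hconv : ∀ {k : 𝔼 → 𝔼}, MemLp k (ENNReal.ofReal p) (volume.restrict U) →
        ∫⁻ x in U, σ x * ENNReal.ofReal (‖k x‖ ^ p) =
          ENNReal.ofReal (∫ x in U, (σ x).toReal * ‖k x‖ ^ p) := by
      intro k hk
      rw [ofReal_integral_eq_lintegral_ofReal (hpow hk) (ae_of_all _ fun x => by positivity)]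
      refine lintegral_congr_ae ?_
      filter_upwards [hM] with x hx
      rw [ENNReal.ofReal_mul ENNReal.toReal_nonneg,
        ENNReal.ofReal_toReal (hx.trans_lt ENNReal.ofReal_lt_top).ne]
    rw [← integral_inner_eq_zero_of_forall_le hp ha haM hg hh fun t => ?_]
    · refine integral_congr_ae ?_
      filter_upwards [hgeq] with x hx
      rw [hx]
    · have h1 := hu.setLIntegral_le hΩ hU hUΩ hf hfin hφ t
      have h2 : MemLp (fun x => weakGradient Ω u x + t • gradient φ x) (ENNReal.ofReal p)
        (volume.restrict U) := hg.add (hh.const_smul t)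
      rwa [hconv hg, hconv h2, ENNReal.ofReal_le_ofReal_iff
        (integral_nonneg fun x => by positivity)] at h1

end EulerLagrange

/-! ### The main theorem -/

theorem mainTheorem4 {n : ℕ} (hn : 1 ≤ n)
    (Ω : Set (EuclideanSpace ℝ (Fin n))) (hΩ_open : IsOpen Ω) (hΩ_bdd : Bornology.IsBounded Ω)
    (σ : EuclideanSpace ℝ (Fin n) → ℝ≥0∞) (hσ : AEMeasurable σ (volume.restrict Ω))
    (D₀ D_inf : Set (EuclideanSpace ℝ (Fin n)))
    (hD₀ : D₀ = levelSet Ω σ 0) (hD_inf : D_inf = levelSet Ω σ ⊤)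
    (hD₀_open : IsOpen D₀) (hD_inf_open : IsOpen D_inf)
    (hdisj : Disjoint (closure D₀) (closure D_inf))
    (hdisj₀ : Disjoint (closure D₀) (frontier Ω))
    (hdisj_inf : Disjoint (closure D_inf) (frontier Ω))
    (hσ_bdd : ∃ m M : ℝ, 0 < m ∧ ∀ᵐ x ∂(volume.restrict (Ω \ (D₀ ∪ D_inf))),
      ENNReal.ofReal m ≤ σ x ∧ σ x ≤ ENNReal.ofReal M)
    (hD₀_lip : HasLipschitzBoundary D₀)
    (p : ℝ) (hp : 1 < p)
    (f : EuclideanSpace ℝ (Fin n) → ℝ) (hf : MemSobolev p Ω f) :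
    (∃ u, IsEnergyMinimizer p Ω σ f u) ∧
    ∀ u, IsEnergyMinimizer p Ω σ f u →
      pEnergy p Ω σ u < ⊤ ∧
      (∀ v, IsEnergyMinimizer p Ω σ f v ↔
        MemSobolevZero p Ω (v - u) ∧
          ∀ᵐ x ∂(volume.restrict (Ω \ D₀)), weakGradient Ω (v - u) x = 0) ∧
      IsWeakSolution p (Ω \ (closure D₀ ∪ closure D_inf)) σ u ∧
      HasWeakGradient D_inf u 0 := by
  have : Fact (1 ≤ ENNReal.ofReal p) := ⟨by simpa using hp.le⟩
  obtain ⟨m, M, hm0, hmM⟩ := hσ_bdd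
  have hmem₀ : ∀ x, x ∈ D₀ ↔ x ∈ Ω ∧ σ x = 0 := fun x => by rw [hD₀]; rfl
  have hmem_inf : ∀ x, x ∈ D_inf ↔ x ∈ Ω ∧ σ x = ⊤ := fun x => by rw [hD_inf]; rfl
  -- A point of `closure D` outside `Ω` would lie in the closure of `Ω` but not in its interior, so
  -- on `frontier Ω`.
  have hclosure : ∀ {D : Set (EuclideanSpace ℝ (Fin n))}, D ⊆ Ω →
      Disjoint (closure D) (frontier Ω) → closure D ⊆ Ω := by
    intro D hD hdis x hx
    by_contra hxΩ
    exact Set.disjoint_left.mp hdis hx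
      ⟨closure_mono hD hx, fun h => hxΩ (interior_subset h)⟩
  have hD₀Ω := hclosure (fun x hx => ((hmem₀ x).mp hx).1) hdisj₀
  have hD_infΩ := hclosure (fun x hx => ((hmem_inf x).mp hx).1) hdisj_inf
  have hΩm := hΩ_open.measurableSet
  have hD₀m := hD₀_open.measurableSet
  rw [ae_restrict_iff' (hΩm.diff (hD₀m.union hD_inf_open.measurableSet))] at hmM
  -- The lower bound extends to `D_inf`, where `σ = ∞`; the upper bound below extends to `D₀`, where
  -- `σ = 0`.
  have hlow : ∀ᵐ x ∂(volume.restrict (Ω \ D₀)), ENNReal.ofReal m ≤ σ x := by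
    rw [ae_restrict_iff' (hΩm.diff hD₀m)]
    filter_upwards [hmM] with x hx hxD
    by_cases hxi : x ∈ D_inf
    · simp [((hmem_inf x).mp hxi).2]
    · exact (hx ⟨hxD.1, fun h => h.elim hxD.2 hxi⟩).1
  have hup : ∀ᵐ x ∂(volume.restrict Ω), x ∉ D_inf → σ x ≤ ENNReal.ofReal M := by
    rw [ae_restrict_iff' hΩm]
    filter_upwards [hmM] with x hx hxΩ hxi
    by_cases hx0 : x ∈ D₀
    · simp [((hmem₀ x).mp hx0).2]
    · exact (hx ⟨hxΩ, fun h => h.elim hx0 hxi⟩).2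
  have hfin := exists_pEnergy_lt_top hΩ_open hΩ_bdd hp hD_infΩ hup hf
  obtain ⟨T, χ, Φ, L, hcover⟩ := hD₀_lip.exists_isReflectionCover hD₀_open
    (hΩ_bdd.subset (subset_closure.trans hD₀Ω))
  refine ⟨hcover.exists_isEnergyMinimizer hD₀_open hΩ_open hΩ_bdd hD₀Ω hσ hp hf
    (fun x hx => ((hmem₀ x).mp hx).2) hm0 hlow hfin, fun u hu => ?_⟩
  have hEu : pEnergy p Ω σ u < ⊤ := by
    obtain ⟨v, hv, hvE⟩ := hfin
    exact (hu.2 v hv).trans_lt hvE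
  -- Within `Ω`, lying outside `D₀` means exactly `σ ≠ 0`, the form in which minimizers were
  -- compared.
  have hae : ∀ w : EuclideanSpace ℝ (Fin n) → EuclideanSpace ℝ (Fin n),
      (∀ᵐ x ∂(volume.restrict (Ω \ D₀)), w x = 0) ↔
        ∀ᵐ x ∂(volume.restrict Ω), σ x ≠ 0 → w x = 0 := fun w => by
    rw [ae_restrict_iff' (hΩm.diff hD₀m), ae_restrict_iff' hΩm]
    refine eventually_congr (Eventually.of_forall fun x => ?_)
    rw [Set.mem_sdiff, hmem₀]
    tauto
  refine ⟨hEu, fun v => ?_, ?_, ?_⟩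
  · rw [hae]
    refine ⟨fun hv => ⟨?_, hu.weakGradient_sub_ae_eq_zero hΩ_open hσ hp hf hv hEu⟩,
      fun hv => hu.of_weakGradient_sub_ae_eq_zero hΩ_open hf hv.1 hv.2⟩
    have := hv.1.sub hΩ_open hu.1
    rwa [sub_sub_sub_cancel_right] at this
  · have hU : IsOpen (Ω \ (closure D₀ ∪ closure D_inf)) :=
      hΩ_open.sdiff (isClosed_closure.union isClosed_closure)
    refine hu.isWeakSolution hΩ_open hΩ_bdd hU Set.sdiff_subset hp hσ (M := M) ?_ hf hEu
    filter_upwards [ae_mono (Measure.restrict_mono Set.sdiff_subset le_rfl) hup,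
      ae_restrict_mem hU.measurableSet] with x hx hxU
    exact hx fun h => hxU.2 (Or.inr (subset_closure h))
  · exact IsEnergyMinimizer.hasWeakGradient_zero hp hσ (hu.1.memSobolev_of_sub hΩ_open hf)
      (subset_closure.trans hD_infΩ) hD_inf_open (fun x hx => ((hmem_inf x).mp hx).2) hEu
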